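/- All objects are $C^\infty$; for 1-forms $\alpha_1,\dots,\alpha_k$, "$\bmod\ \alpha_1,\dots,\alpha_k$" means modulo wedge products having some $\alpha_j$ as a factor. **Monge–Ampère systems.** A Monge–Ampère system $\mathcal I$ on a 5-manifold $M$ is an exterior differential system locally generated by a 1-form $\theta$ with $\theta\wedge d\theta\wedge d\theta\neq0$, the 2-form $\Theta=d\theta$, and a 2-form $\Psi$ linearly independent from $\Theta$ and wedge products involving $\theta$. It is hyperbolic if at each point $(\mu\Theta+\nu\Psi)\wedge(\mu\Theta+\nu\Psi)\equiv0 \bmod \theta$ has two linearly independent real roots $[\mu,\nu]$. Then $\mathcal I$ contains two decomposable 2-forms, independent modulo $\theta$; each of the two characteristic systems of $\mathcal I$ is the rank 3 Pfaffian system spanned by $\theta$ and the factors of one of them. **Parametric Bäcklund transformations.** Let $(M_1,\mathcal I_1)$, $(M_2,\mathcal I_2)$ be hyperbolic Monge–Ampère systems. A parametric Bäcklund transformation between them is a 7-dimensional embedded submanifold $P\subset M_1\times M_2\times\mathbb R$, with projections $\pi_1,\pi_2$ and $\lambda$, such that $d\lambda\ne0$ on $P$ and every slice $P\cap\{\lambda=\lambda_0\}$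 is a (6-dimensional) Bäcklund transformation: $\pi_1,\pi_2$ restrict to submersions on it, and on it (omitting pullbacks) $\{\Theta_1,\Psi_1\}$ and $\{\Theta_2,\Psi_2\}$ have the same span modulo $\theta_1,\theta_2$, while $\Theta_1,\Theta_2$ are linearly independent modulo $\theta_1,\theta_2$. Let $\mathcal C_{i1},\mathcal C_{i2}$ be the characteristic systems of $\mathcal I_i$, smooth on $M_i$ and numbered so that $\pi_1^*\mathcal C_{11}\equiv\pi_2^*\mathcal C_{21}$ and $\pi_1^*\mathcal C_{12}\equiv\pi_2^*\mathcal C_{22}$ modulo $\theta_1,\theta_2,d\lambda$ on $P$. **The canonical $G$-structure.** Let $\mathcal G$ be the bundle over $P$ whose local sections are the local coframings $(\zeta,\theta_1,\theta_2,\omega^1,\omega^2,\omega^3,\omega^4)$ of $P$ such that $\zeta$ is a multiple of $d\lambda$, $\theta_i$ is a multiple of the pullback of a contact form of $\mathcal I_i$, and, for some functions $A_i,D_i$, $$\begin{aligned} d\theta_1&\equiv A_1\,\omega^1\wedge\omega^2+\omega^3\wedge\omega^4+\zeta\wedge(D_3\omega^3+D_4\omega^4) \bmod \theta_1,\\ d\theta_2&\equiv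 \omega^1\wedge\omega^2+A_2\,\omega^3\wedge\omega^4+\zeta\wedge(D_1\omega^1+D_2\omega^2)\bmod\theta_2,\end{aligned}$$ $$\pi_1^*\mathcal C_{11}=\{\theta_1,\omega^1,\omega^2\},\quad \pi_2^*\mathcal C_{22}=\{\theta_2,\omega^3,\omega^4\},\quad \pi_1^*\mathcal C_{12}=\{\theta_1,\tilde\omega^3,\tilde\omega^4\},\quad \pi_2^*\mathcal C_{21}=\{\theta_2,\tilde\omega^1,\tilde\omega^2\},$$ where $\tilde\omega^1=\omega^1+D_2\zeta$, $\tilde\omega^2=\omega^2-D_1\zeta$, $\tilde\omega^3=\omega^3+D_4\zeta$, $\tilde\omega^4=\omega^4-D_3\zeta$ and braces denote spans. The torsion coefficients $B_i,C_i,E_i$ are the functions on $\mathcal G$ given, along each local section, by $$\begin{aligned} d\omega^i&\equiv B_i\,\theta_1\wedge\theta_2+C_i\,\tilde\omega^3\wedge\tilde\omega^4+E_i\,\zeta\wedge\theta_1 \bmod \omega^1,\omega^2 &&(i=1,2),\\ d\omega^i&\equiv B_i\,\theta_1\wedge\theta_2+C_i\,\tilde\omega^1\wedge\tilde\omega^2+E_i\,\zeta\wedge\theta_2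 \bmod \omega^3,\omega^4 &&(i=3,4).\end{aligned}$$ **Theorem.** Suppose that at each point of $\mathcal G$ the vectors $[B_1\ B_2]$ and $[E_1\ E_2]$ are scalar multiples of $[C_1\ C_2]$, and at least two of these three vectors are nonzero. Then each of $\mathcal C_{11}$ and $\mathcal C_{21}$ contains a one-dimensional integrable subsystem locally: for every $p\in P$, the point $\pi_1(p)$ (respectively $\pi_2(p)$) has an open neighborhood in $M_1$ (respectively $M_2$) carrying a nowhere vanishing smooth 1-form $\kappa$ that is a section of $\mathcal C_{11}$ (respectively $\mathcal C_{21}$) and satisfies $d\kappa\equiv0\bmod\kappa$. Likewise, if at each point of $\mathcal G$ the vectors $[B_3\ B_4]$ and $[E_3\ E_4]$ are scalar multiples of $[C_3\ C_4]$, and at least two of these three vectors are nonzero, then $\mathcal C_{12}$ and $\mathcal C_{22}$ contain one-dimensional integrable subsystems in the same local sense, near $\pi_1(p)$ and $\pi_2(p)$ respectively for every $p\in P$. -/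

import Mathlib

open scoped Manifold ContDiff

noncomputable section

namespace Backlund

/-! ### Linear algebra of one- and two-forms at a point -/

/-- The model space `ℝⁿ`. In Mathlib every tangent space of a manifold modelled on `ℝⁿ` is, by
definition, this space (a tangent vector at `x` is read in the preferred chart at `x`), so that
covectors and bilinear forms on it are covectors and bilinear forms at a point. -/
abbrev E (n : ℕ) : Type := EuclideanSpace ℝ (Fin n)

/-- Covectors. -/
abbrev Cov (n : ℕ) : Type := E n →L[ℝ] ℝ

/-- Bilinear forms; two-covectors are the alternating ones. -/
abbrev Bil (n : ℕ) : Type := E n →L[ℝ] E n →L[ℝ] ℝ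

/-- `(a ∧ b)(v, w) = a(v) b(w) - b(v) a(w)`. -/
def wedge {n : ℕ} (a b : Cov n) : Bil n := a.smulRight b - b.smulRight a

/-- The two-covectors that are congruent to zero modulo the covectors in `S`: the linear span of
all wedge products having a factor in `S`. So `α ≡ β mod S` is `α - β ∈ wedgeIdeal S`. -/
def wedgeIdeal {n : ℕ} (S : Set (Cov n)) : Submodule ℝ (Bil n) :=
  Submodule.span ℝ {β | ∃ a ∈ S, ∃ c : Cov n, β = wedge a c}

/-- One half of the four-form `β ∧ β`. -/
def sqForm {n : ℕ} (β : Bil n) (v : Fin 4 → E n) : ℝ :=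
  β (v 0) (v 1) * β (v 2) (v 3) - β (v 0) (v 2) * β (v 1) (v 3) + β (v 0) (v 3) * β (v 1) (v 2)

/-- One half of the five-form `a ∧ β ∧ β`. -/
def fiveForm {n : ℕ} (a : Cov n) (β : Bil n) (v : Fin 5 → E n) : ℝ :=
  ∑ i : Fin 5, (-1) ^ (i : ℕ) * a (v i) * sqForm β (fun j => v (i.succAbove j))

/-- Pull-back of a bilinear form under a linear map. -/
def pullBil {m n : ℕ} (T : E m →L[ℝ] E n) : Bil n →ₗ[ℝ] Bil m where
  toFun β := β.bilinearComp T T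
  map_add' _ _ := rfl
  map_smul' _ _ := rfl

/-- Pull-back of a covector under a linear map. -/
def pullCov {m n : ℕ} (T : E m →L[ℝ] E n) : Cov n →ₗ[ℝ] Cov m where
  toFun a := a.comp T
  map_add' _ _ := rfl
  map_smul' _ _ := rfl

/-! ### Differential forms on manifolds -/

section Forms

variable {n : ℕ} {M : Type*} [TopologicalSpace M] [ChartedSpace (E n) M]

/-- The differential at `y` of the inverse of the preferred chart around `x₀`. -/
def dChartSymm (x₀ : M) (y : E n) : E n →L[ℝ] E n :=
  mfderiv (𝓡 n) (𝓡 n) (extChartAt (𝓡 n) x₀).symm y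

/-- The one-form `α` written in the preferred chart around `x₀`. -/
def readOne (α : M → Cov n) (x₀ : M) (y : E n) : Cov n :=
  pullCov (dChartSymm x₀ y) (α ((extChartAt (𝓡 n) x₀).symm y))

/-- The two-form `β` written in the preferred chart around `x₀`. -/
def readTwo (β : M → Bil n) (x₀ : M) (y : E n) : Bil n :=
  pullBil (dChartSymm x₀ y) (β ((extChartAt (𝓡 n) x₀).symm y))

/-- The one-form `α` is smooth on the open set `U`. -/
def SmoothOneOn (α : M → Cov n) (U : Set M) : Prop :=
  ∀ x ∈ U, ContDiffAt ℝ ∞ (readOne α x) (extChartAt (𝓡 n) x x)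

/-- The two-form `β` is smooth on the open set `U`. -/
def SmoothTwoOn (β : M → Bil n) (U : Set M) : Prop :=
  ∀ x ∈ U, ContDiffAt ℝ ∞ (readTwo β x) (extChartAt (𝓡 n) x x)

/-- The exterior derivative of a one-form, computed at `x` in the preferred chart around `x`:
`dα(v, w) = (∂_v α)(w) - (∂_w α)(v)`. -/
def extD (α : M → Cov n) (x : M) : Bil n :=
  fderiv ℝ (readOne α x) (extChartAt (𝓡 n) x x) -
    (fderiv ℝ (readOne α x) (extChartAt (𝓡 n) x x)).flip

/-- A smooth Pfaffian system of rank `k`: locally spanned by `k` pointwise independent smooth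
one-forms. -/
def IsPfaffian (k : ℕ) (C : M → Submodule ℝ (Cov n)) : Prop :=
  ∀ x : M, ∃ U : Set M, IsOpen U ∧ x ∈ U ∧ ∃ α : Fin k → M → Cov n,
    (∀ i, SmoothOneOn (α i) U) ∧
    ∀ y ∈ U, LinearIndependent ℝ (fun i => α i y) ∧
      C y = Submodule.span ℝ (Set.range fun i => α i y)

/-- Near `x` the system `C` contains a one-dimensional integrable subsystem: the span of a nowhere
vanishing smooth one-form `κ`, a section of `C`, with `dκ ≡ 0 mod κ`. -/
def HasIntegrableLineNear (C : M → Submodule ℝ (Cov n)) (x : M) : Prop :=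
  ∃ V : Set M, IsOpen V ∧ x ∈ V ∧ ∃ κ : M → Cov n, SmoothOneOn κ V ∧
    ∀ y ∈ V, κ y ≠ 0 ∧ κ y ∈ C y ∧ extD κ y ∈ wedgeIdeal {κ y}

end Forms

/-! ### Monge-Ampère systems -/

section MongeAmpere

variable {M : Type*} [TopologicalSpace M] [ChartedSpace (E 5) M]

/-- On `U`, the exterior ideal with degree-one part `one` and degree-two part `two` is generated by
the contact form `θ`, the two-form `dθ` and a two-form `Ψ` that is linearly independent of `dθ` and
of the wedge products involving `θ`. -/
structure IsGenerators (one : M → Submodule ℝ (Cov 5)) (two : M → Submodule ℝ (Bil 5))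
    (U : Set M) (θ : M → Cov 5) (Ψ : M → Bil 5) : Prop where
  smooth_one : SmoothOneOn θ U
  smooth_two : SmoothTwoOn Ψ U
  alternating : ∀ x ∈ U, ∀ v, Ψ x v v = 0
  contact : ∀ x ∈ U, fiveForm (θ x) (extD θ x) ≠ 0
  indep : ∀ x ∈ U, Ψ x ∉ Submodule.span ℝ {extD θ x} ⊔ wedgeIdeal {θ x}
  one_eq : ∀ x ∈ U, one x = Submodule.span ℝ {θ x}
  two_eq : ∀ x ∈ U, two x = Submodule.span ℝ {extD θ x, Ψ x} ⊔ wedgeIdeal {θ x}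

variable (M) in
/-- A Monge-Ampère system on a 5-manifold, given by the degree-one part (the contact line) and the
degree-two part of the ideal at each point. The parts of degree at least three of an ideal locally
generated by `θ`, `dθ`, `Ψ` are determined by these, and closure under `d` is automatic, because
every three-form on a 5-manifold lies in the algebraic ideal generated by `θ` and `dθ`. -/
structure MASystem where
  one : M → Submodule ℝ (Cov 5)
  two : M → Submodule ℝ (Bil 5)
  locally_generated : ∀ x : M, ∃ U : Set M, IsOpen U ∧ x ∈ U ∧
    ∃ (θ : M → Cov 5) (Ψ : M → Bil 5), IsGenerators one two U θ Ψ

/-- Hyperbolicity: at each point the homogeneous quadratic equation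
`(μ dθ + ν Ψ) ∧ (μ dθ + ν Ψ) ≡ 0 mod θ` has two linearly independent real roots. (A four-form is
`≡ 0 mod θ` exactly when it vanishes on the kernel of `θ`.) -/
def MASystem.Hyperbolic (I : MASystem M) : Prop :=
  ∀ x : M, ∃ U : Set M, IsOpen U ∧ x ∈ U ∧
    ∃ (θ : M → Cov 5) (Ψ : M → Bil 5), IsGenerators I.one I.two U θ Ψ ∧
      ∃ μ ν : Fin 2 → ℝ, μ 0 * ν 1 - μ 1 * ν 0 ≠ 0 ∧
        ∀ i, ∀ v : Fin 4 → E 5, (∀ j, θ x (v j) = 0) →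
          sqForm (μ i • extD θ x + ν i • Ψ x) v = 0

/-- `C` and `C'` are the two Monge characteristic systems of `I`: smooth rank 3 Pfaffian systems
which at each point are spanned by the contact line and the factors of the first, respectively the
second, of two decomposable two-forms of `I` that are linearly independent modulo the contact
form. -/
structure MASystem.IsCharacteristic (I : MASystem M) (C C' : M → Submodule ℝ (Cov 5)) : Prop where
  pfaffian_fst : IsPfaffian 3 C
  pfaffian_snd : IsPfaffian 3 C'
  factors : ∀ x : M, ∃ a b c d : Cov 5, wedge a b ∈ I.two x ∧ wedge c d ∈ I.two x ∧
    (∀ s t : ℝ, s • wedge a b + t • wedge c d ∈ wedgeIdeal (I.one x : Set (Cov 5)) →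
      s = 0 ∧ t = 0) ∧
    C x = I.one x ⊔ Submodule.span ℝ {a, b} ∧ C' x = I.one x ⊔ Submodule.span ℝ {c, d}

end MongeAmpere

/-! ### Parametric Bäcklund transformations -/

section Backlund

variable (M₁ M₂ P : Type*)
  [TopologicalSpace M₁] [ChartedSpace (E 5) M₁]
  [TopologicalSpace M₂] [ChartedSpace (E 5) M₂]
  [TopologicalSpace P] [ChartedSpace (E 7) P]

/-- The data underlying a parametric Bäcklund transformation: Monge-Ampère systems on `M₁`, `M₂`,
two Pfaffian systems on each (to be their characteristic systems `𝒞₁₁, 𝒞₁₂` and `𝒞₂₁, 𝒞₂₂`), and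
the three components of a map `P → M₁ × M₂ × ℝ`. -/
structure Data where
  I₁ : MASystem M₁
  I₂ : MASystem M₂
  C₁₁ : M₁ → Submodule ℝ (Cov 5)
  C₁₂ : M₁ → Submodule ℝ (Cov 5)
  C₂₁ : M₂ → Submodule ℝ (Cov 5)
  C₂₂ : M₂ → Submodule ℝ (Cov 5)
  π₁ : P → M₁
  π₂ : P → M₂
  lam : P → ℝ

variable {M₁ M₂ P}

namespace Data

variable (𝓓 : Data M₁ M₂ P)

/-- The differential of `π₁` at `p`. -/
def dπ₁ (p : P) : E 7 →L[ℝ] E 5 := mfderiv (𝓡 7) (𝓡 5) 𝓓.π₁ p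

/-- The differential of `π₂` at `p`. -/
def dπ₂ (p : P) : E 7 →L[ℝ] E 5 := mfderiv (𝓡 7) (𝓡 5) 𝓓.π₂ p

/-- The differential of the parameter `λ` at `p`; its kernel is the tangent space at `p` of the
slice of `P` through `p` on which `λ` is constant. -/
def dlam (p : P) : Cov 7 := mfderiv (𝓡 7) 𝓘(ℝ, ℝ) 𝓓.lam p

/-- Pull-back to `P` of a Pfaffian system on `M₁`. -/
def pull₁ (C : M₁ → Submodule ℝ (Cov 5)) (p : P) : Submodule ℝ (Cov 7) :=
  (C (𝓓.π₁ p)).map (pullCov (𝓓.dπ₁ p))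

/-- Pull-back to `P` of a Pfaffian system on `M₂`. -/
def pull₂ (C : M₂ → Submodule ℝ (Cov 5)) (p : P) : Submodule ℝ (Cov 7) :=
  (C (𝓓.π₂ p)).map (pullCov (𝓓.dπ₂ p))

/-- `𝒦`, the span of the two pulled back contact forms and of `dλ`. -/
def K (p : P) : Submodule ℝ (Cov 7) :=
  𝓓.pull₁ 𝓓.I₁.one p ⊔ 𝓓.pull₂ 𝓓.I₂.one p ⊔ Submodule.span ℝ {𝓓.dlam p}

/-- `P`, as a 7-dimensional submanifold of `M₁ × M₂ × ℝ` with coordinate `λ` on the last factor,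
is a parametric Bäcklund transformation between the two hyperbolic Monge-Ampère systems: every
slice `λ = const` is a non-parametric Bäcklund transformation.

Conditions on a slice are conditions on the kernel of `dλ`. In particular congruences between
forms on a slice modulo the two contact forms are congruences on `P` modulo `𝒦`. -/
structure IsParametricBacklund : Prop where
  hyperbolic₁ : 𝓓.I₁.Hyperbolic
  hyperbolic₂ : 𝓓.I₂.Hyperbolic
  characteristic₁ : 𝓓.I₁.IsCharacteristic 𝓓.C₁₁ 𝓓.C₁₂
  characteristic₂ : 𝓓.I₂.IsCharacteristic 𝓓.C₂₁ 𝓓.C₂₂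
  /-- `P` is a smoothly embedded submanifold of `M₁ × M₂ × ℝ`. -/
  smooth_π₁ : ContMDiff (𝓡 7) (𝓡 5) ∞ 𝓓.π₁
  smooth_π₂ : ContMDiff (𝓡 7) (𝓡 5) ∞ 𝓓.π₂
  smooth_lam : ContMDiff (𝓡 7) 𝓘(ℝ, ℝ) ∞ 𝓓.lam
  embedding : Topology.IsEmbedding fun p => (𝓓.π₁ p, 𝓓.π₂ p, 𝓓.lam p)
  immersion : ∀ p v, 𝓓.dπ₁ p v = 0 → 𝓓.dπ₂ p v = 0 → 𝓓.dlam p v = 0 → v = 0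
  /-- The slices are 6-dimensional submanifolds. -/
  dlam_ne_zero : ∀ p, 𝓓.dlam p ≠ 0
  /-- The projections of each slice to `M₁` and `M₂` are submersions. -/
  submersion₁ : ∀ p w, ∃ v, 𝓓.dlam p v = 0 ∧ 𝓓.dπ₁ p v = w
  submersion₂ : ∀ p w, ∃ v, 𝓓.dlam p v = 0 ∧ 𝓓.dπ₂ p v = w
  /-- On each slice `{dθ₁, Ψ₁}` and `{dθ₂, Ψ₂}` have the same span modulo `θ₁, θ₂`. -/
  same_span : ∀ p,
    (𝓓.I₁.two (𝓓.π₁ p)).map (pullBil (𝓓.dπ₁ p)) ⊔ wedgeIdeal (𝓓.K p : Set (Cov 7)) =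
      (𝓓.I₂.two (𝓓.π₂ p)).map (pullBil (𝓓.dπ₂ p)) ⊔ wedgeIdeal (𝓓.K p : Set (Cov 7))
  /-- On each slice `dθ₁` and `dθ₂` are linearly independent modulo `θ₁, θ₂`. -/
  indep : ∀ p, ∀ (U₁ : Set M₁) (U₂ : Set M₂) (θ₁ : M₁ → Cov 5) (Ψ₁ : M₁ → Bil 5)
    (θ₂ : M₂ → Cov 5) (Ψ₂ : M₂ → Bil 5),
    IsOpen U₁ → 𝓓.π₁ p ∈ U₁ → IsGenerators 𝓓.I₁.one 𝓓.I₁.two U₁ θ₁ Ψ₁ →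
    IsOpen U₂ → 𝓓.π₂ p ∈ U₂ → IsGenerators 𝓓.I₂.one 𝓓.I₂.two U₂ θ₂ Ψ₂ →
    ∀ s t : ℝ, s • pullBil (𝓓.dπ₁ p) (extD θ₁ (𝓓.π₁ p)) +
        t • pullBil (𝓓.dπ₂ p) (extD θ₂ (𝓓.π₂ p)) ∈ wedgeIdeal (𝓓.K p : Set (Cov 7)) →
      s = 0 ∧ t = 0
  /-- The characteristic systems are numbered so that `𝒞₁₁ ≡ 𝒞₂₁` and `𝒞₁₂ ≡ 𝒞₂₂` mod `𝒦`. -/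
  numbering₁ : ∀ p, 𝓓.pull₁ 𝓓.C₁₁ p ⊔ 𝓓.K p = 𝓓.pull₂ 𝓓.C₂₁ p ⊔ 𝓓.K p
  numbering₂ : ∀ p, 𝓓.pull₁ 𝓓.C₁₂ p ⊔ 𝓓.K p = 𝓓.pull₂ 𝓓.C₂₂ p ⊔ 𝓓.K p

end Data

/-! ### The canonical `G`-structure and its torsion -/

variable (P) in
/-- A 7-tuple of one-forms `(ζ, θ₁, θ₂, ω¹, ω², ω³, ω⁴)` on `P`. -/
structure Coframing where
  ζ : P → Cov 7
  θ₁ : P → Cov 7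
  θ₂ : P → Cov 7
  ω₁ : P → Cov 7
  ω₂ : P → Cov 7
  ω₃ : P → Cov 7
  ω₄ : P → Cov 7

namespace Coframing

/-- The value of the 7-tuple at a point. -/
def value (σ : Coframing P) (p : P) : Fin 7 → Cov 7 :=
  ![σ.ζ p, σ.θ₁ p, σ.θ₂ p, σ.ω₁ p, σ.ω₂ p, σ.ω₃ p, σ.ω₄ p]

/-- `ω̃¹ = ω¹ + D₂ ζ` at `p`, where `D i` stands for `D_{i+1}`. -/
def ωt₁ (σ : Coframing P) (D : Fin 4 → ℝ) (p : P) : Cov 7 := σ.ω₁ p + D 1 • σ.ζ p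

/-- `ω̃² = ω² - D₁ ζ`. -/
def ωt₂ (σ : Coframing P) (D : Fin 4 → ℝ) (p : P) : Cov 7 := σ.ω₂ p - D 0 • σ.ζ p

/-- `ω̃³ = ω³ + D₄ ζ`. -/
def ωt₃ (σ : Coframing P) (D : Fin 4 → ℝ) (p : P) : Cov 7 := σ.ω₃ p + D 3 • σ.ζ p

/-- `ω̃⁴ = ω⁴ - D₃ ζ`. -/
def ωt₄ (σ : Coframing P) (D : Fin 4 → ℝ) (p : P) : Cov 7 := σ.ω₄ p - D 2 • σ.ζ p

end Coframing

namespace Data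

variable (𝓓 : Data M₁ M₂ P)

/-- `σ` is on `U` a smooth local section of the `G`-structure, with coefficients `A₁, A₂` and
`D₁, …, D₄`. That `dζ ≡ 0 mod ζ` is automatic, since `ζ` is a multiple of `dλ`. -/
structure IsSection (U : Set P) (σ : Coframing P) (A : P → Fin 2 → ℝ) (D : P → Fin 4 → ℝ) :
    Prop where
  smooth_ζ : SmoothOneOn σ.ζ U
  smooth_θ₁ : SmoothOneOn σ.θ₁ U
  smooth_θ₂ : SmoothOneOn σ.θ₂ U
  smooth_ω₁ : SmoothOneOn σ.ω₁ U
  smooth_ω₂ : SmoothOneOn σ.ω₂ U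
  smooth_ω₃ : SmoothOneOn σ.ω₃ U
  smooth_ω₄ : SmoothOneOn σ.ω₄ U
  coframe : ∀ p ∈ U, LinearIndependent ℝ (σ.value p)
  /-- `ζ` pulls back to zero on every slice. -/
  ζ_mem : ∀ p ∈ U, σ.ζ p ∈ Submodule.span ℝ {𝓓.dlam p}
  /-- `θ₁, θ₂` are multiples of the pulled back contact forms. -/
  θ₁_mem : ∀ p ∈ U, σ.θ₁ p ∈ 𝓓.pull₁ 𝓓.I₁.one p
  θ₂_mem : ∀ p ∈ U, σ.θ₂ p ∈ 𝓓.pull₂ 𝓓.I₂.one p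
  C₁₁_eq : ∀ p ∈ U, 𝓓.pull₁ 𝓓.C₁₁ p = Submodule.span ℝ {σ.θ₁ p, σ.ω₁ p, σ.ω₂ p}
  C₂₂_eq : ∀ p ∈ U, 𝓓.pull₂ 𝓓.C₂₂ p = Submodule.span ℝ {σ.θ₂ p, σ.ω₃ p, σ.ω₄ p}
  /-- `dθ₁ ≡ A₁ ω¹∧ω² + ω³∧ω⁴ + ζ∧(D₃ω³ + D₄ω⁴) mod θ₁`. -/
  dθ₁_eq : ∀ p ∈ U, extD σ.θ₁ p -
    (A p 0 • wedge (σ.ω₁ p) (σ.ω₂ p) + wedge (σ.ω₃ p) (σ.ω₄ p) +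
      wedge (σ.ζ p) (D p 2 • σ.ω₃ p + D p 3 • σ.ω₄ p)) ∈ wedgeIdeal {σ.θ₁ p}
  /-- `dθ₂ ≡ ω¹∧ω² + A₂ ω³∧ω⁴ + ζ∧(D₁ω¹ + D₂ω²) mod θ₂`. -/
  dθ₂_eq : ∀ p ∈ U, extD σ.θ₂ p -
    (wedge (σ.ω₁ p) (σ.ω₂ p) + A p 1 • wedge (σ.ω₃ p) (σ.ω₄ p) +
      wedge (σ.ζ p) (D p 0 • σ.ω₁ p + D p 1 • σ.ω₂ p)) ∈ wedgeIdeal {σ.θ₂ p}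
  C₁₂_eq : ∀ p ∈ U, 𝓓.pull₁ 𝓓.C₁₂ p =
    Submodule.span ℝ {σ.θ₁ p, σ.ωt₃ (D p) p, σ.ωt₄ (D p) p}
  C₂₁_eq : ∀ p ∈ U, 𝓓.pull₂ 𝓓.C₂₁ p =
    Submodule.span ℝ {σ.θ₂ p, σ.ωt₁ (D p) p, σ.ωt₂ (D p) p}

/-- The fibre over `p` of the canonical `G`-structure: the coframes at `p` that are values of its
local sections. -/
def 𝒢 (p : P) : Set (Fin 7 → Cov 7) :=
  {u | ∃ (U : Set P) (σ : Coframing P) (A : P → Fin 2 → ℝ) (D : P → Fin 4 → ℝ),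
    IsOpen U ∧ p ∈ U ∧ 𝓓.IsSection U σ A D ∧ σ.value p = u}

/-- `[B₁ B₂]`, `[C₁ C₂]`, `[E₁ E₂]` are the values at the point `u` of `𝒢` over `p` of these
torsion vectors: for a local section through `u`,
`dωⁱ ≡ Bᵢ θ₁∧θ₂ + Cᵢ ω̃³∧ω̃⁴ + Eᵢ ζ∧θ₁ mod ω¹, ω²` at `p`, `i = 1, 2`. -/
def IsTorsion₁₂ (p : P) (u : Fin 7 → Cov 7) (B C E : Fin 2 → ℝ) : Prop :=
  ∃ (U : Set P) (σ : Coframing P) (A : P → Fin 2 → ℝ) (D : P → Fin 4 → ℝ),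
    IsOpen U ∧ p ∈ U ∧ 𝓓.IsSection U σ A D ∧ σ.value p = u ∧
    ∀ i : Fin 2, extD (![σ.ω₁, σ.ω₂] i) p -
      (B i • wedge (σ.θ₁ p) (σ.θ₂ p) + C i • wedge (σ.ωt₃ (D p) p) (σ.ωt₄ (D p) p) +
        E i • wedge (σ.ζ p) (σ.θ₁ p)) ∈ wedgeIdeal {σ.ω₁ p, σ.ω₂ p}

/-- `[B₃ B₄]`, `[C₃ C₄]`, `[E₃ E₄]` are the values at the point `u` of `𝒢` over `p` of these
torsion vectors: for a local section through `u`,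
`dωⁱ ≡ Bᵢ θ₁∧θ₂ + Cᵢ ω̃¹∧ω̃² + Eᵢ ζ∧θ₂ mod ω³, ω⁴` at `p`, `i = 3, 4`. -/
def IsTorsion₃₄ (p : P) (u : Fin 7 → Cov 7) (B C E : Fin 2 → ℝ) : Prop :=
  ∃ (U : Set P) (σ : Coframing P) (A : P → Fin 2 → ℝ) (D : P → Fin 4 → ℝ),
    IsOpen U ∧ p ∈ U ∧ 𝓓.IsSection U σ A D ∧ σ.value p = u ∧
    ∀ i : Fin 2, extD (![σ.ω₃, σ.ω₄] i) p -
      (B i • wedge (σ.θ₁ p) (σ.θ₂ p) + C i • wedge (σ.ωt₁ (D p) p) (σ.ωt₂ (D p) p) +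
        E i • wedge (σ.ζ p) (σ.θ₂ p)) ∈ wedgeIdeal {σ.ω₃ p, σ.ω₄ p}

end Data

/-- `B` and `E` are linearly dependent on `C`, and at least two of the three are nonzero. -/
def DependentOn (B C E : Fin 2 → ℝ) : Prop :=
  (∃ b : ℝ, B = b • C) ∧ (∃ e : ℝ, E = e • C) ∧
    ((B ≠ 0 ∧ C ≠ 0) ∨ (C ≠ 0 ∧ E ≠ 0) ∨ (B ≠ 0 ∧ E ≠ 0))

end Backlund

end Backlund

end

namespace Backlund

open Filter Topology

/-! ### One-forms on `ℝⁿ` -/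

section Flat

variable {m n : ℕ}

/-! Only the statement about `𝒞₁₁` and `𝒞₂₁` needs an argument. The other one is the same statement
with `M₁` and `M₂` interchanged (`Data.swap`); this turns `θ₁∧θ₂` into its negative, hence `B` into
`-B`, which does not affect linear dependence.

The heart is a computation on `P`. If `B = b C` and `E = e C`, then modulo `ω¹, ω²` the structure
equations read `dω¹ ≡ C₁ Ξ` and `dω² ≡ C₂ Ξ` with one two-form `Ξ = b θ₁∧θ₂ + ω̃³∧ω̃⁴ + e ζ∧θ₁`.
That two of the three vectors are nonzero means `C ≠ 0` and `(b, e) ≠ 0`, so `Ξ` has rank four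
modulo `ω¹, ω²`. Put `η = C₂ω¹ - C₁ω²`. Then `dη ≡ 0 mod ω¹, ω²`, say `dη = ω¹∧γ + ω²∧δ`, and `d(dη)
= 0` gives `Ξ∧(C₁γ + C₂δ) ≡ 0`. Wedging covectors with a form of rank four is injective
(`eq_zero_of_cyclic`), so `C₁γ + C₂δ ≡ 0 mod ω¹, ω²`, and this is what makes `dη ≡ 0 mod η`
(`exists_integrable_combination`).

To bring `η` down to `Mᵢ`, pull it back along a local section `s` of `πᵢ` with values in the slice
of constant `λ` through `p`. On that slice `ζ = 0` and `ωⁱ = ω̃ⁱ`, so the single form `η` serves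
both systems: it lies in `π₁*𝒞₁₁` and, modulo `dλ`, in `π₂*𝒞₂₁`. Hence `s*η` is a nowhere vanishing
section of `𝒞ᵢ₁`, and it is integrable because `d` commutes with pull-back
(`hasIntegrableLineNear_of_form`). Invariance of `η` along the fibres of `πᵢ` is not needed.

Since the hypothesis concerns points of `𝒢`, a local section whose torsion has the prescribed shape
must be produced. Coframes adapted to the characteristic systems exist on each `Mᵢ` because `dθᵢ` is
nondegenerate on the contact distribution (`contact_nondegenerate`). Pulled back to `P` they combine
to a coframe, the key point being `eq_zero_of_map_eq_zero`. In it `ω¹` and `ω²` have two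
descriptions: combinations of forms pulled back from `M₁`, and forms pulled back from `M₂` corrected
by multiples of `θ₂` and `dλ`. Each description kills contractions of `dωⁱ` with vectors tangent to
fibres, and only the components `Bᵢ, Cᵢ, Eᵢ` survive (`IsReducedSection.exists_isTorsion`). -/

@[simp] theorem wedge_apply (a b : Cov n) (v w : E n) : wedge a b v w = a v * b w - b v * a w := by
  simp [wedge]

@[simp] theorem pullCov_apply (T : E m →L[ℝ] E n) (a : Cov n) (v : E m) :
    pullCov T a v = a (T v) := rfl

@[simp] theorem pullBil_apply (T : E m →L[ℝ] E n) (β : Bil n) (v w : E m) :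
    pullBil T β v w = β (T v) (T w) := rfl

/-- The exterior derivative of a one-form on `ℝⁿ`. -/
noncomputable def flatD (a : E n → Cov n) (y : E n) : Bil n :=
  fderiv ℝ a y - (fderiv ℝ a y).flip

theorem flatD_apply (a : E n → Cov n) (y v w : E n) :
    flatD a y v w = fderiv ℝ a y v w - fderiv ℝ a y w v := by
  simp [flatD]

theorem flatD_congr {a b : E n → Cov n} {y : E n} (h : a =ᶠ[𝓝 y] b) : flatD a y = flatD b y := by
  simp only [flatD, h.fderiv_eq]

theorem two_le_smooth : minSmoothness ℝ 2 ≤ (∞ : WithTop ℕ∞) := by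
  rw [minSmoothness_of_isRCLikeNormedField]
  exact WithTop.coe_le_coe.2 le_top

/-- By the chain and product rules the only extra term contains the second derivative of `φ`; it is
symmetric and disappears on antisymmetrising. -/
theorem flatD_pull {φ : E m → E n} {a : E n → Cov n} {y : E m} (hφ : ContDiffAt ℝ ∞ φ y)
    (ha : DifferentiableAt ℝ a (φ y)) :
    flatD (fun z => pullCov (fderiv ℝ φ z) (a (φ z))) y =
      pullBil (fderiv ℝ φ y) (flatD a (φ y)) := by
  have h1 : HasFDerivAt (fun z => a (φ z)) ((fderiv ℝ a (φ y)).comp (fderiv ℝ φ y)) y :=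
    ha.hasFDerivAt.comp y (hφ.differentiableAt (by simp)).hasFDerivAt
  have h2 : HasFDerivAt (fderiv ℝ φ) (fderiv ℝ (fderiv ℝ φ) y) y :=
    ((hφ.fderiv_right (m := ∞) (by simp)).differentiableAt (by simp)).hasFDerivAt
  have h3 := h1.clm_comp h2
  have hs : IsSymmSndFDerivAt ℝ φ y := hφ.isSymmSndFDerivAt two_le_smooth
  have h4 : fderiv ℝ (fun z => pullCov (fderiv ℝ φ z) (a (φ z))) y = _ := h3.fderiv
  ext v w
  rw [flatD_apply, h4]
  simp [flatD_apply, hs v w]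

theorem contDiff_flip {F : Type*} [NormedAddCommGroup F] [NormedSpace ℝ F] :
    ContDiff ℝ ∞ (fun B : F →L[ℝ] F →L[ℝ] ℝ => B.flip) :=
  LinearIsometryEquiv.contDiff (𝕜 := ℝ) (n := ∞) (E := F →L[ℝ] F →L[ℝ] ℝ)
    (F := F →L[ℝ] F →L[ℝ] ℝ) (ContinuousLinearMap.flipₗᵢ ℝ F F ℝ)

theorem contDiffAt_flatD {a : E n → Cov n} {y : E n} (ha : ContDiffAt ℝ ∞ a y) :
    ContDiffAt ℝ ∞ (fun z => flatD a z) y := by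
  have h : ContDiffAt ℝ ∞ (fderiv ℝ a) y := ha.fderiv_right (by simp)
  have h2 : ContDiffAt ℝ ∞ (fun z => (fderiv ℝ a z).flip) y :=
    contDiff_flip.contDiffAt.comp y h
  exact h.sub h2

theorem flatD_smul {f : E n → ℝ} {a : E n → Cov n} {y : E n} (hf : DifferentiableAt ℝ f y)
    (ha : DifferentiableAt ℝ a y) :
    flatD (fun z => f z • a z) y = f y • flatD a y + wedge (fderiv ℝ f y) (a y) := by
  ext v w
  rw [flatD_apply, fderiv_fun_smul hf ha]
  simp [flatD_apply]
  ring

theorem flatD_add {a b : E n → Cov n} {y : E n} (ha : DifferentiableAt ℝ a y)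
    (hb : DifferentiableAt ℝ b y) :
    flatD (fun z => a z + b z) y = flatD a y + flatD b y := by
  ext v w
  simp only [flatD_apply, fderiv_fun_add ha hb, add_apply]
  ring

theorem flatD_fderiv {f : E n → ℝ} {y : E n} (hf : ContDiffAt ℝ ∞ f y) :
    flatD (fderiv ℝ f) y = 0 := by
  have hs : IsSymmSndFDerivAt ℝ f y := hf.isSymmSndFDerivAt two_le_smooth
  ext v w
  simp [flatD_apply, hs v w]

/-- The identity `d(dη) = 0`, when `dη = b ∧ c + b' ∧ c'`. -/
theorem flatD_flatD {η b c b' c' : E n → Cov n} {y : E n} (hη : ContDiffAt ℝ ∞ η y)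
    (hb : DifferentiableAt ℝ b y) (hc : DifferentiableAt ℝ c y)
    (hb' : DifferentiableAt ℝ b' y) (hc' : DifferentiableAt ℝ c' y)
    (h : (fun z => flatD η z) =ᶠ[𝓝 y] fun z => wedge (b z) (c z) + wedge (b' z) (c' z))
    (u v w : E n) :
    (flatD b y u v * c y w + flatD b y v w * c y u + flatD b y w u * c y v) -
      (b y u * flatD c y v w + b y v * flatD c y w u + b y w * flatD c y u v) +
    (flatD b' y u v * c' y w + flatD b' y v w * c' y u + flatD b' y w u * c' y v) -
      (b' y u * flatD c' y v w + b' y v * flatD c' y w u + b' y w * flatD c' y u v) = 0 := by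
  have hs : IsSymmSndFDerivAt ℝ η y := hη.isSymmSndFDerivAt two_le_smooth
  have hd : HasFDerivAt (fderiv ℝ η) (fderiv ℝ (fderiv ℝ η) y) y :=
    ((hη.fderiv_right (m := ∞) (by simp)).differentiableAt (by simp)).hasFDerivAt
  have ev : ∀ {g : E n → Cov n}, DifferentiableAt ℝ g y → ∀ r : E n,
      HasFDerivAt (fun z => g z r) ((fderiv ℝ g y).flip r) y := fun hg r => by
    simpa using hg.hasFDerivAt.clm_apply (hasFDerivAt_const r y)
  -- The equation `dη(v, w) = (b∧c + b'∧c')(v, w)` differentiated in the direction `u`.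
  have key : ∀ u v w : E n,
      fderiv ℝ (fderiv ℝ η) y u v w - fderiv ℝ (fderiv ℝ η) y u w v =
        fderiv ℝ b y u v * c y w + b y v * fderiv ℝ c y u w -
          (fderiv ℝ b y u w * c y v + b y w * fderiv ℝ c y u v) +
        (fderiv ℝ b' y u v * c' y w + b' y v * fderiv ℝ c' y u w -
          (fderiv ℝ b' y u w * c' y v + b' y w * fderiv ℝ c' y u v)) := by
    intro u v w
    have e1 : ∀ r s : E n, HasFDerivAt (fun z => fderiv ℝ η z r s)
        (((fderiv ℝ (fderiv ℝ η) y).flip r).flip s) y := fun r s => by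
      have h1 := hd.clm_apply (hasFDerivAt_const r y)
      have h2 := h1.clm_apply (hasFDerivAt_const s y)
      convert! h2 using 1
      ext t
      simp
    have l := (e1 v w).sub (e1 w v)
    have r := (((ev hb v).mul (ev hc w)).sub ((ev hb w).mul (ev hc v))).add
      (((ev hb' v).mul (ev hc' w)).sub ((ev hb' w).mul (ev hc' v)))
    have r' := r.congr_of_eventuallyEq (f₁ := fun z => fderiv ℝ η z v w - fderiv ℝ η z w v) (by
      filter_upwards [h] with z hz
      have := congrArg (fun B : Bil n => B v w) hz
      simp only [flatD_apply, add_apply, wedge_apply] at this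
      simp only [this, Pi.sub_apply, Pi.add_apply, Pi.mul_apply]
      ring)
    have := congrArg (fun T : Cov n => T u) (l.unique r')
    simp at this
    linarith
  have k1 := key u v w
  have k2 := key v w u
  have k3 := key w u v
  have s1 : fderiv ℝ (fderiv ℝ η) y u v w = fderiv ℝ (fderiv ℝ η) y v u w := by rw [hs u v]
  have s2 : fderiv ℝ (fderiv ℝ η) y v w u = fderiv ℝ (fderiv ℝ η) y w v u := by rw [hs v w]
  have s3 : fderiv ℝ (fderiv ℝ η) y u w v = fderiv ℝ (fderiv ℝ η) y w u v := by rw [hs u w]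
  simp only [flatD_apply]
  -- In the cyclic sum of the three differentiated equations the second derivatives of `η` cancel in
  -- pairs by symmetry.
  linear_combination s1 + s2 - s3 - k1 - k2 - k3

end Flat

/-! ### Pulling back one-forms -/

section Pull

variable {m n k : ℕ}
  {M : Type*} [TopologicalSpace M] [ChartedSpace (E m) M]
  {N : Type*} [TopologicalSpace N] [ChartedSpace (E n) N]
  {Q : Type*} [TopologicalSpace Q] [ChartedSpace (E k) Q]

/-- The differential of a map, read in the preferred charts. -/
noncomputable def mder (m n : ℕ) {M : Type*} [TopologicalSpace M] [ChartedSpace (E m) M]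
    {N : Type*} [TopologicalSpace N] [ChartedSpace (E n) N] (f : M → N) (x : M) :
    E m →L[ℝ] E n := mfderiv (𝓡 m) (𝓡 n) f x

/-- The pull-back of a one-form under a map. -/
noncomputable def pullForm (m n : ℕ) {M : Type*} [TopologicalSpace M] [ChartedSpace (E m) M]
    {N : Type*} [TopologicalSpace N] [ChartedSpace (E n) N] (f : M → N) (α : N → Cov n) (x : M) : Cov m :=
  pullCov (mder m n f x) (α (f x))

/-- Reading a form in a chart is itself a pull-back, so one naturality statement for `d` also covers
changes of chart. -/
theorem readOne_eq_pullForm (α : M → Cov m) (x₀ : M) :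
    readOne α x₀ = pullForm m m (extChartAt (𝓡 m) x₀).symm α := rfl

theorem extD_eq_flatD (α : M → Cov m) (x : M) :
    extD α x = flatD (readOne α x) (extChartAt (𝓡 m) x x) := rfl

theorem readOne_flat (a : E n → Cov n) (y : E n) : readOne a y = a := by
  funext z
  have : mfderiv (𝓡 n) (𝓡 n) (id : E n → E n) z = ContinuousLinearMap.id ℝ _ := mfderiv_id
  have h1 : ((extChartAt (𝓡 n) y).symm : E n → E n) = id := by
    rw [extChartAt_model_space_eq_id]; rfl
  have h2 : dChartSymm y z = ContinuousLinearMap.id ℝ _ := by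
    rw [dChartSymm, h1]; exact this
  rw [readOne, h2, h1]
  rfl

theorem extD_flat (a : E n → Cov n) (y : E n) : extD a y = flatD a y := by
  rw [extD_eq_flatD, readOne_flat, extChartAt_model_space_eq_id]
  rfl

/-- Smoothness of a one-form at a point. -/
def SmoothOneAt (α : M → Cov m) (x : M) : Prop :=
  ContDiffAt ℝ ∞ (readOne α x) (extChartAt (𝓡 m) x x)

theorem pullForm_comp {f : M → N} {g : N → Q} {x : M} (α : Q → Cov k)
    (hg : MDifferentiableAt (𝓡 n) (𝓡 k) g (f x)) (hf : MDifferentiableAt (𝓡 m) (𝓡 n) f x) :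
    pullForm m k (g ∘ f) α x = pullForm m n f (pullForm n k g α) x := by
  ext v
  simp only [pullForm, mder]
  rw [mfderiv_comp x hg hf]
  rfl

theorem pullForm_congr_map {f g : M → N} {x : M} (h : f =ᶠ[𝓝 x] g) (α : N → Cov n) :
    pullForm m n f α x = pullForm m n g α x := by
  simp only [pullForm, mder, h.eq_of_nhds, h.mfderiv_eq]

variable [IsManifold (𝓡 m) ∞ M] [IsManifold (𝓡 n) ∞ N]

/-- The chart expression of a pulled back form is the flat pull-back of the chart expression, by the
functoriality of pull-backs. It holds only near the base point, where the chart around `f x` is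
defined; germs suffice for derivatives. -/
theorem readOne_pullForm {f : M → N} {x : M} (hf : ContMDiffAt (𝓡 m) (𝓡 n) ∞ f x)
    (α : N → Cov n) :
    ContDiffAt ℝ ∞ (extChartAt (𝓡 n) (f x) ∘ f ∘ (extChartAt (𝓡 m) x).symm)
        (extChartAt (𝓡 m) x x) ∧
    readOne (pullForm m n f α) x =ᶠ[𝓝 (extChartAt (𝓡 m) x x)] fun z =>
      pullCov (fderiv ℝ (extChartAt (𝓡 n) (f x) ∘ f ∘ (extChartAt (𝓡 m) x).symm) z)
        (readOne α (f x) ((extChartAt (𝓡 n) (f x) ∘ f ∘ (extChartAt (𝓡 m) x).symm) z)) := by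
  set φ := extChartAt (𝓡 m) x with hφ
  set ψ := extChartAt (𝓡 n) (f x) with hψ
  set F := ψ ∘ f ∘ φ.symm with hF
  have hF' : ContDiffAt ℝ ∞ F (φ x) := by
    have := (contMDiffAt_iff.1 hf).2
    rwa [modelWithCornersSelf_coe, Set.range_id, contDiffWithinAt_univ] at this
  refine ⟨hF', ?_⟩
  have : IsManifold (𝓡 m) 1 M := .of_le (n := ∞) (by simp)
  have : IsManifold (𝓡 n) 1 N := .of_le (n := ∞) (by simp)
  -- Smoothness at a point spreads to a neighbourhood for a finite order only, hence the drop to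
  -- order one.
  have hf1 : ∀ᶠ x' in 𝓝 x, ContMDiffAt (𝓡 m) (𝓡 n) 1 f x' :=
    (contMDiffAt_iff_contMDiffAt_nhds (by simp)).1 (hf.of_le (by simp))
  have hs : ∀ᶠ x' in 𝓝 x, f x' ∈ ψ.source :=
    hf.continuousAt.eventually (extChartAt_source_mem_nhds (f x))
  have hc : Tendsto φ.symm (𝓝 (φ x)) (𝓝 x) := by
    have := continuousAt_extChartAt_symm (I := 𝓡 m) x
    simpa [ContinuousAt, hφ] using this
  have ht : ∀ᶠ z in 𝓝 (φ x), z ∈ φ.target := extChartAt_target_mem_nhds x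
  filter_upwards [hc.eventually hf1, (hc.eventually hs).eventually_nhds, ht] with z h1 h2 h3
  have hcz : MDifferentiableAt (𝓡 m) (𝓡 m) φ.symm z := by
    have := mdifferentiableWithinAt_extChartAt_symm (I := 𝓡 m) (x := x) h3
    rwa [modelWithCornersSelf_coe, Set.range_id, mdifferentiableWithinAt_univ] at this
  have hψz : MDifferentiableAt (𝓡 n) (𝓡 n) ψ (f (φ.symm z)) :=
    mdifferentiableAt_extChartAt (by rw [← extChartAt_source (𝓡 n)]; exact h2.self_of_nhds)
  have hfz : MDifferentiableAt (𝓡 m) (𝓡 n) f (φ.symm z) := h1.mdifferentiableAt (by simp)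
  have hFz : MDifferentiableAt (𝓡 m) (𝓡 n) F z := hψz.comp z (hfz.comp z hcz)
  have hψs : MDifferentiableAt (𝓡 n) (𝓡 n) ψ.symm (F z) := by
    have := mdifferentiableWithinAt_extChartAt_symm (I := 𝓡 n) (x := f x) (z := F z)
      (ψ.map_source h2.self_of_nhds)
    rwa [modelWithCornersSelf_coe, Set.range_id, mdifferentiableWithinAt_univ] at this
  have e1 : readOne (pullForm m n f α) x z = pullForm m n (f ∘ φ.symm) α z := by
    rw [readOne_eq_pullForm, pullForm_comp α hfz hcz]
  -- Inserting `ψ.symm ∘ ψ`, the identity on the chart domain, factors the map through its chart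
  -- expression `F`.
  have e2 : pullForm m n (f ∘ φ.symm) α z = pullForm m n (ψ.symm ∘ F) α z := by
    apply pullForm_congr_map
    filter_upwards [h2] with z' hz'
    simp only [hF, Function.comp_apply]
    rw [ψ.left_inv hz']
  rw [e1, e2, pullForm_comp α hψs hFz]
  simp only [pullForm, mder, mfderiv_eq_fderiv]
  rfl

theorem SmoothOneAt.pullForm {f : M → N} {x : M} {α : N → Cov n} (hα : SmoothOneAt α (f x))
    (hf : ContMDiffAt (𝓡 m) (𝓡 n) ∞ f x) : SmoothOneAt (pullForm m n f α) x := by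
  obtain ⟨h1, h2⟩ := readOne_pullForm hf α
  refine ContDiffAt.congr_of_eventuallyEq ?_ h2
  have e : (extChartAt (𝓡 n) (f x) ∘ f ∘ (extChartAt (𝓡 m) x).symm) (extChartAt (𝓡 m) x x) =
      extChartAt (𝓡 n) (f x) (f x) := by simp
  have h3 : ContDiffAt ℝ ∞ (readOne α (f x))
      ((extChartAt (𝓡 n) (f x) ∘ f ∘ (extChartAt (𝓡 m) x).symm) (extChartAt (𝓡 m) x x)) := by
    rw [e]; exact hα
  exact (h3.comp _ h1).clm_comp (h1.fderiv_right (m := ∞) (by simp))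

omit [IsManifold (𝓡 m) ∞ M] [IsManifold (𝓡 n) ∞ N] in
theorem mfderiv_eq_fderiv_chart {f : M → N} {x : M} (hf : ContMDiffAt (𝓡 m) (𝓡 n) ∞ f x) :
    mder m n f x =
      fderiv ℝ (extChartAt (𝓡 n) (f x) ∘ f ∘ (extChartAt (𝓡 m) x).symm)
        (extChartAt (𝓡 m) x x) := by
  have h := (hf.mdifferentiableAt (by simp)).mfderiv
  rw [modelWithCornersSelf_coe, Set.range_id, fderivWithin_univ] at h
  exact h

/-- The exterior derivative commutes with pull-backs. -/
theorem extD_pullForm {f : M → N} {x : M} {α : N → Cov n} (hα : SmoothOneAt α (f x))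
    (hf : ContMDiffAt (𝓡 m) (𝓡 n) ∞ f x) :
    extD (pullForm m n f α) x = pullBil (mder m n f x) (extD α (f x)) := by
  obtain ⟨h1, h2⟩ := readOne_pullForm hf α
  have e : (extChartAt (𝓡 n) (f x) ∘ f ∘ (extChartAt (𝓡 m) x).symm) (extChartAt (𝓡 m) x x) =
      extChartAt (𝓡 n) (f x) (f x) := by simp
  have hα' : DifferentiableAt ℝ (readOne α (f x))
      ((extChartAt (𝓡 n) (f x) ∘ f ∘ (extChartAt (𝓡 m) x).symm) (extChartAt (𝓡 m) x x)) := by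
    rw [e]; exact ContDiffAt.differentiableAt hα (by simp)
  rw [extD_eq_flatD, flatD_congr h2, flatD_pull h1 hα', mfderiv_eq_fderiv_chart hf,
    extD_eq_flatD, e]

end Pull

end Backlund

namespace Backlund

open Filter Topology

/-! ### Coframes and dual frames -/

section Coframe

variable {n : ℕ}

theorem cov_ext_zero {v : E n} (h : ∀ a : Cov n, a v = 0) : v = 0 := by
  have := h (innerSL ℝ v)
  simpa using this

theorem finrank_cov : Module.finrank ℝ (Cov n) = n := by
  have h : Module.finrank ℝ (Cov n) = Module.finrank ℝ (Module.Dual ℝ (E n)) :=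
    (LinearMap.toContinuousLinearMap (𝕜 := ℝ) (E := E n) (F' := ℝ)).symm.finrank_eq
  rw [h, Subspace.dual_finrank_eq]
  simp

/-- The linear map with components `e i`. -/
noncomputable def coframeMap (e : Fin n → Cov n) : E n →L[ℝ] (Fin n → ℝ) :=
  ∑ i, (e i).smulRight (Pi.single i 1)

theorem coframeMap_apply (e : Fin n → Cov n) (v : E n) (i : Fin n) :
    coframeMap e v i = e i v := by
  simp [coframeMap, Pi.single_apply]

/-- By dimension, `n` independent covectors span the dual space, and covectors separate vectors. -/
theorem eq_zero_of_coframe {e : Fin n → Cov n} (he : LinearIndependent ℝ e)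
    {v : E n} (h : ∀ i, e i v = 0) : v = 0 := by
  have hs : Submodule.span ℝ (Set.range e) = ⊤ :=
    he.span_eq_top_of_card_eq_finrank' (by simp [finrank_cov])
  refine cov_ext_zero fun a => ?_
  have ha : a ∈ Submodule.span ℝ (Set.range e) := hs ▸ Submodule.mem_top
  induction ha using Submodule.span_induction with
  | mem x hx => obtain ⟨i, rfl⟩ := hx; exact h i
  | zero => rfl
  | add x y _ _ hx hy => simp [hx, hy]
  | smul c x _ hx => simp [hx]

theorem exists_coframeEquiv {e : Fin n → Cov n} (h : ∀ v, (∀ i, e i v = 0) → v = 0) :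
    ∃ T : E n ≃L[ℝ] (Fin n → ℝ), (T : E n →L[ℝ] (Fin n → ℝ)) = coframeMap e := by
  have hi : Function.Injective (coframeMap e : E n →ₗ[ℝ] (Fin n → ℝ)) := by
    refine (injective_iff_map_eq_zero _).2 fun v hv => h v fun i => ?_
    rw [← coframeMap_apply e v i]
    exact congrFun hv i
  have hf : Module.finrank ℝ (E n) = Module.finrank ℝ (Fin n → ℝ) := by simp
  refine ⟨(LinearEquiv.ofInjectiveOfFinrankEq _ hi hf).toContinuousLinearEquiv, ?_⟩
  ext v i
  rfl

/-- Evaluate a vanishing combination on the preimages of the unit vectors. This reduces the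
independence of `n` covectors to the triviality of their common kernel. -/
theorem linearIndependent_of_apply {e : Fin n → Cov n} (h : ∀ v, (∀ i, e i v = 0) → v = 0) :
    LinearIndependent ℝ e := by
  obtain ⟨T, hT⟩ := exists_coframeEquiv h
  refine Fintype.linearIndependent_iff.2 fun g hg i => ?_
  have h1 := congrArg (fun a : Cov n => a (T.symm (Pi.single i 1))) hg
  have h2 : ∀ j, e j (T.symm (Pi.single i 1)) = (Pi.single i 1 : Fin n → ℝ) j := fun j => by
    rw [← coframeMap_apply, ← hT]
    simp
  simpa [h2, Pi.single_apply] using h1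

/-- The frame dual to a coframe. -/
noncomputable def dualVec (e : Fin n → Cov n) (j : Fin n) : E n :=
  (coframeMap e).inverse (Pi.single j 1)

theorem apply_dualVec {e : Fin n → Cov n} (he : LinearIndependent ℝ e) (i j : Fin n) :
    e i (dualVec e j) = if i = j then 1 else 0 := by
  obtain ⟨T, hT⟩ := exists_coframeEquiv fun v => eq_zero_of_coframe he (v := v)
  rw [← coframeMap_apply, dualVec, ← hT, ContinuousLinearMap.inverse_equiv]
  simp [Pi.single_apply]

theorem eq_dualVec {e : Fin n → Cov n} (he : LinearIndependent ℝ e) {v : E n} {j : Fin n}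
    (h : ∀ i, e i v = if i = j then 1 else 0) : v = dualVec e j := by
  rw [← sub_eq_zero]
  refine eq_zero_of_coframe he fun i => ?_
  rw [map_sub, h, apply_dualVec he, sub_self]

theorem eq_sum_dualVec {e : Fin n → Cov n} (he : LinearIndependent ℝ e) (v : E n) :
    v = ∑ j, e j v • dualVec e j := by
  rw [← sub_eq_zero]
  refine eq_zero_of_coframe he fun i => ?_
  simp [apply_dualVec he]

theorem cov_eq_sum {e : Fin n → Cov n} (he : LinearIndependent ℝ e) (a : Cov n) :
    a = ∑ j, a (dualVec e j) • e j := by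
  ext v
  conv_lhs => rw [eq_sum_dualVec he v]
  simp [mul_comm]

/-- Inversion of continuous linear maps is smooth at an invertible map. The junk value of
`ContinuousLinearMap.inverse` at other maps is harmless, since invertibility persists near `y`. -/
theorem contDiffAt_dualVec {k : ℕ} {e : Fin n → E k → Cov n} {y : E k}
    (he : ∀ i, ContDiffAt ℝ ∞ (e i) y) (hi : LinearIndependent ℝ fun i => e i y) (j : Fin n) :
    ContDiffAt ℝ ∞ (fun z => dualVec (fun i => e i z) j) y := by
  obtain ⟨T, hT⟩ := exists_coframeEquiv fun v => eq_zero_of_coframe hi (v := v)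
  have h1 : ContDiffAt ℝ ∞ (fun z => coframeMap fun i => e i z) y := by
    unfold coframeMap
    exact ContDiffAt.sum fun i _ => (he i).smulRight contDiffAt_const
  have h2 : ContDiffAt ℝ ∞ ContinuousLinearMap.inverse (coframeMap fun i => e i y) := by
    rw [← hT]; exact contDiffAt_map_inverse T
  exact (h2.comp y h1).clm_apply contDiffAt_const

/-- Invertible linear maps form an open set. -/
theorem eventually_linearIndependent {X : Type*} [TopologicalSpace X] {e : Fin n → X → Cov n}
    {y : X} (he : ∀ i, ContinuousAt (e i) y) (hi : LinearIndependent ℝ fun i => e i y) :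
    ∀ᶠ z in 𝓝 y, LinearIndependent ℝ fun i => e i z := by
  obtain ⟨T, hT⟩ := exists_coframeEquiv fun v => eq_zero_of_coframe hi (v := v)
  have h1 : ContinuousAt (fun z => coframeMap fun i => e i z) y := by
    unfold coframeMap
    refine tendsto_finsetSum _ fun i _ => ?_
    have : Continuous fun a : Cov n => a.smulRight (Pi.single i 1 : Fin n → ℝ) :=
      (ContinuousLinearMap.smulRightL ℝ (E n) (Fin n → ℝ)).continuous.clm_apply continuous_const
    exact this.continuousAt.comp (he i)
  have h2 := h1.eventually (hT ▸ T.nhds)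
  filter_upwards [h2] with z hz
  obtain ⟨T', hT'⟩ := hz
  refine linearIndependent_of_apply fun v hv => T'.injective ?_
  rw [map_zero]
  funext i
  have : T' v = coframeMap (fun i => e i z) v := by rw [← hT']; rfl
  rw [this, coframeMap_apply]
  exact hv i

end Coframe

/-! ### Calculus of one-forms on manifolds -/

section Calculus

variable {n : ℕ} {M : Type*} [TopologicalSpace M] [ChartedSpace (E n) M]

theorem extD_apply_self (α : M → Cov n) (x : M) (v : E n) : extD α x v v = 0 := by
  rw [extD_eq_flatD, flatD_apply, sub_self]

theorem tendsto_chart_symm (x : M) :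
    Tendsto (extChartAt (𝓡 n) x).symm (𝓝 (extChartAt (𝓡 n) x x)) (𝓝 x) := by
  have := continuousAt_extChartAt_symm (I := 𝓡 n) x
  rwa [ContinuousAt, extChartAt_to_inv] at this

theorem readOne_congr {α β : M → Cov n} {x : M} (h : α =ᶠ[𝓝 x] β) :
    readOne α x =ᶠ[𝓝 (extChartAt (𝓡 n) x x)] readOne β x := by
  filter_upwards [(tendsto_chart_symm x).eventually h] with y hy
  simp only [readOne, hy]

theorem extD_congr {α β : M → Cov n} {x : M} (h : α =ᶠ[𝓝 x] β) : extD α x = extD β x :=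
  flatD_congr (readOne_congr h)

/-- Smoothness of a function on an open set, read in the preferred charts. -/
def SmoothFunOn (f : M → ℝ) (U : Set M) : Prop :=
  ∀ x ∈ U, ContDiffAt ℝ ∞ (f ∘ (extChartAt (𝓡 n) x).symm) (extChartAt (𝓡 n) x x)

theorem SmoothOneOn.mono {α : M → Cov n} {U V : Set M} (h : SmoothOneOn α U) (hV : V ⊆ U) :
    SmoothOneOn α V := fun x hx => h x (hV hx)

theorem readOne_add (α β : M → Cov n) (x : M) :
    readOne (fun y => α y + β y) x = fun z => readOne α x z + readOne β x z := by
  funext z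
  simp [readOne]

theorem readOne_smul (f : M → ℝ) (α : M → Cov n) (x : M) :
    readOne (fun y => f y • α y) x =
      fun z => (f ∘ (extChartAt (𝓡 n) x).symm) z • readOne α x z := by
  funext z
  simp [readOne]

theorem SmoothOneOn.add {α β : M → Cov n} {U : Set M} (hα : SmoothOneOn α U)
    (hβ : SmoothOneOn β U) : SmoothOneOn (fun y => α y + β y) U := fun x hx => by
  rw [readOne_add]
  exact (hα x hx).add (hβ x hx)

theorem SmoothOneOn.smul {f : M → ℝ} {α : M → Cov n} {U : Set M}
    (hf : SmoothFunOn (n := n) f U) (hα : SmoothOneOn α U) :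
    SmoothOneOn (fun y => f y • α y) U := fun x hx => by
  rw [readOne_smul]
  exact (hf x hx).smul (hα x hx)

theorem SmoothFunOn.neg {f : M → ℝ} {U : Set M} (hf : SmoothFunOn (n := n) f U) :
    SmoothFunOn (n := n) (fun y => -f y) U := fun x hx => (hf x hx).neg

theorem smoothOneOn_zero {U : Set M} : SmoothOneOn (fun _ : M => (0 : Cov n)) U := fun x _ => by
  have : readOne (fun _ : M => (0 : Cov n)) x = fun _ => 0 := by
    funext z; simp [readOne]
  rw [this]
  exact contDiffAt_const

theorem SmoothOneOn.sum {ι : Type*} (s : Finset ι) {f : ι → M → ℝ} {β : ι → M → Cov n}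
    {U : Set M} (hf : ∀ i ∈ s, SmoothFunOn (n := n) (f i) U) (hβ : ∀ i ∈ s, SmoothOneOn (β i) U) :
    SmoothOneOn (fun y => ∑ i ∈ s, f i y • β i y) U := by
  classical
  induction s using Finset.induction_on with
  | empty => simpa using smoothOneOn_zero
  | insert i s hi ih =>
    simp only [Finset.sum_insert hi]
    exact (SmoothOneOn.smul (hf i (by simp)) (hβ i (by simp))).add
      (ih (fun j hj => hf j (by simp [hj])) fun j hj => hβ j (by simp [hj]))

end Calculus

end Backlund

namespace Backlund

open Filter Topology

/-! ### Forms, exterior derivatives and dual frames read in charts -/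

section Charts

variable {n : ℕ} {M : Type*} [TopologicalSpace M] [ChartedSpace (E n) M]

variable [IsManifold (𝓡 n) ∞ M]

theorem dChartSymm_self (x : M) :
    dChartSymm x (extChartAt (𝓡 n) x x) = ContinuousLinearMap.id ℝ (E n) := by
  have : IsManifold (𝓡 n) 1 M := .of_le (n := ∞) (by simp)
  have := mfderivWithin_range_extChartAt_symm (I := 𝓡 n) (x := x)
  rw [modelWithCornersSelf_coe, Set.range_id, mfderivWithin_univ] at this
  exact this

/-- Tangent vectors at `x` are read in the preferred chart at `x`, so no transition map enters at
the base point. -/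
theorem readOne_self (α : M → Cov n) (x : M) :
    readOne α x (extChartAt (𝓡 n) x x) = α x := by
  rw [readOne, dChartSymm_self, extChartAt_to_inv]
  rfl

theorem dChartSymm_surjective {x : M} {y : E n} (hy : y ∈ (extChartAt (𝓡 n) x).target) :
    Function.Surjective (dChartSymm x y) := by
  have : IsManifold (𝓡 n) 1 M := .of_le (n := ∞) (by simp)
  have := mfderivWithin_extChartAt_symm_comp_mfderiv_extChartAt (I := 𝓡 n) hy
  rw [modelWithCornersSelf_coe, Set.range_id, mfderivWithin_univ] at this
  intro v
  exact ⟨_, congrArg (fun T : E n →L[ℝ] E n => T v) this⟩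

theorem dChartSymm_injective {x : M} {y : E n} (hy : y ∈ (extChartAt (𝓡 n) x).target) :
    Function.Injective (dChartSymm x y) := by
  have h := dChartSymm_surjective hy
  exact (LinearMap.injective_iff_surjective (f := (dChartSymm x y : E n →ₗ[ℝ] E n))).2 h

theorem contMDiffAt_chart_symm {x : M} {y : E n} (hy : y ∈ (extChartAt (𝓡 n) x).target) :
    ContMDiffAt (𝓡 n) (𝓡 n) ∞ (extChartAt (𝓡 n) x).symm y := by
  have h := contMDiffOn_extChartAt_symm (I := 𝓡 n) (n := ∞) x
  exact (h y hy).contMDiffAt ((isOpen_extChartAt_target x).mem_nhds hy)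

/-- Independence of the chart: `extD` uses a different preferred chart at each point, and naturality
of `d` under the inverse chart compares them with one fixed chart. -/
theorem flatD_readOne {α : M → Cov n} {x : M} {y : E n}
    (hy : y ∈ (extChartAt (𝓡 n) x).target) (hα : SmoothOneAt α ((extChartAt (𝓡 n) x).symm y)) :
    flatD (readOne α x) y = pullBil (dChartSymm x y) (extD α ((extChartAt (𝓡 n) x).symm y)) := by
  rw [← extD_flat]
  exact extD_pullForm hα (contMDiffAt_chart_symm hy)

omit [IsManifold (𝓡 n) ∞ M] in
theorem extD_add {α β : M → Cov n} {x : M} (hα : SmoothOneAt α x) (hβ : SmoothOneAt β x) :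
    extD (fun y => α y + β y) x = extD α x + extD β x := by
  rw [extD_eq_flatD, readOne_add]
  exact flatD_add (ContDiffAt.differentiableAt hα (by simp))
    (ContDiffAt.differentiableAt hβ (by simp))

/-- The covector is `df`; its value never matters, because the extra term is always evaluated where
`α` vanishes. -/
theorem exists_extD_smul {f : M → ℝ} {α : M → Cov n} {U : Set M} {x : M} (hx : x ∈ U)
    (hf : SmoothFunOn (n := n) f U) (hα : SmoothOneAt α x) :
    ∃ c : Cov n, extD (fun y => f y • α y) x = f x • extD α x + wedge c (α x) := by
  refine ⟨fderiv ℝ (f ∘ (extChartAt (𝓡 n) x).symm) (extChartAt (𝓡 n) x x), ?_⟩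
  rw [extD_eq_flatD, readOne_smul, flatD_smul ((hf x hx).differentiableAt (by simp))
    (ContDiffAt.differentiableAt hα (by simp)), readOne_self, extD_eq_flatD]
  simp

/-- The exterior derivative of a combination of one-forms, modulo these forms. -/
theorem extD_sum_apply {ι : Type*} (s : Finset ι) {f : ι → M → ℝ} {β : ι → M → Cov n}
    {U : Set M} (hf : ∀ i ∈ s, SmoothFunOn (n := n) (f i) U) (hβ : ∀ i ∈ s, SmoothOneOn (β i) U)
    {x : M} (hx : x ∈ U) {v w : E n} (hv : ∀ i ∈ s, β i x v = 0) (hw : ∀ i ∈ s, β i x w = 0) :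
    extD (fun y => ∑ i ∈ s, f i y • β i y) x v w = ∑ i ∈ s, f i x * extD (β i) x v w := by
  classical
  induction s using Finset.induction_on with
  | empty =>
    have : readOne (fun _ : M => (0 : Cov n)) x = fun _ => 0 := by
      funext z; simp [readOne]
    simp only [Finset.sum_empty]
    rw [extD_eq_flatD, this]
    simp [flatD]
  | insert i s hi ih =>
    simp only [Finset.sum_insert hi]
    have h1 : SmoothOneOn (fun y => f i y • β i y) U :=
      SmoothOneOn.smul (hf i (by simp)) (hβ i (by simp))
    have h2 : SmoothOneOn (fun y => ∑ i ∈ s, f i y • β i y) U :=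
      SmoothOneOn.sum s (fun j hj => hf j (by simp [hj])) fun j hj => hβ j (by simp [hj])
    obtain ⟨c, hc⟩ := exists_extD_smul hx (hf i (by simp)) (hβ i (by simp) x hx)
    rw [extD_add (h1 x hx) (h2 x hx), hc]
    simp [ih (fun j hj => hf j (by simp [hj])) (fun j hj => hβ j (by simp [hj]))
      (fun j hj => hv j (by simp [hj])) (fun j hj => hw j (by simp [hj])),
      hv i (by simp), hw i (by simp)]

omit [IsManifold (𝓡 n) ∞ M] in
theorem eventually_target (x : M) :
    ∀ᶠ y in 𝓝 (extChartAt (𝓡 n) x x), y ∈ (extChartAt (𝓡 n) x).target :=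
  extChartAt_target_mem_nhds x

theorem linearIndependent_readOne {e : Fin n → M → Cov n} {x : M} {y : E n}
    (hy : y ∈ (extChartAt (𝓡 n) x).target) :
    LinearIndependent ℝ (fun i => readOne (e i) x y) ↔
      LinearIndependent ℝ fun i => e i ((extChartAt (𝓡 n) x).symm y) := by
  constructor
  · intro h
    refine linearIndependent_of_apply fun v hv => ?_
    obtain ⟨w, rfl⟩ := dChartSymm_surjective hy v
    rw [eq_zero_of_coframe h (v := w) hv, map_zero]
  · intro h
    refine linearIndependent_of_apply fun v hv => ?_
    apply dChartSymm_injective hy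
    rw [map_zero]
    exact eq_zero_of_coframe h hv

theorem dualVec_readOne {e : Fin n → M → Cov n} {x : M} {y : E n}
    (hy : y ∈ (extChartAt (𝓡 n) x).target)
    (he : LinearIndependent ℝ fun i => e i ((extChartAt (𝓡 n) x).symm y)) (j : Fin n) :
    dChartSymm x y (dualVec (fun i => readOne (e i) x y) j) =
      dualVec (fun i => e i ((extChartAt (𝓡 n) x).symm y)) j :=
  eq_dualVec he fun i => apply_dualVec ((linearIndependent_readOne hy).2 he) i j

variable {U : Set M} {e : Fin n → M → Cov n}

omit [IsManifold (𝓡 n) ∞ M] in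
theorem eventually_mem_chart (hU : IsOpen U) {x : M} (hx : x ∈ U) :
    ∀ᶠ y in 𝓝 (extChartAt (𝓡 n) x x), (extChartAt (𝓡 n) x).symm y ∈ U :=
  (tendsto_chart_symm x).eventually (hU.mem_nhds hx)

theorem contDiffAt_dualVec_readOne (he : ∀ i, SmoothOneOn (e i) U)
    (hi : ∀ x ∈ U, LinearIndependent ℝ fun i => e i x) {x : M} (hx : x ∈ U) (j : Fin n) :
    ContDiffAt ℝ ∞ (fun y => dualVec (fun i => readOne (e i) x y) j) (extChartAt (𝓡 n) x x) :=
  contDiffAt_dualVec (fun i => he i x hx) (by simpa only [readOne_self] using hi x hx) j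

/-- Near `x` the dual frame is carried by the chart around `x` to the dual frame of the chart
expressions, and the latter is smooth. -/
theorem smoothFunOn_dualVec (hU : IsOpen U) (he : ∀ i, SmoothOneOn (e i) U)
    (hi : ∀ x ∈ U, LinearIndependent ℝ fun i => e i x) {α : M → Cov n} (hα : SmoothOneOn α U)
    (j : Fin n) : SmoothFunOn (n := n) (fun x => α x (dualVec (fun i => e i x) j)) U := by
  intro x hx
  have h := ContDiffAt.clm_apply (hα x hx) (contDiffAt_dualVec_readOne he hi hx j)
  refine h.congr_of_eventuallyEq ?_
  filter_upwards [eventually_target x, eventually_mem_chart hU hx] with y h1 h2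
  simp only [Function.comp_apply]
  rw [← dualVec_readOne h1 (hi _ h2)]
  rfl

/-- Contraction of an exterior derivative with a vector field of the dual frame. -/
theorem smoothOneOn_extD_dualVec (hU : IsOpen U) (he : ∀ i, SmoothOneOn (e i) U)
    (hi : ∀ x ∈ U, LinearIndependent ℝ fun i => e i x) {α : M → Cov n} (hα : SmoothOneOn α U)
    (j : Fin n) : SmoothOneOn (fun x => extD α x (dualVec (fun i => e i x) j)) U := by
  intro x hx
  have h := (contDiffAt_flatD (hα x hx)).clm_apply (contDiffAt_dualVec_readOne he hi hx j)
  refine h.congr_of_eventuallyEq ?_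
  filter_upwards [eventually_target x, eventually_mem_chart hU hx] with y h1 h2
  rw [flatD_readOne h1 (hα _ h2)]
  ext v
  rw [pullBil_apply, dualVec_readOne h1 (hi _ h2)]
  rfl

/-- Pointwise independence is an open condition on smooth coframes. -/
theorem exists_open_linearIndependent (hU : IsOpen U) (he : ∀ i, SmoothOneOn (e i) U)
    {x : M} (hx : x ∈ U) (hi : LinearIndependent ℝ fun i => e i x) :
    ∃ V ⊆ U, IsOpen V ∧ x ∈ V ∧ ∀ y ∈ V, LinearIndependent ℝ fun i => e i y := by
  have h1 := eventually_linearIndependent (e := fun i => readOne (e i) x)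
    (fun i => ContDiffAt.continuousAt (he i x hx)) (by simpa only [readOne_self] using hi)
  have h2 : ∀ᶠ y in 𝓝 x, y ∈ U ∧ LinearIndependent ℝ fun i => e i y := by
    filter_upwards [hU.mem_nhds hx, (continuousAt_extChartAt (I := 𝓡 n) x).eventually h1,
      extChartAt_source_mem_nhds (I := 𝓡 n) x] with y hy h3 h4
    refine ⟨hy, ?_⟩
    have := (linearIndependent_readOne ((extChartAt (𝓡 n) x).map_source h4)).1 h3
    simpa only [(extChartAt (𝓡 n) x).left_inv h4] using this
  obtain ⟨V, hV, hVo, hxV⟩ := eventually_nhds_iff.1 h2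
  exact ⟨V, fun y hy => (hV y hy).1, hVo, hxV, fun y hy => (hV y hy).2⟩

theorem pullBil_wedge {m : ℕ} (T : E m →L[ℝ] E n) (a b : Cov n) :
    pullBil T (wedge a b) = wedge (pullCov T a) (pullCov T b) := by
  ext v w
  simp

/-- The identity `d(dη) = 0`, when `dη = b ∧ c + b' ∧ c'`. -/
theorem extD_extD {η b c b' c' : M → Cov n} (hU : IsOpen U) (hη : SmoothOneOn η U)
    (hb : SmoothOneOn b U) (hc : SmoothOneOn c U) (hb' : SmoothOneOn b' U)
    (hc' : SmoothOneOn c' U)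
    (h : ∀ x ∈ U, extD η x = wedge (b x) (c x) + wedge (b' x) (c' x)) {x : M} (hx : x ∈ U)
    (u v w : E n) :
    (extD b x u v * c x w + extD b x v w * c x u + extD b x w u * c x v) -
      (b x u * extD c x v w + b x v * extD c x w u + b x w * extD c x u v) +
    (extD b' x u v * c' x w + extD b' x v w * c' x u + extD b' x w u * c' x v) -
      (b' x u * extD c' x v w + b' x v * extD c' x w u + b' x w * extD c' x u v) = 0 := by
  have d : ∀ {a : M → Cov n}, SmoothOneOn a U →
      DifferentiableAt ℝ (readOne a x) (extChartAt (𝓡 n) x x) := fun ha =>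
    ContDiffAt.differentiableAt (ha x hx) (by simp)
  have key := flatD_flatD (hη x hx) (d hb) (d hc) (d hb') (d hc') (by
    filter_upwards [eventually_target x, eventually_mem_chart hU hx] with y h1 h2
    rw [flatD_readOne h1 (hη _ h2), h _ h2, map_add, pullBil_wedge, pullBil_wedge]
    rfl) u v w
  simpa only [readOne_self, ← extD_eq_flatD] using key

/-- The differential of a function, as a one-form. -/
noncomputable def diffForm (n : ℕ) {M : Type*} [TopologicalSpace M] [ChartedSpace (E n) M]
    (f : M → ℝ) (x : M) : Cov n := mfderiv (𝓡 n) 𝓘(ℝ, ℝ) f x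

theorem readOne_diffForm {f : M → ℝ} (hf : ContMDiff (𝓡 n) 𝓘(ℝ, ℝ) ∞ f) (x : M) :
    ContDiffAt ℝ ∞ (f ∘ (extChartAt (𝓡 n) x).symm) (extChartAt (𝓡 n) x x) ∧
    readOne (diffForm n f) x =ᶠ[𝓝 (extChartAt (𝓡 n) x x)]
      fderiv ℝ (f ∘ (extChartAt (𝓡 n) x).symm) := by
  constructor
  · have h := (hf ((extChartAt (𝓡 n) x).symm (extChartAt (𝓡 n) x x))).comp _
      (contMDiffAt_chart_symm (mem_extChartAt_target x))
    exact contMDiffAt_iff_contDiffAt.1 h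
  · filter_upwards [eventually_target x] with y hy
    have e : fderiv ℝ (f ∘ (extChartAt (𝓡 n) x).symm) y = _ := mfderiv_eq_fderiv.symm
    rw [e, mfderiv_comp y ((hf _).mdifferentiableAt (by simp))
      ((contMDiffAt_chart_symm hy).mdifferentiableAt (by simp))]
    rfl

theorem smoothOneOn_diffForm {f : M → ℝ} (hf : ContMDiff (𝓡 n) 𝓘(ℝ, ℝ) ∞ f) (V : Set M) :
    SmoothOneOn (diffForm n f) V := fun x _ =>
  ((readOne_diffForm hf x).1.fderiv_right (m := ∞) (by simp)).congr_of_eventuallyEq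
    (readOne_diffForm hf x).2

theorem extD_diffForm {f : M → ℝ} (hf : ContMDiff (𝓡 n) 𝓘(ℝ, ℝ) ∞ f) (x : M) :
    extD (diffForm n f) x = 0 := by
  rw [extD_eq_flatD, flatD_congr (readOne_diffForm hf x).2]
  exact flatD_fderiv (readOne_diffForm hf x).1

end Charts

end Backlund

namespace Backlund

open Filter Topology

/-! ### Two-forms modulo one-forms -/

section Ideal

variable {n : ℕ}

theorem wedge_mem_wedgeIdeal {S : Set (Cov n)} {a : Cov n} (ha : a ∈ S) (c : Cov n) :
    wedge a c ∈ wedgeIdeal S := Submodule.subset_span ⟨a, ha, c, rfl⟩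

theorem wedge_swap (a b : Cov n) : wedge a b = -wedge b a := by
  ext v w; simp

theorem bil_neg_mem {S : Submodule ℝ (Bil n)} {β : Bil n} (h : β ∈ S) : -β ∈ S := by
  have : -β = (-1 : ℝ) • β := by ext; simp
  rw [this]
  exact S.smul_mem _ h

theorem wedge_mem_wedgeIdeal' {S : Set (Cov n)} {a : Cov n} (ha : a ∈ S) (c : Cov n) :
    wedge c a ∈ wedgeIdeal S := by
  rw [wedge_swap]
  exact bil_neg_mem (wedge_mem_wedgeIdeal ha c)

theorem wedgeIdeal_mono {S T : Set (Cov n)} (h : S ⊆ T) : wedgeIdeal S ≤ wedgeIdeal T :=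
  Submodule.span_mono fun _ ⟨a, ha, c, hc⟩ => ⟨a, h ha, c, hc⟩

theorem wedge_add_left (a b c : Cov n) : wedge (a + b) c = wedge a c + wedge b c := by
  ext v w; simp; ring

theorem wedge_smul_left (r : ℝ) (a c : Cov n) : wedge (r • a) c = r • wedge a c := by
  ext v w; simp; ring

theorem wedgeIdeal_span (S : Set (Cov n)) :
    wedgeIdeal (Submodule.span ℝ S : Set (Cov n)) = wedgeIdeal S := by
  refine le_antisymm (Submodule.span_le.2 ?_) (wedgeIdeal_mono Submodule.subset_span)
  rintro _ ⟨a, ha, c, rfl⟩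
  rw [SetLike.mem_coe] at ha ⊢
  induction ha using Submodule.span_induction with
  | mem x hx => exact wedge_mem_wedgeIdeal hx c
  | zero => convert! (wedgeIdeal S).zero_mem; ext; simp
  | add x y _ _ hx hy => rw [wedge_add_left]; exact add_mem hx hy
  | smul r x _ hx => rw [wedge_smul_left]; exact Submodule.smul_mem _ _ hx

theorem apply_eq_zero_of_mem_wedgeIdeal {S : Set (Cov n)} {β : Bil n} (hβ : β ∈ wedgeIdeal S)
    {v w : E n} (hv : ∀ a ∈ S, a v = 0) (hw : ∀ a ∈ S, a w = 0) : β v w = 0 := by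
  induction hβ using Submodule.span_induction with
  | mem x hx => obtain ⟨a, ha, c, rfl⟩ := hx; simp [hv a ha, hw a ha]
  | zero => rfl
  | add x y _ _ hx hy => simp [hx, hy]
  | smul r x _ hx => simp [hx]

theorem swap_of_apply_self {β : Bil n} (h : ∀ v, β v v = 0) (v w : E n) : β v w = -β w v := by
  have := h (v + w)
  simp only [map_add, add_apply, h] at this
  linarith

/-- With `κ x = 1`, projecting both arguments to `ker κ` along `x` gives `β = κ ∧ β(x, ·)`. This
turns integrability into a test on the kernel. -/
theorem mem_wedgeIdeal_singleton {κ : Cov n} (hκ : κ ≠ 0) {β : Bil n} (hβ : ∀ v, β v v = 0)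
    (h : ∀ v w, κ v = 0 → κ w = 0 → β v w = 0) : β ∈ wedgeIdeal {κ} := by
  obtain ⟨x, hx⟩ : ∃ x, κ x = 1 := by
    by_contra hc
    push Not at hc
    refine hκ (ContinuousLinearMap.ext fun v => ?_)
    by_contra hv
    refine hc ((κ v)⁻¹ • v) ?_
    rw [map_smul, smul_eq_mul]
    exact inv_mul_cancel₀ hv
  have : β = wedge κ (β x) := by
    ext v w
    have h1 := h (v - κ v • x) (w - κ w • x) (by simp [hx]) (by simp [hx])
    have h2 := swap_of_apply_self hβ v x
    simp only [map_sub, map_smul, sub_apply, smul_apply, smul_eq_mul, hβ, h2] at h1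
    simp only [wedge_apply]
    linarith
  rw [this]
  exact wedge_mem_wedgeIdeal (Set.mem_singleton κ) _

/-- A two-form that vanishes on the common kernel of two members of a coframe. -/
theorem eq_wedge_add_wedge {a b : Cov n} {x y : E n} (hax : a x = 1) (hay : a y = 0)
    (hbx : b x = 0) (hby : b y = 1) {β : Bil n} (hβ : ∀ v, β v v = 0)
    (h : ∀ v w, a v = 0 → b v = 0 → a w = 0 → b w = 0 → β v w = 0) :
    β = wedge a (β x - β x y • b) + wedge b (β y) := by
  ext v w
  have h1 := h (v - a v • x - b v • y) (w - a w • x - b w • y) (by simp [*]) (by simp [*])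
    (by simp [*]) (by simp [*])
  have h2 := swap_of_apply_self hβ v x
  have h3 := swap_of_apply_self hβ v y
  have h4 := swap_of_apply_self hβ y x
  simp only [map_sub, map_smul, sub_apply, smul_apply, smul_eq_mul, hβ, h2, h3, h4] at h1
  simp only [wedge_apply, add_apply, sub_apply, smul_apply, smul_eq_mul]
  linarith

theorem mem_wedgeIdeal_pair {a b : Cov n} {x y : E n} (hax : a x = 1) (hay : a y = 0)
    (hbx : b x = 0) (hby : b y = 1) {β : Bil n} (hβ : ∀ v, β v v = 0)
    (h : ∀ v w, a v = 0 → b v = 0 → a w = 0 → b w = 0 → β v w = 0) :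
    β ∈ wedgeIdeal {a, b} := by
  rw [eq_wedge_add_wedge hax hay hbx hby hβ h]
  exact add_mem (wedge_mem_wedgeIdeal (by simp) _) (wedge_mem_wedgeIdeal (by simp) _)

end Ideal

/-! ### Integrable lines in rank two systems -/

section Line

variable {n : ℕ} {M : Type*} [TopologicalSpace M] [ChartedSpace (E n) M]
  [IsManifold (𝓡 n) ∞ M]

/-- If the structure equations of `ω`, `ω'` read `dω ≡ c Ξ`, `dω' ≡ c' Ξ mod ω, ω'`, with a
two-form `Ξ` such that `Ξ ∧ γ ≡ 0` only for `γ ≡ 0`, then `c' ω - c ω'` is integrable. -/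
theorem exists_integrable_combination {U : Set M} (hU : IsOpen U) {e : Fin n → M → Cov n}
    (he : ∀ i, SmoothOneOn (e i) U) (hi : ∀ x ∈ U, LinearIndependent ℝ fun i => e i x)
    {i j k l : Fin n} (hij : i ≠ j) (hki : k ≠ i) (hkj : k ≠ j) (hli : l ≠ i) (hlj : l ≠ j)
    (h : ∀ x ∈ U, ∃ (Ξ : Bil n) (c c' : ℝ), (c ≠ 0 ∨ c' ≠ 0) ∧
      (∀ u v, e i x u = 0 → e j x u = 0 → e i x v = 0 → e j x v = 0 →
        extD (e i) x u v = c * Ξ u v ∧ extD (e j) x u v = c' * Ξ u v) ∧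
      Ξ (dualVec (fun i => e i x) k) (dualVec (fun i => e i x) l) = 1 ∧
      ∀ γ : Cov n, (∀ u v w, e i x u = 0 → e j x u = 0 → e i x v = 0 → e j x v = 0 →
          e i x w = 0 → e j x w = 0 → Ξ u v * γ w + Ξ v w * γ u + Ξ w u * γ v = 0) →
        ∀ w, e i x w = 0 → e j x w = 0 → γ w = 0) :
    ∃ η : M → Cov n, SmoothOneOn η U ∧ ∀ x ∈ U, η x ≠ 0 ∧
      η x ∈ Submodule.span ℝ {e i x, e j x} ∧ extD η x ∈ wedgeIdeal {η x} := by
  set f : Fin n → M → E n := fun a x => dualVec (fun i => e i x) a with hf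
  have hd : ∀ x ∈ U, ∀ a b, e a x (f b x) = if a = b then 1 else 0 := fun x hx a b =>
    apply_dualVec (hi x hx) a b
  -- The coefficients in `h` are given pointwise, with no smoothness. As `Ξ` takes the value one on
  -- the frame vectors `k` and `l`, they equal these smooth components of `dω` and `dω'`.
  set c : Fin n → M → ℝ := fun a x => extD (e a) x (f k x) (f l x) with hc
  have hcs : ∀ a, SmoothFunOn (n := n) (c a) U := fun a =>
    smoothFunOn_dualVec hU he hi (smoothOneOn_extD_dualVec hU he hi (he a) k) l
  have hΞ : ∀ x ∈ U, ∃ Ξ : Bil n, (c i x ≠ 0 ∨ c j x ≠ 0) ∧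
      (∀ u v, e i x u = 0 → e j x u = 0 → e i x v = 0 → e j x v = 0 →
        extD (e i) x u v = c i x * Ξ u v ∧ extD (e j) x u v = c j x * Ξ u v) ∧
      ∀ γ : Cov n, (∀ u v w, e i x u = 0 → e j x u = 0 → e i x v = 0 → e j x v = 0 →
          e i x w = 0 → e j x w = 0 → Ξ u v * γ w + Ξ v w * γ u + Ξ w u * γ v = 0) →
        ∀ w, e i x w = 0 → e j x w = 0 → γ w = 0 := by
    intro x hx
    obtain ⟨Ξ, r, r', hr, h1, h2, h3⟩ := h x hx
    obtain ⟨h4, h5⟩ := h1 (f k x) (f l x) (by simp [hd x hx, hki.symm])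
      (by simp [hd x hx, hkj.symm]) (by simp [hd x hx, hli.symm]) (by simp [hd x hx, hlj.symm])
    rw [h2, mul_one] at h4 h5
    have h4' : c i x = r := h4
    have h5' : c j x = r' := h5
    exact ⟨Ξ, by rwa [h4', h5'], by rwa [h4', h5'], h3⟩
  have hη : ∃ η : M → Cov n, SmoothOneOn η U ∧ (∀ x, η x = c j x • e i x + (-c i x) • e j x) ∧
      ∀ x ∈ U, ∀ u v, e i x u = 0 → e j x u = 0 → e i x v = 0 → e j x v = 0 →
        extD η x u v = c j x * extD (e i) x u v - c i x * extD (e j) x u v := by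
    have s1 := SmoothOneOn.smul (hcs j) (he i)
    have s2 := SmoothOneOn.smul (hcs i).neg (he j)
    refine ⟨fun x => c j x • e i x + (-c i x) • e j x, s1.add s2, fun _ => rfl, ?_⟩
    intro x hx u v h1 h2 h3 h4
    obtain ⟨a, ha⟩ := exists_extD_smul hx (hcs j) (he i x hx)
    obtain ⟨b, hb⟩ := exists_extD_smul hx (hcs i).neg (he j x hx)
    rw [extD_add (s1 x hx) (s2 x hx), ha, hb]
    simp [h1, h2, h3, h4]
    ring
  obtain ⟨η, hηs, hηe, hηd⟩ := hη
  have hker : ∀ x ∈ U, ∀ u v, e i x u = 0 → e j x u = 0 → e i x v = 0 → e j x v = 0 →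
      extD η x u v = 0 := by
    intro x hx u v h1 h2 h3 h4
    obtain ⟨Ξ, -, h5, -⟩ := hΞ x hx
    rw [hηd x hx u v h1 h2 h3 h4, (h5 u v h1 h2 h3 h4).1, (h5 u v h1 h2 h3 h4).2]
    ring
  have hδs : SmoothOneOn (fun x => extD η x (f j x)) U := smoothOneOn_extD_dualVec hU he hi hηs j
  -- The subtracted term keeps the `ω ∧ ω'` component of `dη` from being counted in both `γ` and
  -- `δ`.
  obtain ⟨γ, hγs, hγ⟩ : ∃ γ : M → Cov n, SmoothOneOn γ U ∧
      ∀ x, γ x = extD η x (f i x) - extD η x (f i x) (f j x) • e j x := by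
    have s := smoothOneOn_extD_dualVec hU he hi hηs i
    refine ⟨_, s.add (SmoothOneOn.smul (smoothFunOn_dualVec hU he hi s j).neg (he j)), ?_⟩
    intro x
    ext v
    simp [hf]
    ring
  obtain ⟨δ, hδ⟩ : ∃ δ : M → Cov n, δ = fun x => extD η x (f j x) := ⟨_, rfl⟩
  rw [← hδ] at hδs
  have hdη : ∀ x ∈ U, extD η x = wedge (e i x) (γ x) + wedge (e j x) (δ x) := by
    intro x hx
    have h1 : e i x (f i x) = 1 := by simp [hd x hx]
    have h2 : e i x (f j x) = 0 := by simp [hd x hx, hij]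
    have h3 : e j x (f i x) = 0 := by simp [hd x hx, hij.symm]
    have h4 : e j x (f j x) = 1 := by simp [hd x hx]
    rw [hγ, hδ]
    exact eq_wedge_add_wedge h1 h2 h3 h4 (extD_apply_self η x)
      fun v w h1 h2 h3 h4 => hker x hx v w h1 h2 h3 h4
  refine ⟨η, hηs, fun x hx => ?_⟩
  obtain ⟨Ξ, hne, h5, h6⟩ := hΞ x hx
  have hηx := hηe x
  have hne' : η x ≠ 0 := by
    intro h0
    have e1 := congrArg (fun a : Cov n => a (f i x)) (hηx.symm.trans h0)
    have e2 := congrArg (fun a : Cov n => a (f j x)) (hηx.symm.trans h0)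
    simp [hd x hx, hij, hij.symm] at e1 e2
    tauto
  refine ⟨hne', ?_, ?_⟩
  · rw [hηx]
    exact add_mem (Submodule.smul_mem _ _ (Submodule.subset_span (by simp)))
      (Submodule.smul_mem _ _ (Submodule.subset_span (by simp)))
  -- On `ker ω ∩ ker ω'` the identity `d(dη) = 0` says `Ξ ∧ (c γ + c' δ) = 0`, and `Ξ` is
  -- nondegenerate enough to cancel.
  have hμ : ∀ w, e i x w = 0 → e j x w = 0 → (c i x • γ x + c j x • δ x) w = 0 := by
    refine h6 _ fun u v w h1 h2 h3 h4 h7 h8 => ?_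
    have k := extD_extD hU hηs (he i) hγs (he j) hδs hdη hx u v w
    rw [(h5 u v h1 h2 h3 h4).1, (h5 u v h1 h2 h3 h4).2, (h5 v w h3 h4 h7 h8).1,
      (h5 v w h3 h4 h7 h8).2, (h5 w u h7 h8 h1 h2).1, (h5 w u h7 h8 h1 h2).2] at k
    simp only [h1, h2, h3, h4, h7, h8] at k
    simp only [add_apply, smul_apply, smul_eq_mul]
    linarith
  refine mem_wedgeIdeal_singleton hne' (extD_apply_self η x) fun v w hv hw => ?_
  -- Consequently `c γ + c' δ` is a combination of `ω` and `ω'`.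
  have hexp : ∀ v, c i x * γ x v + c j x * δ x v =
      e i x v * (c i x * γ x (f i x) + c j x * δ x (f i x)) +
        e j x v * (c i x * γ x (f j x) + c j x * δ x (f j x)) := by
    intro v
    have := hμ (v - e i x v • f i x - e j x v • f j x) (by simp [hd x hx, hij])
      (by simp [hd x hx, hij.symm])
    simp only [map_sub, map_smul, add_apply, smul_apply, smul_eq_mul] at this
    linarith
  have ev := hexp v
  have ew := hexp w
  rw [hηx] at hv hw
  simp only [add_apply, smul_apply, smul_eq_mul] at hv hw
  rw [hdη x hx]
  simp only [add_apply, wedge_apply]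
  -- On `ker η` the pair `(ω, ω')` is proportional to `(c, c')`.
  obtain ⟨s, hs1, hs2⟩ : ∃ s, e i x v = s * c i x ∧ e j x v = s * c j x := by
    rcases hne with h0 | h0
    · exact ⟨e i x v / c i x, by field_simp, by field_simp; linarith⟩
    · exact ⟨e j x v / c j x, by field_simp; linarith, by field_simp⟩
  obtain ⟨t, ht1, ht2⟩ : ∃ s, e i x w = s * c i x ∧ e j x w = s * c j x := by
    rcases hne with h0 | h0
    · exact ⟨e i x w / c i x, by field_simp, by field_simp; linarith⟩
    · exact ⟨e j x w / c j x, by field_simp; linarith, by field_simp⟩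
  rw [hs1, hs2] at ev ⊢
  rw [ht1, ht2] at ew ⊢
  -- Here `dη(v, w) = s μ(w) - t μ(v)` with `μ = c γ + c' δ`, while `μ(v)` and `μ(w)` are the same
  -- multiple of `s` and of `t`.
  linear_combination s * ew - t * ev

end Line

end Backlund

namespace Backlund

open Filter Topology

/-! ### Local sections of submersions -/

/-- Restrict `F` to the affine slice `y₀ + R w`, where `R` is a right inverse of the differential.
There the differential is the identity and the inverse function theorem applies. -/
theorem exists_smooth_rightInverse {X Y : Type*} [NormedAddCommGroup X] [NormedSpace ℝ X]
    [NormedAddCommGroup Y] [NormedSpace ℝ Y] [FiniteDimensional ℝ Y] {F : X → Y} {O : Set X}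
    (hO : IsOpen O) (hF : ∀ y ∈ O, ContDiffAt ℝ ∞ F y) {y₀ : X} (hy₀ : y₀ ∈ O)
    (hs : Function.Surjective (fderiv ℝ F y₀)) :
    ∃ (V : Set Y) (g : Y → X), IsOpen V ∧ F y₀ ∈ V ∧ g (F y₀) = y₀ ∧
      ∀ z ∈ V, ContDiffAt ℝ ∞ g z ∧ F (g z) = z ∧ g z ∈ O := by
  have : CompleteSpace Y := FiniteDimensional.complete ℝ Y
  obtain ⟨R, hR⟩ := (fderiv ℝ F y₀).exists_rightInverse_of_surjective
    (LinearMap.range_eq_top.2 hs)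
  have hι : ContDiff ℝ ∞ fun w : Y => y₀ + R w := contDiff_const.add R.contDiff
  set G : Y → Y := fun w => F (y₀ + R w) with hG
  set O' : Set Y := (fun w => y₀ + R w) ⁻¹' O with hO'
  have hO'o : IsOpen O' := hO.preimage hι.continuous
  have h0 : (0 : Y) ∈ O' := by simpa [hO'] using hy₀
  have hGs : ∀ w ∈ O', ContDiffAt ℝ ∞ G w := fun w hw =>
    ContDiffAt.comp w (hF _ hw) hι.contDiffAt
  have hG0 : G 0 = F y₀ := by simp [hG]
  have hGd : HasFDerivAt G ((ContinuousLinearEquiv.refl ℝ Y : Y ≃L[ℝ] Y) : Y →L[ℝ] Y) 0 := by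
    have h1 : HasFDerivAt (fun w : Y => y₀ + R w) R 0 := by
      simpa using R.hasFDerivAt.const_add y₀
    have h2 : HasFDerivAt F (fderiv ℝ F y₀) (y₀ + R 0) := by
      simpa using ((hF y₀ hy₀).differentiableAt (by simp)).hasFDerivAt
    have h3 := h2.comp (0 : Y) h1
    rw [hR] at h3
    exact h3
  let h := (hGs 0 h0).toOpenPartialHomeomorph G hGd (by simp)
  have hh : ∀ w, h w = G w := fun w => rfl
  have h0s : (0 : Y) ∈ h.source :=
    ContDiffAt.mem_toOpenPartialHomeomorph_source (hGs 0 h0) hGd (by simp)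
  -- Smoothness of the inverse is required on a whole open set, so the points with invertible
  -- derivative are collected in one.
  have hinv : ∀ᶠ w in 𝓝 (0 : Y), fderiv ℝ G w ∈ Set.range ((↑) : (Y ≃L[ℝ] Y) → Y →L[ℝ] Y) := by
    have hc : ContinuousAt (fderiv ℝ G) 0 :=
      ((hGs 0 h0).fderiv_right (m := ∞) (by simp)).continuousAt
    refine hc.eventually ?_
    rw [hGd.fderiv]
    exact ContinuousLinearEquiv.nhds _
  obtain ⟨S, hS, hSo, h0S⟩ := eventually_nhds_iff.1 hinv
  set W : Set Y := S ∩ O' ∩ h.source with hW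
  have hWo : IsOpen W := (hSo.inter hO'o).inter h.open_source
  refine ⟨h.target ∩ h.symm ⁻¹' W, fun z => y₀ + R (h.symm z), ?_, ?_, ?_, ?_⟩
  · exact h.isOpen_inter_preimage_symm hWo
  · rw [← hG0, ← hh]
    refine ⟨h.map_source h0s, ?_⟩
    rw [Set.mem_preimage, h.left_inv h0s]
    exact ⟨⟨h0S, h0⟩, h0s⟩
  · simp only [← hG0, ← hh, h.left_inv h0s]
    simp
  · rintro z ⟨hz, ⟨hz1, hz2⟩, hz3⟩
    refine ⟨?_, ?_, hz2⟩
    · obtain ⟨T, hT⟩ := hS _ hz1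
      have h1 : ContDiffAt ℝ ∞ h.symm z := by
        refine h.contDiffAt_symm (f₀' := T) hz ?_ (hGs _ hz2)
        rw [hT]
        exact ((hGs _ hz2).differentiableAt (by simp)).hasFDerivAt
      exact hι.contDiffAt.comp z h1
    · exact h.right_inv hz

section Section

variable {m n : ℕ}
  {M : Type*} [TopologicalSpace M] [ChartedSpace (E m) M] [IsManifold (𝓡 m) ∞ M]
  {N : Type*} [TopologicalSpace N] [ChartedSpace (E n) N] [IsManifold (𝓡 n) ∞ N]

/-- A submersion has a smooth local section through each point, on which a given
further independent function is constant. -/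
theorem exists_smooth_section {f : M → N} {g : M → ℝ} (hf : ContMDiff (𝓡 m) (𝓡 n) ∞ f)
    (hg : ContMDiff (𝓡 m) 𝓘(ℝ, ℝ) ∞ g) {p : M} (hgp : diffForm m g p ≠ 0)
    (hsub : ∀ w : E n, ∃ v : E m, diffForm m g p v = 0 ∧
      mder m n f p v = w)
    {U : Set M} (hU : IsOpen U) (hp : p ∈ U) :
    ∃ (V : Set N) (s : N → M), IsOpen V ∧ f p ∈ V ∧ s (f p) = p ∧ ∀ x ∈ V,
      ContMDiffAt (𝓡 n) (𝓡 m) ∞ s x ∧ f (s x) = x ∧ g (s x) = g p ∧ s x ∈ U := by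
  set φ := extChartAt (𝓡 m) p with hφ
  set ψ := extChartAt (𝓡 n) (f p) with hψ
  set F₁ : E m → E n := ψ ∘ f ∘ φ.symm with hF₁
  set F₂ : E m → ℝ := g ∘ φ.symm with hF₂
  set F : E m → E n × ℝ := fun y => (F₁ y, F₂ y) with hF
  have hφc : ContinuousOn φ.symm φ.target := continuousOn_extChartAt_symm p
  set O : Set (E m) := φ.target ∩ φ.symm ⁻¹' (U ∩ f ⁻¹' ψ.source) with hO
  have hOo : IsOpen O := hφc.isOpen_inter_preimage (isOpen_extChartAt_target p)
    (hU.inter ((isOpen_extChartAt_source (f p)).preimage hf.continuous))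
  have hF₁s : ∀ y ∈ O, ContDiffAt ℝ ∞ F₁ y := by
    intro y hy
    have h1 : ContMDiffAt (𝓡 n) (𝓡 n) ∞ ψ (f (φ.symm y)) :=
      contMDiffAt_extChartAt' (by rw [← extChartAt_source (𝓡 n)]; exact hy.2.2)
    exact contMDiffAt_iff_contDiffAt.1
      (h1.comp y ((hf (φ.symm y)).comp y (contMDiffAt_chart_symm hy.1)))
  have hF₂s : ∀ y ∈ O, ContDiffAt ℝ ∞ F₂ y := fun y hy =>
    contMDiffAt_iff_contDiffAt.1 ((hg (φ.symm y)).comp y (contMDiffAt_chart_symm hy.1))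
  have hFs : ∀ y ∈ O, ContDiffAt ℝ ∞ F y := fun y hy => (hF₁s y hy).prodMk (hF₂s y hy)
  have hpy : φ.symm (φ p) = p := extChartAt_to_inv p
  have hy₀ : φ p ∈ O := by
    refine ⟨mem_extChartAt_target p, ?_⟩
    rw [Set.mem_preimage, hpy]
    exact ⟨hp, mem_extChartAt_source (f p)⟩
  have hd₁ : fderiv ℝ F₁ (φ p) = mder m n f p :=
    (mfderiv_eq_fderiv_chart (hf p)).symm
  have hd₂ : fderiv ℝ F₂ (φ p) = diffForm m g p := by
    rw [← readOne_self (diffForm m g) p]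
    exact (readOne_diffForm hg p).2.eq_of_nhds.symm
  have hdF : fderiv ℝ F (φ p) = (fderiv ℝ F₁ (φ p)).prod (fderiv ℝ F₂ (φ p)) :=
    (((hF₁s _ hy₀).differentiableAt (by simp)).hasFDerivAt.prodMk
      ((hF₂s _ hy₀).differentiableAt (by simp)).hasFDerivAt).fderiv
  have hsurj : Function.Surjective (fderiv ℝ F (φ p)) := by
    rintro ⟨w, r⟩
    obtain ⟨t, ht⟩ : ∃ t, diffForm m g p t ≠ 0 := by
      by_contra hc
      push Not at hc
      exact hgp (ContinuousLinearMap.ext hc)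
    -- A multiple of `t` gives the `dg`-component its prescribed value; a vector of `ker dg` then
    -- corrects the component along `N`.
    set t' := (r / diffForm m g p t) • t with ht'
    obtain ⟨v, hv1, hv2⟩ := hsub (w - mder m n f p t')
    refine ⟨v + t', ?_⟩
    rw [hdF, hd₁, hd₂]
    rw [ContinuousLinearMap.prod_apply, map_add, map_add, hv1, hv2, sub_add_cancel, zero_add]
    simp [ht', ht]
  obtain ⟨V, h, hV, hVm, hh0, hh⟩ := exists_smooth_rightInverse hOo hFs hy₀ hsurj
  have hcψ : ContinuousOn (fun x => (ψ x, g p)) ψ.source :=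
    (continuousOn_extChartAt (f p)).prodMk continuousOn_const
  have hF0 : F (φ p) = (ψ (f p), g p) := by simp only [hF, hF₁, hF₂, Function.comp_apply, hpy]
  rw [hF0] at hVm hh0
  refine ⟨ψ.source ∩ (fun x => (ψ x, g p)) ⁻¹' V, fun x => φ.symm (h (ψ x, g p)), ?_, ?_, ?_, ?_⟩
  · exact hcψ.isOpen_inter_preimage (isOpen_extChartAt_source (f p)) hV
  · exact ⟨mem_extChartAt_source (f p), hVm⟩
  · simp only [hh0, hpy]
  · rintro x ⟨hx1, hx2⟩
    obtain ⟨h1, h2, h3⟩ := hh _ hx2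
    have h4 : ContMDiffAt (𝓡 n) (𝓡 n) ∞ ψ x :=
      contMDiffAt_extChartAt' (by rw [← extChartAt_source (𝓡 n)]; exact hx1)
    have h5 : ContDiffAt ℝ ∞ (fun z : E n => h (z, g p)) (ψ x) :=
      h1.comp (ψ x) (contDiffAt_id.prodMk contDiffAt_const)
    refine ⟨?_, ?_, ?_, h3.2.1⟩
    · exact (contMDiffAt_chart_symm h3.1).comp x (h5.contMDiffAt.comp x h4)
    · have := congrArg Prod.fst h2
      exact ψ.injOn h3.2.2 hx1 this
    · exact congrArg Prod.snd h2

/-- An integrable form on the total space which, modulo `dg`, is pulled back pointwise from a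
system on the base yields an integrable line in that system. -/
theorem hasIntegrableLineNear_of_form {f : M → N} {g : M → ℝ} (hf : ContMDiff (𝓡 m) (𝓡 n) ∞ f)
    (hg : ContMDiff (𝓡 m) 𝓘(ℝ, ℝ) ∞ g) {p : M} (hgp : diffForm m g p ≠ 0)
    (hsub : ∀ w : E n, ∃ v : E m, diffForm m g p v = 0 ∧
      mder m n f p v = w)
    {U : Set M} (hU : IsOpen U) (hp : p ∈ U) {η : M → Cov m} (hη : SmoothOneOn η U)
    (hd : ∀ q ∈ U, extD η q ∈ wedgeIdeal {η q}) {C : N → Submodule ℝ (Cov n)}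
    (hC : ∀ q ∈ U, ∃ α ∈ C (f q), α ≠ 0 ∧ ∃ c : ℝ,
      η q = pullCov (mder m n f q) α + c • diffForm m g q) :
    HasIntegrableLineNear C (f p) := by
  obtain ⟨V, s, hV, hpV, -, hs⟩ := exists_smooth_section hf hg hgp hsub hU hp
  -- Since `f ∘ s = id` and `g ∘ s` is constant, `s*(f*α + c dg) = α`.
  have key : ∀ x ∈ V, ∃ α ∈ C x, α ≠ 0 ∧ pullForm n m s η x = α := by
    intro x hx
    obtain ⟨h1, h2, h3, h4⟩ := hs x hx
    obtain ⟨α, hα, hα0, c, hc⟩ := hC _ h4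
    rw [h2] at hα
    refine ⟨α, hα, hα0, ?_⟩
    have hsd := h1.mdifferentiableAt (by simp : (∞ : WithTop ℕ∞) ≠ 0)
    have e1 := mfderiv_comp x ((hf (s x)).mdifferentiableAt (by simp)) hsd
    have e2 := mfderiv_comp x ((hg (s x)).mdifferentiableAt (by simp)) hsd
    have e3 : mfderiv (𝓡 n) (𝓡 n) (f ∘ s) x = mfderiv (𝓡 n) (𝓡 n) id x := by
      apply EventuallyEq.mfderiv_eq
      filter_upwards [hV.mem_nhds hx] with z hz
      exact (hs z hz).2.1
    have e4 : mfderiv (𝓡 n) 𝓘(ℝ, ℝ) (g ∘ s) x = mfderiv (𝓡 n) 𝓘(ℝ, ℝ) (fun _ => g p) x := by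
      apply EventuallyEq.mfderiv_eq
      filter_upwards [hV.mem_nhds hx] with z hz
      exact (hs z hz).2.2.1
    ext v
    have e5 : mder m n f (s x)
        (mder n m s x v) = v := by
      have := congrArg (fun T : E n →L[ℝ] E n => T v) (e1.symm.trans (e3.trans mfderiv_id))
      exact this
    have e6 : diffForm m g (s x) (mder n m s x v) = 0 := by
      have := congrArg (fun T : E n →L[ℝ] ℝ => T v) (e2.symm.trans (e4.trans mfderiv_const))
      exact this
    rw [pullForm, hc]
    simp only [pullCov_apply, add_apply, smul_apply, e5, e6]
    simp
  refine ⟨V, hV, hpV, pullForm n m s η, fun x hx => SmoothOneAt.pullForm (hη _ (hs x hx).2.2.2) (hs x hx).1, ?_⟩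
  intro x hx
  obtain ⟨α, hα, hα0, hκ⟩ := key x hx
  refine ⟨hκ ▸ hα0, hκ ▸ hα, ?_⟩
  have hq := (hs x hx).2.2.2
  rw [extD_pullForm (hη _ hq) (hs x hx).1]
  refine mem_wedgeIdeal_singleton (hκ ▸ hα0) (fun v => ?_) fun v w hv hw => ?_
  · exact extD_apply_self _ _ _
  · refine apply_eq_zero_of_mem_wedgeIdeal (hd _ hq) ?_ ?_
    · rintro _ rfl; exact hv
    · rintro _ rfl; exact hw

end Section

end Backlund

namespace Backlund

open Filter Topology

/-! ### Contact forms on a five-dimensional space -/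

section Contact

theorem fiveForm_apply (a : Cov 5) (β : Bil 5) (v : Fin 5 → E 5) :
    fiveForm a β v =
      a (v 0) * (β (v 1) (v 2) * β (v 3) (v 4) - β (v 1) (v 3) * β (v 2) (v 4) +
        β (v 1) (v 4) * β (v 2) (v 3)) -
      a (v 1) * (β (v 0) (v 2) * β (v 3) (v 4) - β (v 0) (v 3) * β (v 2) (v 4) +
        β (v 0) (v 4) * β (v 2) (v 3)) +
      a (v 2) * (β (v 0) (v 1) * β (v 3) (v 4) - β (v 0) (v 3) * β (v 1) (v 4) +
        β (v 0) (v 4) * β (v 1) (v 3)) -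
      a (v 3) * (β (v 0) (v 1) * β (v 2) (v 4) - β (v 0) (v 2) * β (v 1) (v 4) +
        β (v 0) (v 4) * β (v 1) (v 2)) +
      a (v 4) * (β (v 0) (v 1) * β (v 2) (v 3) - β (v 0) (v 2) * β (v 1) (v 3) +
        β (v 0) (v 3) * β (v 1) (v 2)) := by
  have h1 : ∀ (i : Fin 5), sqForm β (fun j => v (i.succAbove j)) =
      β (v (i.succAbove 0)) (v (i.succAbove 1)) * β (v (i.succAbove 2)) (v (i.succAbove 3)) -
      β (v (i.succAbove 0)) (v (i.succAbove 2)) * β (v (i.succAbove 1)) (v (i.succAbove 3)) +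
      β (v (i.succAbove 0)) (v (i.succAbove 3)) * β (v (i.succAbove 1)) (v (i.succAbove 2)) :=
    fun i => rfl
  have h3 : (1 : Fin 5).succAbove = ![0, 2, 3, 4] := by decide
  have h4 : (2 : Fin 5).succAbove = ![0, 1, 3, 4] := by decide
  have h5 : (3 : Fin 5).succAbove = ![0, 1, 2, 4] := by decide
  have h6 : (4 : Fin 5).succAbove = ![0, 1, 2, 3] := by decide
  simp [fiveForm, h1, Fin.sum_univ_five, h3, h4, h5, h6]
  ring

/-- A kernel vector of a bordered skew-symmetric matrix is annihilated by its Pfaffian. -/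
theorem bordered_pfaffian_kernel {t0 t1 t2 t3 t4 b01 b02 b03 b04 b12 b13 b14 b23 b24 b34 : ℝ}
    {c0 c1 c2 c3 c4 μ F : ℝ}
    (hF : F = t0 * (b12 * b34 - b13 * b24 + b14 * b23) - t1 * (b02 * b34 - b03 * b24 + b04 * b23) +
      t2 * (b01 * b34 - b03 * b14 + b04 * b13) - t3 * (b01 * b24 - b02 * b14 + b04 * b12) +
      t4 * (b01 * b23 - b02 * b13 + b03 * b12))
    (rx : c0 * t0 + c1 * t1 + c2 * t2 + c3 * t3 + c4 * t4 = 0)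
    (r0 : -c1 * b01 - c2 * b02 - c3 * b03 - c4 * b04 = μ * t0)
    (r1 : c0 * b01 - c2 * b12 - c3 * b13 - c4 * b14 = μ * t1)
    (r2 : c0 * b02 + c1 * b12 - c3 * b23 - c4 * b24 = μ * t2)
    (r3 : c0 * b03 + c1 * b13 + c2 * b23 - c4 * b34 = μ * t3)
    (r4 : c0 * b04 + c1 * b14 + c2 * b24 + c3 * b34 = μ * t4) :
    c0 * F = 0 ∧ c1 * F = 0 ∧ c2 * F = 0 ∧ c3 * F = 0 ∧ c4 * F = 0 := by
  subst hF
  refine ⟨?_, ?_, ?_, ?_, ?_⟩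
  -- The multipliers are the sub-Pfaffians of size four, that is, a row of the Pfaffian adjugate of
  -- the bordered matrix.
  · linear_combination (b12 * b34 - b13 * b24 + b14 * b23) * rx
      + (t2 * b34 - t3 * b24 + t4 * b23) * r1
      - (t1 * b34 - t3 * b14 + t4 * b13) * r2
      + (t1 * b24 - t2 * b14 + t4 * b12) * r3
      - (t1 * b23 - t2 * b13 + t3 * b12) * r4
  · linear_combination -(b02 * b34 - b03 * b24 + b04 * b23) * rx
      - (t2 * b34 - t3 * b24 + t4 * b23) * r0
      + (t0 * b34 - t3 * b04 + t4 * b03) * r2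
      - (t0 * b24 - t2 * b04 + t4 * b02) * r3
      + (t0 * b23 - t2 * b03 + t3 * b02) * r4
  · linear_combination (b01 * b34 - b03 * b14 + b04 * b13) * rx
      + (t1 * b34 - t3 * b14 + t4 * b13) * r0
      - (t0 * b34 - t3 * b04 + t4 * b03) * r1
      + (t0 * b14 - t1 * b04 + t4 * b01) * r3
      - (t0 * b13 - t1 * b03 + t3 * b01) * r4
  · linear_combination -(b01 * b24 - b02 * b14 + b04 * b12) * rx
      - (t1 * b24 - t2 * b14 + t4 * b12) * r0
      + (t0 * b24 - t2 * b04 + t4 * b02) * r1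
      - (t0 * b14 - t1 * b04 + t4 * b01) * r2
      + (t0 * b12 - t1 * b02 + t2 * b01) * r4
  · linear_combination (b01 * b23 - b02 * b13 + b03 * b12) * rx
      + (t1 * b23 - t2 * b13 + t3 * b12) * r0
      - (t0 * b23 - t2 * b03 + t3 * b02) * r1
      + (t0 * b13 - t1 * b03 + t3 * b01) * r2
      - (t0 * b12 - t1 * b02 + t2 * b01) * r3

/-- Either the five vectors form a basis (`r = 1`) or they are dependent (`r = 0`). Both cases feed
the same Pfaffian identity. -/
theorem exists_sum_of_five (V : Fin 5 → E 5) (v : E 5) (hv : v ≠ 0) :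
    ∃ c : Fin 5 → ℝ, c ≠ 0 ∧ ∃ r : ℝ, ∑ i, c i • V i = r • v := by
  by_cases hi : LinearIndependent ℝ V
  · have hs : Submodule.span ℝ (Set.range V) = ⊤ :=
      hi.span_eq_top_of_card_eq_finrank' (by simp)
    obtain ⟨c, hc⟩ := (Submodule.mem_span_range_iff_exists_fun ℝ).1
      (hs ▸ Submodule.mem_top : v ∈ Submodule.span ℝ (Set.range V))
    refine ⟨c, ?_, 1, by simpa using hc⟩
    rintro rfl
    exact hv (by simpa using hc.symm)
  · obtain ⟨c, hc, i, hi⟩ := Fintype.not_linearIndependent_iff.1 hi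
    exact ⟨c, fun h => hi (by simp [h]), 0, by simpa using hc⟩

/-- On the kernel of a contact form its exterior derivative is nondegenerate. -/
theorem contact_nondegenerate {θ : Cov 5} {β : Bil 5} (hβ : ∀ v, β v v = 0)
    (h : fiveForm θ β ≠ 0) {v : E 5} (hv : θ v = 0) (hβv : ∀ w, θ w = 0 → β v w = 0) :
    v = 0 := by
  by_contra hv0
  apply h
  funext V
  obtain ⟨c, hc, r, hr⟩ := exists_sum_of_five V v hv0
  -- The covector `β(v, ·)` vanishes on `ker θ`, hence is a multiple of `θ`. In terms of the five
  -- vectors this says that `c` and `μ` form a kernel vector of the bordered matrix.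
  obtain ⟨μ, hμ⟩ : ∃ μ : ℝ, ∀ w, β v w = μ * θ w := by
    by_cases hθ : ∃ x, θ x ≠ 0
    · obtain ⟨x, hx⟩ := hθ
      refine ⟨β v x / θ x, fun w => ?_⟩
      have := hβv (w - (θ w / θ x) • x) (by simp [hx])
      simp only [map_sub, map_smul, smul_eq_mul] at this
      field_simp at this ⊢
      linarith
    · push Not at hθ
      exact ⟨0, fun w => by simp [hβv w (hθ w)]⟩
  have rx := congrArg θ hr
  have rw' : ∀ j, β (∑ i, c i • V i) (V j) = r * μ * θ (V j) := fun j => by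
    rw [hr, map_smul, smul_apply, hμ]; simp; ring
  have sw := swap_of_apply_self hβ
  have key := bordered_pfaffian_kernel (fiveForm_apply θ β V) (c0 := c 0) (c1 := c 1) (c2 := c 2)
    (c3 := c 3) (c4 := c 4) (μ := r * μ)
    (by simpa [Fin.sum_univ_five, hv] using rx)
    (by have := rw' 0
        simp [Fin.sum_univ_five, hβ, sw (V 1) (V 0), sw (V 2) (V 0), sw (V 3) (V 0),
          sw (V 4) (V 0)] at this
        linarith)
    (by have := rw' 1
        simp [Fin.sum_univ_five, hβ, sw (V 2) (V 1), sw (V 3) (V 1), sw (V 4) (V 1)] at this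
        linarith)
    (by have := rw' 2
        simp [Fin.sum_univ_five, hβ, sw (V 3) (V 2), sw (V 4) (V 2)] at this
        linarith)
    (by have := rw' 3
        simp [Fin.sum_univ_five, hβ, sw (V 4) (V 3)] at this
        linarith)
    (by have := rw' 4
        simp [Fin.sum_univ_five, hβ] at this
        linarith)
  by_contra hF
  have hF' : fiveForm θ β V ≠ 0 := hF
  apply hc
  funext i
  obtain ⟨k0, k1, k2, k3, k4⟩ := key
  fin_cases i
  · simpa [hF'] using k0
  · simpa [hF'] using k1
  · simpa [hF'] using k2
  · simpa [hF'] using k3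
  · simpa [hF'] using k4

end Contact

end Backlund

namespace Backlund

open Filter Topology

/-! ### Adapted coframes of hyperbolic Monge-Ampère systems -/

section Adapted

/-- The two-covector `wedge a b` only depends, up to a factor and modulo `θ`, on the span of
`θ, a, b`. -/
theorem exists_wedge_sub_mem {n : ℕ} {θ a b a' b' : Cov n}
    (ha : a' ∈ Submodule.span ℝ {θ, a, b}) (hb : b' ∈ Submodule.span ℝ {θ, a, b}) :
    ∃ r : ℝ, wedge a' b' - r • wedge a b ∈ wedgeIdeal {θ} := by
  obtain ⟨x, y, z, rfl⟩ := Submodule.mem_span_triple.1 ha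
  obtain ⟨x', y', z', rfl⟩ := Submodule.mem_span_triple.1 hb
  refine ⟨y * z' - z * y', ?_⟩
  have : wedge (x • θ + y • a + z • b) (x' • θ + y' • a + z' • b) -
      (y * z' - z * y') • wedge a b =
      wedge θ (x • (y' • a + z' • b) - x' • (y • a + z • b)) := by
    ext v w
    simp only [wedge_apply, sub_apply, add_apply, smul_apply, smul_eq_mul]
    ring
  rw [this]
  exact wedge_mem_wedgeIdeal (Set.mem_singleton θ) _

theorem span_triple_range {n : ℕ} (a b c : Cov n) :
    Submodule.span ℝ (Set.range ![a, b, c]) = Submodule.span ℝ {a, b, c} := by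
  congr 1
  ext x
  simp only [Set.mem_range, Fin.exists_fin_succ, Set.mem_insert_iff, Set.mem_singleton_iff]
  simp [eq_comm]

theorem eq_span_triple {n : ℕ} {S : Submodule ℝ (Cov n)} {α : Fin 3 → Cov n}
    (hS : S = Submodule.span ℝ (Set.range α)) {a b c : Cov n}
    (hi : LinearIndependent ℝ ![a, b, c]) (ha : a ∈ S) (hb : b ∈ S) (hc : c ∈ S) :
    S = Submodule.span ℝ {a, b, c} := by
  symm
  apply Submodule.eq_of_le_of_finrank_le
  · rw [Submodule.span_le]
    rintro x (rfl | rfl | rfl) <;> assumption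
  · rw [← span_triple_range, finrank_span_eq_card hi, hS]
    exact finrank_range_le_card α

/-- Exchange: a generator that occurs in `θ` with nonzero coefficient may be replaced by `θ`. -/
theorem exists_span_triple {n : ℕ} {α : Fin 3 → Cov n} {θ : Cov n} (hθ : θ ≠ 0)
    (h : θ ∈ Submodule.span ℝ (Set.range α)) :
    ∃ i j, Submodule.span ℝ (Set.range α) = Submodule.span ℝ {θ, α i, α j} := by
  obtain ⟨g, hg⟩ := (Submodule.mem_span_range_iff_exists_fun ℝ).1 h
  obtain ⟨k, hk⟩ : ∃ k, g k ≠ 0 := by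
    by_contra hc
    push Not at hc
    exact hθ (by simpa [hc] using hg.symm)
  rw [Fin.sum_univ_three] at hg
  have key : ∃ i j, ∀ l, α l ∈ Submodule.span ℝ {θ, α i, α j} := by
    fin_cases k
    · refine ⟨1, 2, fun l => ?_⟩
      fin_cases l
      · refine Submodule.mem_span_triple.2 ⟨(g 0)⁻¹, -(g 0)⁻¹ * g 1, -(g 0)⁻¹ * g 2, ?_⟩
        have hk' : g 0 ≠ 0 := hk
        rw [← hg]
        ext v
        simp
        field_simp
        ring
      · exact Submodule.subset_span (by simp)
      · exact Submodule.subset_span (by simp)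
    · refine ⟨0, 2, fun l => ?_⟩
      fin_cases l
      · exact Submodule.subset_span (by simp)
      · refine Submodule.mem_span_triple.2 ⟨(g 1)⁻¹, -(g 1)⁻¹ * g 0, -(g 1)⁻¹ * g 2, ?_⟩
        have hk' : g 1 ≠ 0 := hk
        rw [← hg]
        ext v
        simp
        field_simp
        ring
      · exact Submodule.subset_span (by simp)
    · refine ⟨0, 1, fun l => ?_⟩
      fin_cases l
      · exact Submodule.subset_span (by simp)
      · exact Submodule.subset_span (by simp)
      · refine Submodule.mem_span_triple.2 ⟨(g 2)⁻¹, -(g 2)⁻¹ * g 0, -(g 2)⁻¹ * g 1, ?_⟩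
        have hk' : g 2 ≠ 0 := hk
        rw [← hg]
        ext v
        simp
        field_simp
        ring
  obtain ⟨i, j, hij⟩ := key
  refine ⟨i, j, le_antisymm (Submodule.span_le.2 ?_) (Submodule.span_le.2 ?_)⟩
  · rintro _ ⟨l, rfl⟩; exact hij l
  · rintro x (rfl | rfl | rfl)
    · exact h
    · exact Submodule.subset_span ⟨i, rfl⟩
    · exact Submodule.subset_span ⟨j, rfl⟩

/-- `θ, a, b, c, d` is a coframe in which the degree-two part of a Monge-Ampère system is spanned
by `a ∧ b` and `c ∧ d` modulo `θ`, both of which occur in `β = dθ`. -/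
structure IsSplit (two : Submodule ℝ (Bil 5)) (β : Bil 5) (θ a b c d : Cov 5) : Prop where
  indep : LinearIndependent ℝ ![θ, a, b, c, d]
  fst_mem : wedge a b ∈ two
  snd_mem : wedge c d ∈ two
  exists_sub_mem : ∀ γ ∈ two, ∃ p q : ℝ, γ - (p • wedge a b + q • wedge c d) ∈ wedgeIdeal {θ}
  exists_contact : ∃ p q : ℝ, p ≠ 0 ∧ q ≠ 0 ∧
    β - (p • wedge a b + q • wedge c d) ∈ wedgeIdeal {θ}

/-- Modulo `θ` the degree-two part is spanned by `β` and `Ψ`, so two elements independent modulo `θ`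
span it. The proof is Cramer's rule. -/
theorem exists_combination_of_factors {two : Submodule ℝ (Bil 5)} {θ : Cov 5} {β Ψ φ χ : Bil 5}
    (htwo : two = Submodule.span ℝ {β, Ψ} ⊔ wedgeIdeal {θ}) (hφ : φ ∈ two) (hχ : χ ∈ two)
    (hi : ∀ s t : ℝ, s • φ + t • χ ∈ wedgeIdeal {θ} → s = 0 ∧ t = 0) :
    ∀ γ ∈ two, ∃ p q : ℝ, γ - (p • φ + q • χ) ∈ wedgeIdeal {θ} := by
  have dec : ∀ γ ∈ two, ∃ s t : ℝ, ∃ w ∈ wedgeIdeal {θ}, γ = s • β + t • Ψ + w := by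
    intro γ hγ
    rw [htwo] at hγ
    obtain ⟨y, hy, w, hw, rfl⟩ := Submodule.mem_sup.1 hγ
    obtain ⟨s, t, rfl⟩ := Submodule.mem_span_pair.1 hy
    exact ⟨s, t, w, hw, rfl⟩
  obtain ⟨s₁, t₁, w₁, hw₁, h₁⟩ := dec φ hφ
  obtain ⟨s₂, t₂, w₂, hw₂, h₂⟩ := dec χ hχ
  -- A zero determinant yields two relations modulo `θ` between `φ` and `χ`. Their triviality gives
  -- `s₁ = t₁ = 0`, so that `φ` itself is zero modulo `θ`.
  have hdet : s₁ * t₂ - s₂ * t₁ ≠ 0 := by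
    intro h0
    have e1 : t₂ • φ + (-t₁) • χ = t₂ • w₁ + (-t₁) • w₂ := by
      rw [h₁, h₂]
      ext v w
      simp only [add_apply, smul_apply, smul_eq_mul]
      linear_combination (β v w) * h0
    have e2 : s₂ • φ + (-s₁) • χ = s₂ • w₁ + (-s₁) • w₂ := by
      rw [h₁, h₂]
      ext v w
      simp only [add_apply, smul_apply, smul_eq_mul]
      linear_combination (-(Ψ v w)) * h0
    obtain ⟨a1, a2⟩ := hi _ _ (e1 ▸ Submodule.add_mem _ (Submodule.smul_mem _ _ hw₁)
      (Submodule.smul_mem _ _ hw₂))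
    obtain ⟨a3, a4⟩ := hi _ _ (e2 ▸ Submodule.add_mem _ (Submodule.smul_mem _ _ hw₁)
      (Submodule.smul_mem _ _ hw₂))
    have h3 : φ = w₁ := by
      rw [h₁, neg_eq_zero.1 a4, neg_eq_zero.1 a2]
      ext v w
      simp
    have h4 : (1 : ℝ) • φ + (0 : ℝ) • χ = w₁ := by
      rw [h3]
      ext v w
      simp
    have := hi 1 0 (h4 ▸ hw₁)
    simp at this
  intro γ hγ
  obtain ⟨s, t, w, hw, rfl⟩ := dec γ hγ
  refine ⟨(s * t₂ - t * s₂) / (s₁ * t₂ - s₂ * t₁), (t * s₁ - s * t₁) / (s₁ * t₂ - s₂ * t₁), ?_⟩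
  set p := (s * t₂ - t * s₂) / (s₁ * t₂ - s₂ * t₁) with hp
  set q := (t * s₁ - s * t₁) / (s₁ * t₂ - s₂ * t₁) with hq
  have hs : s = p * s₁ + q * s₂ := by
    rw [hp, hq, div_mul_eq_mul_div, div_mul_eq_mul_div, ← add_div, eq_div_iff hdet]
    ring
  have ht : t = p * t₁ + q * t₂ := by
    rw [hp, hq, div_mul_eq_mul_div, div_mul_eq_mul_div, ← add_div, eq_div_iff hdet]
    ring
  have e : s • β + t • Ψ + w - (p • φ + q • χ) = w + ((-p) • w₁ + (-q) • w₂) := by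
    rw [h₁, h₂]
    ext v u
    simp only [add_apply, sub_apply, smul_apply, smul_eq_mul]
    linear_combination (β v u) * hs + (Ψ v u) * ht
  rw [e]
  exact Submodule.add_mem _ hw (Submodule.add_mem _ (Submodule.smul_mem _ _ hw₁)
    (Submodule.smul_mem _ _ hw₂))

/-- Replacing the given factors by other generators rescales the decomposable forms modulo `θ`. A
common zero of `θ, a, b, c, d` would lie in the radical of `β` on `ker θ`, hence is zero. If one
coefficient of `β` vanished, a dual vector of the corresponding pair would lie in that radical. -/
theorem isSplit_of_factors {two : Submodule ℝ (Bil 5)} {θ : Cov 5} {β Ψ : Bil 5}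
    (hβ : ∀ v, β v v = 0) (hc : fiveForm θ β ≠ 0)
    (htwo : two = Submodule.span ℝ {β, Ψ} ⊔ wedgeIdeal {θ}) {a₀ b₀ c₀ d₀ : Cov 5}
    (h₁ : wedge a₀ b₀ ∈ two) (h₂ : wedge c₀ d₀ ∈ two)
    (hi : ∀ s t : ℝ, s • wedge a₀ b₀ + t • wedge c₀ d₀ ∈ wedgeIdeal {θ} → s = 0 ∧ t = 0)
    {a b c d : Cov 5} (hab : Submodule.span ℝ {θ} ⊔ Submodule.span ℝ {a₀, b₀} =
      Submodule.span ℝ {θ, a, b})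
    (hcd : Submodule.span ℝ {θ} ⊔ Submodule.span ℝ {c₀, d₀} = Submodule.span ℝ {θ, c, d}) :
    IsSplit two β θ a b c d := by
  have hle : wedgeIdeal {θ} ≤ two := htwo ▸ le_sup_right
  obtain ⟨r, hr⟩ : ∃ r : ℝ, wedge a₀ b₀ - r • wedge a b ∈ wedgeIdeal {θ} := by
    apply exists_wedge_sub_mem <;> rw [← hab] <;>
      exact Submodule.mem_sup_right (Submodule.subset_span (by simp))
  obtain ⟨s, hs⟩ : ∃ r : ℝ, wedge c₀ d₀ - r • wedge c d ∈ wedgeIdeal {θ} := by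
    apply exists_wedge_sub_mem <;> rw [← hcd] <;>
      exact Submodule.mem_sup_right (Submodule.subset_span (by simp))
  have hr0 : r ≠ 0 := by
    rintro rfl
    have e : (1 : ℝ) • wedge a₀ b₀ + (0 : ℝ) • wedge c₀ d₀ =
        wedge a₀ b₀ - (0 : ℝ) • wedge a b := by
      ext v w
      simp
    have := hi 1 0 (e ▸ hr)
    simp at this
  have hs0 : s ≠ 0 := by
    rintro rfl
    have e : (0 : ℝ) • wedge a₀ b₀ + (1 : ℝ) • wedge c₀ d₀ =
        wedge c₀ d₀ - (0 : ℝ) • wedge c d := by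
      ext v w
      simp
    have := hi 0 1 (e ▸ hs)
    simp at this
  have m₁ : wedge a b ∈ two := by
    have : wedge a b = r⁻¹ • wedge a₀ b₀ + (-r⁻¹) • (wedge a₀ b₀ - r • wedge a b) := by
      ext v w
      simp only [add_apply, sub_apply, smul_apply, smul_eq_mul]
      field_simp
      ring
    rw [this]
    exact Submodule.add_mem _ (Submodule.smul_mem _ _ h₁) (Submodule.smul_mem _ _ (hle hr))
  have m₂ : wedge c d ∈ two := by
    have : wedge c d = s⁻¹ • wedge c₀ d₀ + (-s⁻¹) • (wedge c₀ d₀ - s • wedge c d) := by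
      ext v w
      simp only [add_apply, sub_apply, smul_apply, smul_eq_mul]
      field_simp
      ring
    rw [this]
    exact Submodule.add_mem _ (Submodule.smul_mem _ _ h₂) (Submodule.smul_mem _ _ (hle hs))
  have hex : ∀ γ ∈ two, ∃ p q : ℝ,
      γ - (p • wedge a b + q • wedge c d) ∈ wedgeIdeal {θ} := by
    intro γ hγ
    obtain ⟨p, q, hpq⟩ := exists_combination_of_factors htwo h₁ h₂ hi γ hγ
    refine ⟨p * r, q * s, ?_⟩
    have : γ - ((p * r) • wedge a b + (q * s) • wedge c d) =
        (γ - (p • wedge a₀ b₀ + q • wedge c₀ d₀)) + (p • (wedge a₀ b₀ - r • wedge a b) +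
          q • (wedge c₀ d₀ - s • wedge c d)) := by
      ext v w
      simp only [add_apply, sub_apply, smul_apply, smul_eq_mul]
      ring
    rw [this]
    exact Submodule.add_mem _ hpq (Submodule.add_mem _ (Submodule.smul_mem _ _ hr)
      (Submodule.smul_mem _ _ hs))
  obtain ⟨p, q, hpq⟩ := hex β (by
    rw [htwo]
    exact Submodule.mem_sup_left (Submodule.subset_span (by simp)))
  have hβe : ∀ v w, θ v = 0 → θ w = 0 →
      β v w = p * (a v * b w - b v * a w) + q * (c v * d w - d v * c w) := by
    intro v w hv hw
    have := apply_eq_zero_of_mem_wedgeIdeal hpq (v := v) (w := w) (by simpa using hv)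
      (by simpa using hw)
    simp only [add_apply, sub_apply, smul_apply, smul_eq_mul, wedge_apply] at this
    linarith
  have hind : LinearIndependent ℝ ![θ, a, b, c, d] := by
    refine linearIndependent_of_apply fun v hv => ?_
    have e0 : θ v = 0 := hv 0
    have e1 : a v = 0 := hv 1
    have e2 : b v = 0 := hv 2
    have e3 : c v = 0 := hv 3
    have e4 : d v = 0 := hv 4
    refine contact_nondegenerate hβ hc e0 fun w hw => ?_
    rw [hβe v w e0 hw, e1, e2, e3, e4]
    ring
  have hdv : ∀ i j, ![θ, a, b, c, d] i (dualVec ![θ, a, b, c, d] j) = if i = j then 1 else 0 :=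
    apply_dualVec hind
  refine ⟨hind, m₁, m₂, hex, p, q, ?_, ?_, hpq⟩
  · rintro rfl
    have e0 : θ (dualVec ![θ, a, b, c, d] 1) = 0 := by simpa using hdv 0 1
    have e1 : a (dualVec ![θ, a, b, c, d] 1) = 1 := by simpa using hdv 1 1
    have e3 : c (dualVec ![θ, a, b, c, d] 1) = 0 := by simpa using hdv 3 1
    have e4 : d (dualVec ![θ, a, b, c, d] 1) = 0 := by simpa using hdv 4 1
    have := contact_nondegenerate hβ hc e0 fun w hw => by
      rw [hβe _ w e0 hw, e3, e4]
      ring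
    rw [this, map_zero] at e1
    exact zero_ne_one e1
  · rintro rfl
    have e0 : θ (dualVec ![θ, a, b, c, d] 3) = 0 := by simpa using hdv 0 3
    have e1 : a (dualVec ![θ, a, b, c, d] 3) = 0 := by simpa using hdv 1 3
    have e2 : b (dualVec ![θ, a, b, c, d] 3) = 0 := by simpa using hdv 2 3
    have e3 : c (dualVec ![θ, a, b, c, d] 3) = 1 := by simpa using hdv 3 3
    have := contact_nondegenerate hβ hc e0 fun w hw => by
      rw [hβe _ w e0 hw, e1, e2]
      ring
    rw [this, map_zero] at e3
    exact zero_ne_one e3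

end Adapted

/-! ### Smooth adapted coframes near a point -/

section AdaptedCoframe

variable {M : Type*} [TopologicalSpace M] [ChartedSpace (E 5) M]

theorem IsGenerators.mono {one : M → Submodule ℝ (Cov 5)} {two : M → Submodule ℝ (Bil 5)}
    {U V : Set M} {θ : M → Cov 5} {Ψ : M → Bil 5} (h : IsGenerators one two U θ Ψ) (hV : V ⊆ U) :
    IsGenerators one two V θ Ψ where
  smooth_one x hx := h.smooth_one x (hV hx)
  smooth_two x hx := h.smooth_two x (hV hx)
  alternating x hx := h.alternating x (hV hx)
  contact x hx := h.contact x (hV hx)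
  indep x hx := h.indep x (hV hx)
  one_eq x hx := h.one_eq x (hV hx)
  two_eq x hx := h.two_eq x (hV hx)

/-- A smooth local coframe adapted to a Monge-Ampère system with characteristic systems `C, C'`,
normalised by `dθ ≡ a ∧ b + q c ∧ d mod θ`. -/
structure IsAdapted (I : MASystem M) (C C' : M → Submodule ℝ (Cov 5)) (U : Set M)
    (θ a b c d : M → Cov 5) : Prop where
  smooth : ∀ i, SmoothOneOn (![θ, a, b, c, d] i) U
  generators : ∃ Ψ, IsGenerators I.one I.two U θ Ψ
  fst_eq : ∀ x ∈ U, C x = Submodule.span ℝ {θ x, a x, b x}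
  snd_eq : ∀ x ∈ U, C' x = Submodule.span ℝ {θ x, c x, d x}
  split : ∀ x ∈ U, IsSplit (I.two x) (extD θ x) (θ x) (a x) (b x) (c x) (d x)
  normal : ∀ x ∈ U, ∃ q : ℝ, q ≠ 0 ∧
    extD θ x - (wedge (a x) (b x) + q • wedge (c x) (d x)) ∈ wedgeIdeal {θ x}

theorem value_five {X : Type*} (θ a b c d : X → Cov 5) (x : X) :
    (fun i => ![θ, a, b, c, d] i x) = ![θ x, a x, b x, c x, d x] := by
  funext i
  fin_cases i <;> rfl

variable [IsManifold (𝓡 5) ∞ M]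

theorem MASystem.IsCharacteristic.exists_isAdapted {I : MASystem M}
    {C C' : M → Submodule ℝ (Cov 5)} (h : I.IsCharacteristic C C') (x : M) :
    ∃ (U : Set M) (θ a b c d : M → Cov 5), IsOpen U ∧ x ∈ U ∧ IsAdapted I C C' U θ a b c d := by
  obtain ⟨U₀, hU₀, hx₀, θ, Ψ, hg⟩ := I.locally_generated x
  obtain ⟨U₁, hU₁, hx₁, α, hα, hαe⟩ := h.pfaffian_fst x
  obtain ⟨U₂, hU₂, hx₂, α', hα', hαe'⟩ := h.pfaffian_snd x
  have hθ0 : ∀ y ∈ U₀, θ y ≠ 0 := by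
    intro y hy h0
    refine hg.contact y hy ?_
    funext v
    rw [fiveForm_apply, h0]
    simp
  have hfac : ∀ y ∈ U₀, ∀ a b c d : Cov 5, C y = Submodule.span ℝ {θ y, a, b} →
      C' y = Submodule.span ℝ {θ y, c, d} → IsSplit (I.two y) (extD θ y) (θ y) a b c d := by
    intro y hy a b c d hab hcd
    obtain ⟨a₀, b₀, c₀, d₀, h1, h2, h3, h4, h5⟩ := h.factors y
    rw [hg.one_eq y hy] at h3 h4 h5
    rw [wedgeIdeal_span] at h3
    exact isSplit_of_factors (extD_apply_self θ y) (hg.contact y hy) (hg.two_eq y hy) h1 h2 h3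
      (h4.symm.trans hab) (h5.symm.trans hcd)
  have hθC : ∀ y ∈ U₀, θ y ∈ C y ∧ θ y ∈ C' y := by
    intro y hy
    obtain ⟨a₀, b₀, c₀, d₀, -, -, -, h4, h5⟩ := h.factors y
    rw [h4, h5, hg.one_eq y hy]
    exact ⟨Submodule.mem_sup_left (Submodule.mem_span_singleton_self _),
      Submodule.mem_sup_left (Submodule.mem_span_singleton_self _)⟩
  -- The exchange is made at `x` alone. The selected forms stay independent nearby, and a dimension
  -- count then shows that they still span `C` and `C'`.
  obtain ⟨i, j, hij⟩ := exists_span_triple (hθ0 x hx₀) ((hαe x hx₁).2 ▸ (hθC x hx₀).1)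
  obtain ⟨i', j', hij'⟩ := exists_span_triple (hθ0 x hx₀) ((hαe' x hx₂).2 ▸ (hθC x hx₀).2)
  have hind := (hfac x hx₀ _ _ _ _ ((hαe x hx₁).2.trans hij) ((hαe' x hx₂).2.trans hij')).indep
  have hsm : ∀ k, SmoothOneOn (![θ, α i, α j, α' i', α' j'] k) (U₀ ∩ U₁ ∩ U₂) := by
    intro k
    fin_cases k
    · exact SmoothOneOn.mono hg.smooth_one fun y hy => hy.1.1
    · exact SmoothOneOn.mono (hα i) fun y hy => hy.1.2
    · exact SmoothOneOn.mono (hα j) fun y hy => hy.1.2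
    · exact SmoothOneOn.mono (hα' i') fun y hy => hy.2
    · exact SmoothOneOn.mono (hα' j') fun y hy => hy.2
  obtain ⟨V, hVU, hV, hxV, hVi⟩ := exists_open_linearIndependent ((hU₀.inter hU₁).inter hU₂) hsm
    ⟨⟨hx₀, hx₁⟩, hx₂⟩ (by rw [value_five]; exact hind)
  have hsV := fun k => (hsm k).mono hVU
  simp only [value_five] at hVi
  have hCV : ∀ y ∈ V, C y = Submodule.span ℝ {θ y, α i y, α j y} := by
    intro y hy
    refine eq_span_triple (hαe y (hVU hy).1.2).2 ?_ (hθC y (hVU hy).1.1).1 ?_ ?_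
    · exact (hVi y hy).comp ![0, 1, 2] (by decide) |> fun h => by
        convert! h using 1
        funext k
        fin_cases k <;> rfl
    · rw [(hαe y (hVU hy).1.2).2]; exact Submodule.subset_span ⟨i, rfl⟩
    · rw [(hαe y (hVU hy).1.2).2]; exact Submodule.subset_span ⟨j, rfl⟩
  have hCV' : ∀ y ∈ V, C' y = Submodule.span ℝ {θ y, α' i' y, α' j' y} := by
    intro y hy
    refine eq_span_triple (hαe' y (hVU hy).2).2 ?_ (hθC y (hVU hy).1.1).2 ?_ ?_
    · exact (hVi y hy).comp ![0, 3, 4] (by decide) |> fun h => by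
        convert! h using 1
        funext k
        fin_cases k <;> rfl
    · rw [(hαe' y (hVU hy).2).2]; exact Submodule.subset_span ⟨i', rfl⟩
    · rw [(hαe' y (hVU hy).2).2]; exact Submodule.subset_span ⟨j', rfl⟩
  have hsplit := fun y hy => hfac y (hVU hy).1.1 _ _ _ _ (hCV y hy) (hCV' y hy)
  -- The coefficient of `α i ∧ α j` in `dθ`, written as a component in the dual frame so that it is
  -- visibly smooth. Absorbing it into `α i` normalises that coefficient to one.
  obtain ⟨f, hf⟩ : ∃ f : M → ℝ, f = fun y => extD θ y
      (dualVec (fun k => ![θ, α i, α j, α' i', α' j'] k y) 1)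
      (dualVec (fun k => ![θ, α i, α j, α' i', α' j'] k y) 2) := ⟨_, rfl⟩
  have hfs : SmoothFunOn (n := 5) f V := by
    rw [hf]
    exact smoothFunOn_dualVec hV hsV (by simpa only [value_five] using hVi)
      (smoothOneOn_extD_dualVec hV hsV (by simpa only [value_five] using hVi) (hsV 0) 1) 2
  have hfe : ∀ y ∈ V, f y ≠ 0 ∧ ∃ q : ℝ, q ≠ 0 ∧ extD θ y - (f y • wedge (α i y) (α j y) +
      q • wedge (α' i' y) (α' j' y)) ∈ wedgeIdeal {θ y} := by
    intro y hy
    obtain ⟨p, q, hp, hq, hpq⟩ := (hsplit y hy).exists_contact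
    have hd := apply_dualVec (hVi y hy)
    have e := apply_eq_zero_of_mem_wedgeIdeal hpq
      (v := dualVec ![θ y, α i y, α j y, α' i' y, α' j' y] 1)
      (w := dualVec ![θ y, α i y, α j y, α' i' y, α' j' y] 2)
      (by simpa using hd 0 1) (by simpa using hd 0 2)
    have d11 := hd 1 1
    have d12 := hd 1 2
    have d21 := hd 2 1
    have d22 := hd 2 2
    have d31 := hd 3 1
    have d41 := hd 4 1
    simp at d11 d12 d21 d22 d31 d41
    simp only [add_apply, sub_apply, smul_apply, smul_eq_mul, wedge_apply, d11, d12, d21, d22,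
      d31, d41] at e
    have hfp : f y = p := by
      rw [hf]
      simp only [value_five]
      linarith
    rw [hfp]
    exact ⟨hp, q, hq, hpq⟩
  have hspan : ∀ y ∈ V, Submodule.span ℝ {θ y, α i y, α j y} =
      Submodule.span ℝ {θ y, f y • α i y, α j y} := by
    intro y hy
    refine le_antisymm (Submodule.span_le.2 ?_) (Submodule.span_le.2 ?_)
    · rintro z (rfl | rfl | rfl)
      · exact Submodule.subset_span (by simp)
      · exact Submodule.mem_span_triple.2 ⟨0, (f y)⁻¹, 0, by simp [(hfe y hy).1]⟩
      · exact Submodule.subset_span (by simp)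
    · rintro z (rfl | rfl | rfl)
      · exact Submodule.subset_span (by simp)
      · exact Submodule.smul_mem _ _ (Submodule.subset_span (by simp))
      · exact Submodule.subset_span (by simp)
  have hCf : ∀ y ∈ V, C y = Submodule.span ℝ {θ y, f y • α i y, α j y} := fun y hy =>
    (hCV y hy).trans (hspan y hy)
  refine ⟨V, θ, fun y => f y • α i y, α j, α' i', α' j', hV, hxV, ?_,
    ⟨Ψ, hg.mono fun y hy => (hVU hy).1.1⟩, hCf, hCV', fun y hy =>
      hfac y (hVU hy).1.1 _ _ _ _ (hCf y hy) (hCV' y hy), fun y hy => ?_⟩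
  · intro k
    fin_cases k
    · exact hsV 0
    · exact SmoothOneOn.smul hfs (hsV 1)
    · exact hsV 2
    · exact hsV 3
    · exact hsV 4
  · obtain ⟨-, q, hq, h1⟩ := hfe y hy
    rw [wedge_smul_left]
    exact ⟨q, hq, h1⟩

end AdaptedCoframe

end Backlund

namespace Backlund

open Filter Topology

/-! ### Linear algebra of Bäcklund transformations at a point -/

section Pointwise

theorem mem_span_triple_of_ker {n : ℕ} {a b c x : Cov n}
    (h : ∀ v, a v = 0 → b v = 0 → c v = 0 → x v = 0) : x ∈ Submodule.span ℝ {a, b, c} := by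
  have h1 := mem_span_of_iInf_ker_le_ker (𝕜 := ℝ)
    (L := fun i : Fin 3 => (![a, b, c] i : E n →ₗ[ℝ] ℝ)) (K := (x : E n →ₗ[ℝ] ℝ)) (by
      intro v hv
      simp only [Submodule.mem_iInf, LinearMap.mem_ker] at hv ⊢
      exact h v (hv 0) (hv 1) (hv 2))
  obtain ⟨g, hg⟩ := (Submodule.mem_span_range_iff_exists_fun ℝ).1 h1
  refine Submodule.mem_span_triple.2 ⟨g 0, g 1, g 2, ?_⟩
  ext v
  have := congrArg (fun T : E n →ₗ[ℝ] ℝ => T v) hg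
  simpa [Fin.sum_univ_three] using this

theorem pullBil_mem_wedgeIdeal {m n : ℕ} (T : E m →L[ℝ] E n) {S : Set (Cov n)} {β : Bil n}
    (hβ : β ∈ wedgeIdeal S) : pullBil T β ∈ wedgeIdeal (pullCov T '' S) := by
  induction hβ using Submodule.span_induction with
  | mem x hx =>
    obtain ⟨a, ha, c, rfl⟩ := hx
    rw [pullBil_wedge]
    exact wedge_mem_wedgeIdeal (Set.mem_image_of_mem _ ha) _
  | zero => rw [map_zero]; exact Submodule.zero_mem _
  | add x y _ _ hx hy => rw [map_add]; exact Submodule.add_mem _ hx hy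
  | smul r x _ hx => rw [map_smul]; exact Submodule.smul_mem _ _ hx

/-- If `a ∧ b` is annihilated modulo `S` by a vector of `ker S` on which `a, b` do not both
vanish, then `a ∧ b ≡ 0 mod S`. -/
theorem wedge_mem_wedgeIdeal_of_contraction {n : ℕ} {x y z a b : Cov n} {v : E n}
    (hv : a v ≠ 0 ∨ b v ≠ 0)
    (h : ∀ w, x w = 0 → y w = 0 → z w = 0 → wedge a b v w = 0) :
    wedge a b ∈ wedgeIdeal {x, y, z} := by
  have hs : a v • b - b v • a ∈ Submodule.span ℝ {x, y, z} :=
    mem_span_triple_of_ker fun w h1 h2 h3 => by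
      have := h w h1 h2 h3
      simp only [wedge_apply] at this
      simp only [sub_apply, smul_apply, smul_eq_mul]
      linarith
  rw [← wedgeIdeal_span]
  rcases hv with h0 | h0
  · have e : wedge a b = (a v)⁻¹ • wedge a (a v • b - b v • a) := by
      ext u w
      simp only [smul_apply, wedge_apply, sub_apply, smul_eq_mul]
      field_simp
      ring
    rw [e]
    exact Submodule.smul_mem _ _ (wedge_mem_wedgeIdeal' hs a)
  · have e : wedge a b = (b v)⁻¹ • wedge b (a v • b - b v • a) := by
      ext u w
      simp only [smul_apply, wedge_apply, sub_apply, smul_eq_mul]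
      field_simp
      ring
    rw [e]
    exact Submodule.smul_mem _ _ (wedge_mem_wedgeIdeal' hs b)

/-- The kernel of the differential of the second projection is transverse to the first contact
distribution. -/
theorem eq_zero_of_map_eq_zero {T₁ T₂ : E 7 →L[ℝ] E 5} {ℓ : Cov 7}
    {two₁ two₂ : Submodule ℝ (Bil 5)} {β₁ β₂ : Bil 5} {θ₁ a b c d θ₂ : Cov 5}
    (h₁ : IsSplit two₁ β₁ θ₁ a b c d) (h₂ : β₂ ∈ two₂)
    (same : two₁.map (pullBil T₁) ⊔ wedgeIdeal {pullCov T₁ θ₁, pullCov T₂ θ₂, ℓ} =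
      two₂.map (pullBil T₂) ⊔ wedgeIdeal {pullCov T₁ θ₁, pullCov T₂ θ₂, ℓ})
    (indep : ∀ s t : ℝ, s • pullBil T₁ β₁ + t • pullBil T₂ β₂ ∈
      wedgeIdeal {pullCov T₁ θ₁, pullCov T₂ θ₂, ℓ} → s = 0 ∧ t = 0)
    (imm : ∀ v, T₁ v = 0 → T₂ v = 0 → ℓ v = 0 → v = 0)
    {n : E 7} (hn : T₂ n = 0) (hℓ : ℓ n = 0) (hθ : θ₁ (T₁ n) = 0) : n = 0 := by
  set K : Set (Cov 7) := {pullCov T₁ θ₁, pullCov T₂ θ₂, ℓ} with hK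
  have hnK : ∀ x ∈ K, x n = 0 := by
    rintro x (rfl | rfl | rfl)
    · exact hθ
    · rw [pullCov_apply, hn, map_zero]
    · exact hℓ
  -- Modulo `K` every form of the first system is pulled back from the second manifold, where `n`
  -- projects to zero.
  have van : ∀ γ ∈ two₁, ∀ w, (∀ x ∈ K, x w = 0) → γ (T₁ n) (T₁ w) = 0 := by
    intro γ hγ w hw
    have h3 : pullBil T₁ γ ∈ two₂.map (pullBil T₂) ⊔ wedgeIdeal K := by
      rw [← same]
      exact Submodule.mem_sup_left (Submodule.mem_map_of_mem hγ)
    obtain ⟨y, hy, χ, hχ, hyχ⟩ := Submodule.mem_sup.1 h3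
    obtain ⟨γ', -, rfl⟩ := (Submodule.mem_map).1 hy
    have h4 := congrArg (fun B : Bil 7 => B n w) hyχ
    simp only [add_apply, pullBil_apply, hn, map_zero, zero_apply,
      apply_eq_zero_of_mem_wedgeIdeal hχ hnK hw] at h4
    simpa using h4.symm
  have hθK : wedgeIdeal (pullCov T₁ '' {θ₁}) ≤ wedgeIdeal K := by
    rw [Set.image_singleton]
    exact wedgeIdeal_mono (by simp [hK])
  obtain ⟨p₁, q₁, hp₁, hq₁, e₁⟩ := h₁.exists_contact
  have e₁' := hθK (pullBil_mem_wedgeIdeal T₁ e₁)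
  obtain ⟨p, q, e₂⟩ : ∃ p q : ℝ, pullBil T₂ β₂ -
      (p • pullBil T₁ (wedge a b) + q • pullBil T₁ (wedge c d)) ∈ wedgeIdeal K := by
    have h3 : pullBil T₂ β₂ ∈ two₁.map (pullBil T₁) ⊔ wedgeIdeal K := by
      rw [same]
      exact Submodule.mem_sup_left (Submodule.mem_map_of_mem h₂)
    obtain ⟨y, hy, χ, hχ, hyχ⟩ := Submodule.mem_sup.1 h3
    obtain ⟨γ, hγ, rfl⟩ := (Submodule.mem_map).1 hy
    obtain ⟨p, q, hpq⟩ := h₁.exists_sub_mem γ hγ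
    refine ⟨p, q, ?_⟩
    have := Submodule.add_mem _ (hθK (pullBil_mem_wedgeIdeal T₁ hpq)) hχ
    convert! this using 1
    rw [← hyχ]
    ext v w
    simp only [add_apply, sub_apply, smul_apply, pullBil_apply]
    ring
  -- The two contact differentials cannot both be multiples of one form modulo `K`.
  have contra : ∀ {r₁ r₂ : ℝ}, r₁ ≠ 0 → (∃ φ : Bil 7, pullBil T₁ β₁ - r₁ • φ ∈ wedgeIdeal K ∧
      pullBil T₂ β₂ - r₂ • φ ∈ wedgeIdeal K) → False := by
    rintro r₁ r₂ hr ⟨φ, k₁, k₂⟩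
    have k₃ := Submodule.add_mem _ (Submodule.smul_mem _ r₂ k₁) (Submodule.smul_mem _ (-r₁) k₂)
    have e : r₂ • (pullBil T₁ β₁ - r₁ • φ) + (-r₁) • (pullBil T₂ β₂ - r₂ • φ) =
        r₂ • pullBil T₁ β₁ + (-r₁) • pullBil T₂ β₂ := by
      ext v w
      simp only [add_apply, sub_apply, smul_apply, smul_eq_mul]
      ring
    rw [e] at k₃
    exact hr (neg_eq_zero.1 (indep _ _ k₃).2)
  by_contra hn0
  have hT : T₁ n ≠ 0 := fun h => hn0 (imm n h hn hℓ)
  have mem : ∀ {a b : Cov 5}, wedge a b ∈ two₁ → (a (T₁ n) ≠ 0 ∨ b (T₁ n) ≠ 0) →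
      pullBil T₁ (wedge a b) ∈ wedgeIdeal K := by
    intro a b hab h0
    rw [pullBil_wedge]
    refine wedge_mem_wedgeIdeal_of_contraction (v := n) h0 fun w h3 h4 h5 => ?_
    rw [← pullBil_wedge]
    refine van _ hab w ?_
    rintro x (rfl | rfl | rfl) <;> assumption
  -- If `a` or `b` is nonzero on `T₁ n`, then `a ∧ b ≡ 0 mod K` and both differentials are multiples
  -- of `c ∧ d`. The case of `c, d` is symmetric. So the whole coframe kills `T₁ n`, and the
  -- immersion property gives `n = 0`.
  by_cases hab : a (T₁ n) ≠ 0 ∨ b (T₁ n) ≠ 0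
  · have m := mem h₁.fst_mem hab
    refine contra (r₂ := q) hq₁ ⟨pullBil T₁ (wedge c d), ?_, ?_⟩
    · convert! Submodule.add_mem _ e₁' (Submodule.smul_mem _ p₁ m) using 1
      ext v w
      simp only [add_apply, sub_apply, smul_apply, pullBil_apply, smul_eq_mul]
      ring
    · convert! Submodule.add_mem _ e₂ (Submodule.smul_mem _ p m) using 1
      ext v w
      simp only [add_apply, sub_apply, smul_apply, pullBil_apply, smul_eq_mul]
      ring
  by_cases hcd : c (T₁ n) ≠ 0 ∨ d (T₁ n) ≠ 0
  · have m := mem h₁.snd_mem hcd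
    refine contra (r₂ := p) hp₁ ⟨pullBil T₁ (wedge a b), ?_, ?_⟩
    · convert! Submodule.add_mem _ e₁' (Submodule.smul_mem _ q₁ m) using 1
      ext v w
      simp only [add_apply, sub_apply, smul_apply, pullBil_apply, smul_eq_mul]
      ring
    · convert! Submodule.add_mem _ e₂ (Submodule.smul_mem _ q m) using 1
      ext v w
      simp only [add_apply, sub_apply, smul_apply, pullBil_apply, smul_eq_mul]
      ring
  push Not at hab hcd
  refine hT (eq_zero_of_coframe h₁.indep fun i => ?_)
  fin_cases i
  · exact hθ
  · exact hab.1
  · exact hab.2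
  · exact hcd.1
  · exact hcd.2

theorem apply_eq_zero_of_sup_eq {n : ℕ} {S S' K : Submodule ℝ (Cov n)} (h : S ⊔ K = S' ⊔ K)
    {v : E n} (hK : ∀ x ∈ K, x v = 0) (hS : ∀ x ∈ S, x v = 0) : ∀ x ∈ S', x v = 0 := by
  intro x hx
  have : x ∈ S ⊔ K := h ▸ Submodule.mem_sup_left hx
  obtain ⟨y, hy, z, hz, rfl⟩ := Submodule.mem_sup.1 this
  simp [hS y hy, hK z hz]

theorem apply_eq_zero_of_mem_span {n : ℕ} {S : Set (Cov n)} {v : E n} (h : ∀ x ∈ S, x v = 0)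
    {x : Cov n} (hx : x ∈ Submodule.span ℝ S) : x v = 0 := by
  induction hx using Submodule.span_induction with
  | mem x hx => exact h x hx
  | zero => rfl
  | add x y _ _ hx hy => simp [hx, hy]
  | smul r x _ hx => simp [hx]

theorem apply_eq_zero_of_mem_span_triple {n : ℕ} {a b c x : Cov n} {v : E n} (ha : a v = 0)
    (hb : b v = 0) (hc : c v = 0) (hx : x ∈ Submodule.span ℝ {a, b, c}) : x v = 0 := by
  refine apply_eq_zero_of_mem_span ?_ hx
  rintro y (rfl | rfl | rfl) <;> assumption

/-- Alternating forms on the common kernel of the fourth and fifth member of a coframe. -/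
theorem apply_eq_of_coframe {e : Fin 7 → Cov 7} (he : LinearIndependent ℝ e) {β : Bil 7}
    (hβ : ∀ v, β v v = 0) (h02 : β (dualVec e 0) (dualVec e 2) = 0)
    (h05 : β (dualVec e 0) (dualVec e 5) = 0) (h06 : β (dualVec e 0) (dualVec e 6) = 0)
    (h15 : β (dualVec e 1) (dualVec e 5) = 0) (h16 : β (dualVec e 1) (dualVec e 6) = 0)
    (h25 : β (dualVec e 2) (dualVec e 5) = 0) (h26 : β (dualVec e 2) (dualVec e 6) = 0)
    {v w : E 7} (h3 : e 3 v = 0) (h4 : e 4 v = 0) (h3' : e 3 w = 0) (h4' : e 4 w = 0) :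
    β v w = β (dualVec e 1) (dualVec e 2) * wedge (e 1) (e 2) v w +
      β (dualVec e 5) (dualVec e 6) * wedge (e 5) (e 6) v w +
      β (dualVec e 0) (dualVec e 1) * wedge (e 0) (e 1) v w := by
  have sw := swap_of_apply_self hβ
  have ev := eq_sum_dualVec he v
  have ew := eq_sum_dualVec he w
  have e1 : β v w = β (∑ j, e j v • dualVec e j) (∑ j, e j w • dualVec e j) := by
    rw [← ev, ← ew]
  rw [e1]
  simp only [Fin.sum_univ_seven, h3, h4, h3', h4', zero_smul, add_zero, map_add, map_smul,
    add_apply, smul_apply, smul_eq_mul, hβ, h02, h05, h06, h15, h16, h25, h26, wedge_apply,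
    sw (dualVec e 2) (dualVec e 0), sw (dualVec e 5) (dualVec e 0), sw (dualVec e 6) (dualVec e 0),
    sw (dualVec e 5) (dualVec e 1), sw (dualVec e 6) (dualVec e 1), sw (dualVec e 5) (dualVec e 2),
    sw (dualVec e 6) (dualVec e 2), sw (dualVec e 2) (dualVec e 1), sw (dualVec e 1) (dualVec e 0),
    sw (dualVec e 6) (dualVec e 5)]
  ring

/-- A two-form `r e₁ ∧ e₂ + e₅ ∧ e₆ + s e₀ ∧ e₁` with `(r, s) ≠ 0` has rank four: it annihilates no
covector of the common kernel of `e₃` and `e₄`. -/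
theorem eq_zero_of_cyclic {e : Fin 7 → Cov 7} (he : LinearIndependent ℝ e) {r s : ℝ}
    (hrs : r ≠ 0 ∨ s ≠ 0) {Ξ : Bil 7}
    (hΞ : Ξ = r • wedge (e 1) (e 2) + wedge (e 5) (e 6) + s • wedge (e 0) (e 1)) {γ : Cov 7}
    (h : ∀ u v w, e 3 u = 0 → e 4 u = 0 → e 3 v = 0 → e 4 v = 0 → e 3 w = 0 → e 4 w = 0 →
      Ξ u v * γ w + Ξ v w * γ u + Ξ w u * γ v = 0) {w : E 7} (h3 : e 3 w = 0) (h4 : e 4 w = 0) :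
    γ w = 0 := by
  have hd := apply_dualVec he
  have hc : ∀ i j k : Fin 7, i ≠ 3 → i ≠ 4 → j ≠ 3 → j ≠ 4 → k ≠ 3 → k ≠ 4 →
      Ξ (dualVec e i) (dualVec e j) * γ (dualVec e k) +
      Ξ (dualVec e j) (dualVec e k) * γ (dualVec e i) +
      Ξ (dualVec e k) (dualVec e i) * γ (dualVec e j) = 0 := fun i j k h1 h2 h3 h4 h5 h6 =>
    h _ _ _ (by simp [hd, h1.symm]) (by simp [hd, h2.symm]) (by simp [hd, h3.symm])
      (by simp [hd, h4.symm]) (by simp [hd, h5.symm]) (by simp [hd, h6.symm])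
  -- As `Ξ` has component one in position `(5, 6)`, the triples `(5, 6, k)` isolate `γ` on the
  -- vectors 0, 1, 2. Then `(1, 2, k)` or `(0, 1, k)`, with weight `r` or `s`, isolates it on 5 and
  -- 6.
  have g0 : γ (dualVec e 0) = 0 := by
    simpa [hΞ, hd] using hc 5 6 0 (by decide) (by decide) (by decide) (by decide) (by decide)
      (by decide)
  have g1 : γ (dualVec e 1) = 0 := by
    simpa [hΞ, hd] using hc 5 6 1 (by decide) (by decide) (by decide) (by decide) (by decide)
      (by decide)
  have g2 : γ (dualVec e 2) = 0 := by
    simpa [hΞ, hd] using hc 5 6 2 (by decide) (by decide) (by decide) (by decide) (by decide)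
      (by decide)
  have g5 : γ (dualVec e 5) = 0 := by
    rcases hrs with h0 | h0
    · simpa [hΞ, hd, h0] using hc 1 2 5 (by decide) (by decide) (by decide) (by decide) (by decide)
        (by decide)
    · simpa [hΞ, hd, h0] using hc 0 1 5 (by decide) (by decide) (by decide) (by decide) (by decide)
        (by decide)
  have g6 : γ (dualVec e 6) = 0 := by
    rcases hrs with h0 | h0
    · simpa [hΞ, hd, h0] using hc 1 2 6 (by decide) (by decide) (by decide) (by decide) (by decide)
        (by decide)
    · simpa [hΞ, hd, h0] using hc 0 1 6 (by decide) (by decide) (by decide) (by decide) (by decide)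
        (by decide)
  rw [eq_sum_dualVec he w]
  simp [Fin.sum_univ_seven, h3, h4, g0, g1, g2, g5, g6]

end Pointwise

end Backlund

namespace Backlund

open Filter Topology

/-! ### Local sections of the canonical `G`-structure -/

section Combination

variable {n : ℕ} {M : Type*} [TopologicalSpace M] [ChartedSpace (E n) M]
  [IsManifold (𝓡 n) ∞ M] {U : Set M}

/-- The derivatives of the coefficients enter only through `dz ∧ y` and `dw ∧ ζ`, which vanish on
`ker y ∩ ker ζ`. -/
theorem exists_sub_smul_sub_smul {x y ζ : M → Cov n} {z w : M → ℝ} (hx : SmoothOneOn x U)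
    (hy : SmoothOneOn y U) (hζ : SmoothOneOn ζ U) (hz : SmoothFunOn (n := n) z U)
    (hw : SmoothFunOn (n := n) w U) :
    ∃ χ : M → Cov n, SmoothOneOn χ U ∧ (∀ q, χ q = x q - z q • y q - w q • ζ q) ∧
      ∀ q ∈ U, ∀ u v, y q u = 0 → y q v = 0 → ζ q u = 0 → ζ q v = 0 →
        extD χ q u v = extD x q u v - z q * extD y q u v - w q * extD ζ q u v := by
  have s1 := SmoothOneOn.smul hz.neg hy
  have s2 := SmoothOneOn.smul hw.neg hζ
  refine ⟨fun q => (x q + -z q • y q) + -w q • ζ q, (hx.add s1).add s2, fun q => ?_, ?_⟩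
  · ext v
    simp only [add_apply, sub_apply, smul_apply, smul_eq_mul]
    ring
  · intro q hq u v h1 h2 h3 h4
    obtain ⟨a, ha⟩ := exists_extD_smul hq hz.neg (hy q hq)
    obtain ⟨b, hb⟩ := exists_extD_smul hq hw.neg (hζ q hq)
    rw [extD_add ((hx.add s1) q hq) (s2 q hq), extD_add (hx q hq) (s1 q hq), ha, hb]
    simp [h1, h2, h3, h4]
    ring

theorem extD_apply_of_eq_sum {ι : Type*} [Fintype ι] (hU : IsOpen U) {α : M → Cov n}
    {f : ι → M → ℝ} {β : ι → M → Cov n} (hf : ∀ i, SmoothFunOn (n := n) (f i) U)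
    (hβ : ∀ i, SmoothOneOn (β i) U) (h : ∀ q ∈ U, α q = ∑ i, f i q • β i q) {q : M} (hq : q ∈ U)
    {u v : E n} (hu : ∀ i, β i q u = 0) (hv : ∀ i, β i q v = 0) :
    extD α q u v = ∑ i, f i q * extD (β i) q u v := by
  have e : α =ᶠ[𝓝 q] fun q => ∑ i, f i q • β i q := by
    filter_upwards [hU.mem_nhds hq] with y hy using h y hy
  rw [extD_congr e, extD_sum_apply Finset.univ (fun i _ => hf i) (fun i _ => hβ i) hq
    (fun i _ => hu i) fun i _ => hv i]

end Combination

/-! ### Adapted coframes pulled back to `P` -/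

namespace Data

variable {M₁ M₂ P : Type*}
  [TopologicalSpace M₁] [ChartedSpace (E 5) M₁]
  [TopologicalSpace M₂] [ChartedSpace (E 5) M₂]
  [TopologicalSpace P] [ChartedSpace (E 7) P]

/-- Smooth one-forms on `P`, pulled back from adapted coframes of the two Monge-Ampère systems. -/
structure IsLift (𝓓 : Data M₁ M₂ P) (U : Set P) (θ₁ a b c d θ₂ a' b' c' d' : P → Cov 7) :
    Prop where
  smooth₁ : ∀ i, SmoothOneOn (![θ₁, a, b, c, d] i) U
  smooth₂ : ∀ i, SmoothOneOn (![θ₂, a', b', c', d'] i) U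
  θ₁_mem : ∀ q ∈ U, θ₁ q ∈ 𝓓.pull₁ 𝓓.I₁.one q
  θ₂_mem : ∀ q ∈ U, θ₂ q ∈ 𝓓.pull₂ 𝓓.I₂.one q
  C₁₁_eq : ∀ q ∈ U, 𝓓.pull₁ 𝓓.C₁₁ q = Submodule.span ℝ {θ₁ q, a q, b q}
  C₁₂_eq : ∀ q ∈ U, 𝓓.pull₁ 𝓓.C₁₂ q = Submodule.span ℝ {θ₁ q, c q, d q}
  C₂₁_eq : ∀ q ∈ U, 𝓓.pull₂ 𝓓.C₂₁ q = Submodule.span ℝ {θ₂ q, a' q, b' q}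
  C₂₂_eq : ∀ q ∈ U, 𝓓.pull₂ 𝓓.C₂₂ q = Submodule.span ℝ {θ₂ q, c' q, d' q}
  dθ₁_eq : ∀ q ∈ U, ∃ r : ℝ,
    extD θ₁ q - (wedge (c q) (d q) + r • wedge (a q) (b q)) ∈ wedgeIdeal {θ₁ q}
  dθ₂_eq : ∀ q ∈ U, ∃ r : ℝ,
    extD θ₂ q - (wedge (a' q) (b' q) + r • wedge (c' q) (d' q)) ∈ wedgeIdeal {θ₂ q}
  ker₁ : ∀ q ∈ U, ∀ v, (∀ i, ![θ₁ q, a q, b q, c q, d q] i v = 0) → 𝓓.dπ₁ q v = 0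
  ker₂ : ∀ q ∈ U, ∀ v, (∀ i, ![θ₂ q, a' q, b' q, c' q, d' q] i v = 0) → 𝓓.dπ₂ q v = 0
  ker : ∀ q ∈ U, ∀ v, 𝓓.dπ₂ q v = 0 → 𝓓.dlam q v = 0 → θ₁ q v = 0 → v = 0
  ext₁ : ∀ q ∈ U, ∀ i, ∀ u v, 𝓓.dπ₁ q u = 0 → extD (![θ₁, a, b, c, d] i) q u v = 0
  ext₂ : ∀ q ∈ U, ∀ i, ∀ u v, 𝓓.dπ₂ q u = 0 → extD (![θ₂, a', b', c', d'] i) q u v = 0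
  K_eq : ∀ q ∈ U, 𝓓.K q = Submodule.span ℝ {θ₁ q, θ₂ q, 𝓓.dlam q}

theorem map_span_triple {m n : ℕ} (T : E m →L[ℝ] E n) (a b c : Cov n) :
    (Submodule.span ℝ {a, b, c}).map (pullCov T) =
      Submodule.span ℝ {pullCov T a, pullCov T b, pullCov T c} := by
  rw [Submodule.map_span]
  simp [Set.image_insert_eq]

theorem pullBil_sub_mem {m n : ℕ} (T : E m →L[ℝ] E n) {β : Bil n} {θ a b c d : Cov n} {r : ℝ}
    (h : β - (wedge a b + r • wedge c d) ∈ wedgeIdeal {θ}) :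
    pullBil T β - (wedge (pullCov T a) (pullCov T b) + r • wedge (pullCov T c) (pullCov T d)) ∈
      wedgeIdeal {pullCov T θ} := by
  have := pullBil_mem_wedgeIdeal T h
  rw [Set.image_singleton] at this
  convert! this using 1

theorem apply_five_eq_zero {m n : ℕ} {T : E m →L[ℝ] E n} {a b c d e : Cov n} {v : E m}
    (h : ∀ i, ![pullCov T a, pullCov T b, pullCov T c, pullCov T d, pullCov T e] i v = 0) :
    ∀ i, ![a, b, c, d, e] i (T v) = 0 := by
  intro i
  have := h i
  fin_cases i <;> exact this

theorem _root_.Backlund.MASystem.IsCharacteristic.symm {M : Type*} [TopologicalSpace M]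
    [ChartedSpace (E 5) M] {I : MASystem M} {C C' : M → Submodule ℝ (Cov 5)}
    (h : I.IsCharacteristic C C') : I.IsCharacteristic C' C where
  pfaffian_fst := h.pfaffian_snd
  pfaffian_snd := h.pfaffian_fst
  factors x := by
    obtain ⟨a, b, c, d, h1, h2, h3, h4, h5⟩ := h.factors x
    refine ⟨c, d, a, b, h2, h1, fun s t hst => (h3 t s ?_).symm, h5, h4⟩
    have e : t • wedge a b + s • wedge c d = s • wedge c d + t • wedge a b := by
      ext v w
      simp only [add_apply]
      ring
    rwa [e]

variable [IsManifold (𝓡 5) ∞ M₁] [IsManifold (𝓡 5) ∞ M₂] [IsManifold (𝓡 7) ∞ P]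

theorem IsParametricBacklund.exists_isLift {𝓓 : Data M₁ M₂ P} (h : 𝓓.IsParametricBacklund)
    (p : P) : ∃ (U : Set P) (θ₁ a b c d θ₂ a' b' c' d' : P → Cov 7), IsOpen U ∧ p ∈ U ∧
      𝓓.IsLift U θ₁ a b c d θ₂ a' b' c' d' := by
  -- Adapted coframes have coefficient one on their first pair. For `dθ₁` this has to be the pair of
  -- `𝒞₁₂`, for `dθ₂` the pair of `𝒞₂₁`; hence the interchange on `M₁` only.
  obtain ⟨U₁, θ₁, c, d, a, b, hU₁, hp₁, h₁⟩ := h.characteristic₁.symm.exists_isAdapted (𝓓.π₁ p)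
  obtain ⟨U₂, θ₂, a', b', c', d', hU₂, hp₂, h₂⟩ := h.characteristic₂.exists_isAdapted (𝓓.π₂ p)
  obtain ⟨Ψ₁, g₁⟩ := h₁.generators
  obtain ⟨Ψ₂, g₂⟩ := h₂.generators
  have s₁ : ∀ i, ∀ x ∈ U₁, SmoothOneAt (![θ₁, a, b, c, d] i) x := by
    intro i
    fin_cases i
    · exact h₁.smooth 0
    · exact h₁.smooth 3
    · exact h₁.smooth 4
    · exact h₁.smooth 1
    · exact h₁.smooth 2
  have s₂ : ∀ i, ∀ x ∈ U₂, SmoothOneAt (![θ₂, a', b', c', d'] i) x := fun i => h₂.smooth i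
  have e₁ : ∀ i, ![pullForm 7 5 𝓓.π₁ θ₁, pullForm 7 5 𝓓.π₁ a, pullForm 7 5 𝓓.π₁ b,
      pullForm 7 5 𝓓.π₁ c, pullForm 7 5 𝓓.π₁ d] i = pullForm 7 5 𝓓.π₁ (![θ₁, a, b, c, d] i) := by
    intro i
    fin_cases i <;> rfl
  have e₂ : ∀ i, ![pullForm 7 5 𝓓.π₂ θ₂, pullForm 7 5 𝓓.π₂ a', pullForm 7 5 𝓓.π₂ b',
      pullForm 7 5 𝓓.π₂ c', pullForm 7 5 𝓓.π₂ d'] i =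
        pullForm 7 5 𝓓.π₂ (![θ₂, a', b', c', d'] i) := by
    intro i
    fin_cases i <;> rfl
  have hK : ∀ q ∈ 𝓓.π₁ ⁻¹' U₁ ∩ 𝓓.π₂ ⁻¹' U₂, 𝓓.K q =
      Submodule.span ℝ {pullCov (𝓓.dπ₁ q) (θ₁ (𝓓.π₁ q)), pullCov (𝓓.dπ₂ q) (θ₂ (𝓓.π₂ q)),
        𝓓.dlam q} := by
    intro q hq
    rw [K, pull₁, pull₂, g₁.one_eq _ hq.1, g₂.one_eq _ hq.2, Submodule.map_span,
      Submodule.map_span, Set.image_singleton, Set.image_singleton, ← Submodule.span_union,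
      ← Submodule.span_union, Set.union_assoc]
    rfl
  refine ⟨𝓓.π₁ ⁻¹' U₁ ∩ 𝓓.π₂ ⁻¹' U₂, pullForm 7 5 𝓓.π₁ θ₁, pullForm 7 5 𝓓.π₁ a,
    pullForm 7 5 𝓓.π₁ b, pullForm 7 5 𝓓.π₁ c, pullForm 7 5 𝓓.π₁ d, pullForm 7 5 𝓓.π₂ θ₂,
    pullForm 7 5 𝓓.π₂ a', pullForm 7 5 𝓓.π₂ b', pullForm 7 5 𝓓.π₂ c', pullForm 7 5 𝓓.π₂ d',
    (hU₁.preimage h.smooth_π₁.continuous).inter (hU₂.preimage h.smooth_π₂.continuous),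
    ⟨hp₁, hp₂⟩, ?_⟩
  constructor
  · intro i q hq
    rw [e₁]
    exact (s₁ i _ hq.1).pullForm (h.smooth_π₁ q)
  · intro i q hq
    rw [e₂]
    exact (s₂ i _ hq.2).pullForm (h.smooth_π₂ q)
  · intro q hq
    refine Submodule.mem_map_of_mem (f := pullCov (𝓓.dπ₁ q)) ?_
    rw [g₁.one_eq _ hq.1]
    exact Submodule.mem_span_singleton_self _
  · intro q hq
    refine Submodule.mem_map_of_mem (f := pullCov (𝓓.dπ₂ q)) ?_
    rw [g₂.one_eq _ hq.2]
    exact Submodule.mem_span_singleton_self _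
  · intro q hq
    rw [pull₁, h₁.snd_eq _ hq.1, map_span_triple]
    rfl
  · intro q hq
    rw [pull₁, h₁.fst_eq _ hq.1, map_span_triple]
    rfl
  · intro q hq
    rw [pull₂, h₂.fst_eq _ hq.2, map_span_triple]
    rfl
  · intro q hq
    rw [pull₂, h₂.snd_eq _ hq.2, map_span_triple]
    rfl
  · intro q hq
    obtain ⟨r, -, hr⟩ := h₁.normal _ hq.1
    refine ⟨r, ?_⟩
    rw [extD_pullForm (show SmoothOneAt θ₁ _ from s₁ 0 _ hq.1) (h.smooth_π₁ q)]
    exact pullBil_sub_mem _ hr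
  · intro q hq
    obtain ⟨r, -, hr⟩ := h₂.normal _ hq.2
    refine ⟨r, ?_⟩
    rw [extD_pullForm (show SmoothOneAt θ₂ _ from s₂ 0 _ hq.2) (h.smooth_π₂ q)]
    exact pullBil_sub_mem _ hr
  · intro q hq v hv
    have hv' := apply_five_eq_zero hv
    refine eq_zero_of_coframe (h₁.split _ hq.1).indep fun i => ?_
    fin_cases i
    · exact hv' 0
    · exact hv' 3
    · exact hv' 4
    · exact hv' 1
    · exact hv' 2
  · intro q hq v hv
    exact eq_zero_of_coframe (h₂.split _ hq.2).indep (apply_five_eq_zero hv)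
  · intro q hq v h1 h2 h3
    refine eq_zero_of_map_eq_zero (θ₂ := θ₂ (𝓓.π₂ q)) (β₂ := extD θ₂ (𝓓.π₂ q))
      (T₁ := 𝓓.dπ₁ q) (T₂ := 𝓓.dπ₂ q) (ℓ := 𝓓.dlam q)
      (h₁.split _ hq.1) (two₂ := 𝓓.I₂.two (𝓓.π₂ q)) ?_ ?_ ?_ (h.immersion q) h1 h2 h3
    · rw [g₂.two_eq _ hq.2]
      exact Submodule.mem_sup_left (Submodule.subset_span (by simp))
    · have := h.same_span q
      rwa [hK q hq, wedgeIdeal_span] at this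
    · have := h.indep q U₁ U₂ θ₁ Ψ₁ θ₂ Ψ₂ hU₁ hq.1 g₁ hU₂ hq.2 g₂
      rwa [hK q hq, wedgeIdeal_span] at this
  · intro q hq i u v hu
    rw [e₁, extD_pullForm (s₁ i _ hq.1) (h.smooth_π₁ q)]
    have hu' : mder 7 5 𝓓.π₁ q u = 0 := hu
    rw [pullBil_apply, hu', map_zero]
    rfl
  · intro q hq i u v hu
    rw [e₂, extD_pullForm (s₂ i _ hq.2) (h.smooth_π₂ q)]
    have hu' : mder 7 5 𝓓.π₂ q u = 0 := hu
    rw [pullBil_apply, hu', map_zero]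
    rfl
  · exact hK

end Data

end Backlund

namespace Backlund

open Filter Topology

/-! ### Removing multiples of a contact form and of `dλ` -/

section Combination

variable {M : Type*} [TopologicalSpace M] [ChartedSpace (E 7) M]
  [IsManifold (𝓡 7) ∞ M] {U : Set M}

/-- Expand `x` in the coframe: two components vanish by hypothesis, two are subtracted, and three
remain. The resulting `χ` is thus both a correction of `x` and a smooth combination of the `e (s
t)`; each description serves to compute a part of `dχ`. -/
theorem exists_reduction (hU : IsOpen U) {e : Fin 7 → M → Cov 7} (he : ∀ i, SmoothOneOn (e i) U)
    (hi : ∀ q ∈ U, LinearIndependent ℝ fun i => e i q) {x : M → Cov 7} (hx : SmoothOneOn x U)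
    {i j k l : Fin 7} {s : Fin 3 → Fin 7} (hs : Function.Injective s) (hij : i ≠ j)
    (ht : ∀ t, t ∉ Set.range s → t = i ∨ t = j ∨ t = k ∨ t = l)
    (hk : k ≠ i ∧ k ≠ j) (hl : l ≠ i ∧ l ≠ j)
    (hxk : ∀ q ∈ U, x q (dualVec (fun i => e i q) k) = 0)
    (hxl : ∀ q ∈ U, x q (dualVec (fun i => e i q) l) = 0) :
    ∃ (χ : M → Cov 7) (z w : M → ℝ), SmoothOneOn χ U ∧
      (∀ q, χ q = x q - z q • e j q - w q • e i q) ∧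
      (∀ q ∈ U, ∀ u v, e j q u = 0 → e j q v = 0 → e i q u = 0 → e i q v = 0 →
        extD χ q u v = extD x q u v - z q * extD (e j) q u v - w q * extD (e i) q u v) ∧
      ∃ g : Fin 3 → M → ℝ, (∀ t, SmoothFunOn (n := 7) (g t) U) ∧
        ∀ q ∈ U, χ q = ∑ t, g t q • e (s t) q := by
  obtain ⟨χ, h1, h2, h3⟩ := exists_sub_smul_sub_smul hx (he j) (he i)
    (smoothFunOn_dualVec hU he hi hx j) (smoothFunOn_dualVec hU he hi hx i)
  refine ⟨χ, _, _, h1, h2, h3, fun t q => χ q (dualVec (fun i => e i q) (s t)),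
    fun t => smoothFunOn_dualVec hU he hi h1 (s t), fun q hq => ?_⟩
  have hd := apply_dualVec (hi q hq)
  conv_lhs => rw [cov_eq_sum (hi q hq) (χ q)]
  refine (Fintype.sum_of_injective s hs _ _ (fun t hr => ?_) fun t => rfl).symm
  have : χ q (dualVec (fun i => e i q) t) = 0 := by
    rw [h2]
    simp only [sub_apply, smul_apply, smul_eq_mul, hd]
    rcases ht t hr with rfl | rfl | rfl | rfl
    · simp [hij.symm]
    · simp [hij]
    · simp [hxk q hq, hk.1.symm, hk.2.symm]
    · simp [hxl q hq, hl.1.symm, hl.2.symm]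
  rw [this]
  ext v
  simp

end Combination

theorem span_sub_smul {n : ℕ} (θ a b : Cov n) (z w : ℝ) :
    Submodule.span ℝ {θ, a, b} = Submodule.span ℝ {θ, a - z • θ, b - w • θ} := by
  apply le_antisymm <;> rw [Submodule.span_le]
  · rintro x (rfl | rfl | rfl) <;> rw [SetLike.mem_coe, Submodule.mem_span_triple]
    · exact ⟨1, 0, 0, by ext v; simp⟩
    · exact ⟨z, 1, 0, by ext v; simp⟩
    · exact ⟨w, 0, 1, by ext v; simp⟩
  · rintro x (rfl | rfl | rfl) <;> rw [SetLike.mem_coe, Submodule.mem_span_triple]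
    · exact ⟨1, 0, 0, by ext v; simp⟩
    · exact ⟨-z, 1, 0, by ext v; simp; ring⟩
    · exact ⟨-w, 0, 1, by ext v; simp; ring⟩

/-- Substituting `c ≡ c' + w ζ` and `d ≡ d' + w' ζ mod θ` in `c ∧ d` produces `ζ ∧ (-w' c' + w d')`,
the source of the coefficients `Dᵢ`. -/
theorem exists_sub_wedge_mem {n : ℕ} {β : Bil n} {θ ζ a b c d x y c' d' : Cov n} {r z w z' w' : ℝ}
    (h : β - (wedge c d + r • wedge a b) ∈ wedgeIdeal {θ})
    (ha : a ∈ Submodule.span ℝ {θ, x, y}) (hb : b ∈ Submodule.span ℝ {θ, x, y})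
    (hc : c' = c - z • θ - w • ζ) (hd : d' = d - z' • θ - w' • ζ) :
    ∃ A : ℝ, β - (wedge c' d' + A • wedge x y + wedge ζ (-w' • c' + w • d')) ∈
      wedgeIdeal {θ} := by
  obtain ⟨s, hs⟩ := exists_wedge_sub_mem ha hb
  refine ⟨r * s, ?_⟩
  have e : β - (wedge c' d' + (r * s) • wedge x y + wedge ζ (-w' • c' + w • d')) =
      β - (wedge c d + r • wedge a b) + wedge θ (z • d - z' • c) +
        r • (wedge a b - s • wedge x y) := by
    subst hc hd
    ext u v
    simp only [add_apply, sub_apply, smul_apply, smul_eq_mul, wedge_apply]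
    ring
  rw [e]
  exact Submodule.add_mem _ (Submodule.add_mem _ h
    (wedge_mem_wedgeIdeal (Set.mem_singleton θ) _)) (Submodule.smul_mem _ _ hs)

theorem apply_eq_zero_of_sup_span_eq {n : ℕ} {S S' K : Submodule ℝ (Cov n)} (h : S ⊔ K = S' ⊔ K)
    {k₁ k₂ k₃ x a b x' a' b' : Cov n} (hK : K = Submodule.span ℝ {k₁, k₂, k₃})
    (hS : S = Submodule.span ℝ {x, a, b}) (hS' : S' = Submodule.span ℝ {x', a', b'}) {v : E n}
    (h₁ : k₁ v = 0) (h₂ : k₂ v = 0) (h₃ : k₃ v = 0) (hx : x v = 0) (ha : a v = 0)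
    (hb : b v = 0) : a' v = 0 ∧ b' v = 0 := by
  have := apply_eq_zero_of_sup_eq h (v := v)
    (fun y hy => apply_eq_zero_of_mem_span_triple h₁ h₂ h₃ (hK ▸ hy))
    (fun y hy => apply_eq_zero_of_mem_span_triple hx ha hb (hS ▸ hy))
  exact ⟨this _ (hS' ▸ Submodule.subset_span (by simp)),
    this _ (hS' ▸ Submodule.subset_span (by simp))⟩

end Backlund

namespace Backlund

open Filter Topology

/-! ### Construction of a section with `ζ = dλ` -/

namespace Data

variable {M₁ M₂ P : Type*}
  [TopologicalSpace M₁] [ChartedSpace (E 5) M₁]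
  [TopologicalSpace M₂] [ChartedSpace (E 5) M₂]
  [TopologicalSpace P] [ChartedSpace (E 7) P]

/-- A local section of the `G`-structure with `ζ = dλ`, together with the vanishing of the
contractions of `dω¹`, `dω²` with vectors tangent to the fibres of `π₁` and `π₂`. -/
structure IsReducedSection (𝓓 : Data M₁ M₂ P) (U : Set P) (σ : Coframing P)
    (A : P → Fin 2 → ℝ) (D : P → Fin 4 → ℝ) : Prop extends 𝓓.IsSection U σ A D where
  ζ_eq : σ.ζ = 𝓓.dlam
  ker₁ : ∀ q ∈ U, ∀ v, σ.θ₁ q v = 0 → σ.ω₁ q v = 0 → σ.ω₂ q v = 0 → σ.ωt₃ (D q) q v = 0 →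
    σ.ωt₄ (D q) q v = 0 → 𝓓.dπ₁ q v = 0
  ker₂ : ∀ q ∈ U, ∀ v, σ.θ₂ q v = 0 → σ.ωt₁ (D q) q v = 0 → σ.ωt₂ (D q) q v = 0 →
    σ.ω₃ q v = 0 → σ.ω₄ q v = 0 → 𝓓.dπ₂ q v = 0
  ext₁ : ∀ q ∈ U, ∀ i : Fin 2, ∀ u v, 𝓓.dπ₁ q u = 0 → σ.θ₁ q v = 0 → σ.ω₁ q v = 0 →
    σ.ω₂ q v = 0 → extD (![σ.ω₁, σ.ω₂] i) q u v = 0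
  ext₂ : ∀ q ∈ U, ∀ i : Fin 2, ∀ u v, 𝓓.dπ₂ q u = 0 → σ.ζ q u = 0 → σ.ζ q v = 0 →
    σ.θ₂ q v = 0 → extD (![σ.ω₁, σ.ω₂] i) q u v = 0

theorem apply_eq_zero_of_mem_pull₁ {𝓓 : Data M₁ M₂ P} {C : M₁ → Submodule ℝ (Cov 5)} {q : P}
    {x : Cov 7} (hx : x ∈ 𝓓.pull₁ C q) {v : E 7} (hv : 𝓓.dπ₁ q v = 0) : x v = 0 := by
  obtain ⟨α, -, rfl⟩ := hx
  rw [pullCov_apply, hv, map_zero]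

theorem apply_eq_zero_of_mem_pull₂ {𝓓 : Data M₁ M₂ P} {C : M₂ → Submodule ℝ (Cov 5)} {q : P}
    {x : Cov 7} (hx : x ∈ 𝓓.pull₂ C q) {v : E 7} (hv : 𝓓.dπ₂ q v = 0) : x v = 0 := by
  obtain ⟨α, -, rfl⟩ := hx
  rw [pullCov_apply, hv, map_zero]

variable [IsManifold (𝓡 7) ∞ P]

theorem _root_.Backlund.sum_three_mem {n : ℕ} {y a b : Cov n} (g : Fin 3 → ℝ) :
    (∑ t, g t • ![y, a, b] t) ∈ Submodule.span ℝ {y, a, b} := by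
  rw [Fin.sum_univ_three]
  exact Submodule.mem_span_triple.2 ⟨g 0, g 1, g 2, rfl⟩

/-- Modulo `θ₁, θ₂, dλ` the forms `a', b'` are combinations of `a, b`. Subtracting from them the
right multiples of `θ₂` and `dλ` puts them into `π₁*𝒞₁₁`, and this defines `ω¹, ω²`; likewise `c, d`
are corrected by `θ₁` and `dλ` to define `ω³, ω⁴` in `π₂*𝒞₂₂`. -/
theorem IsLift.exists_isReducedSection {𝓓 : Data M₁ M₂ P} (h : 𝓓.IsParametricBacklund)
    {U : Set P} (hU : IsOpen U) {θ₁ a b c d θ₂ a' b' c' d' : P → Cov 7}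
    (L : 𝓓.IsLift U θ₁ a b c d θ₂ a' b' c' d') :
    ∃ σ A D, 𝓓.IsReducedSection U σ A D := by
  have hζ : SmoothOneOn 𝓓.dlam U := smoothOneOn_diffForm h.smooth_lam U
  have n₁ : ∀ q ∈ U, ∀ v, 𝓓.dlam q v = 0 → θ₁ q v = 0 → θ₂ q v = 0 → a q v = 0 → b q v = 0 →
      a' q v = 0 ∧ b' q v = 0 := fun q hq v h0 h1 h2 h3 h4 =>
    apply_eq_zero_of_sup_span_eq (h.numbering₁ q) (L.K_eq q hq) (L.C₁₁_eq q hq) (L.C₂₁_eq q hq)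
      h1 h2 h0 h1 h3 h4
  have n₂ : ∀ q ∈ U, ∀ v, 𝓓.dlam q v = 0 → θ₁ q v = 0 → θ₂ q v = 0 → c q v = 0 → d q v = 0 →
      c' q v = 0 ∧ d' q v = 0 := fun q hq v h0 h1 h2 h3 h4 =>
    apply_eq_zero_of_sup_span_eq (h.numbering₂ q) (L.K_eq q hq) (L.C₁₂_eq q hq) (L.C₂₂_eq q hq)
      h1 h2 h0 h1 h3 h4
  have n₂' : ∀ q ∈ U, ∀ v, 𝓓.dlam q v = 0 → θ₁ q v = 0 → θ₂ q v = 0 → c' q v = 0 →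
      d' q v = 0 → c q v = 0 ∧ d q v = 0 := fun q hq v h0 h1 h2 h3 h4 =>
    apply_eq_zero_of_sup_span_eq (h.numbering₂ q).symm (L.K_eq q hq) (L.C₂₂_eq q hq)
      (L.C₁₂_eq q hq) h1 h2 h0 h2 h3 h4
  have kz : ∀ q ∈ U, ∀ v, 𝓓.dlam q v = 0 → θ₁ q v = 0 → θ₂ q v = 0 → a' q v = 0 → b' q v = 0 →
      c' q v = 0 → d' q v = 0 → v = 0 := by
    intro q hq v h0 h1 h2 h3 h4 h5 h6
    refine L.ker q hq v (L.ker₂ q hq v fun i => ?_) h0 h1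
    fin_cases i <;> assumption
  -- A mixed auxiliary coframe: `a, b` come from `M₁` and `c', d'` from `M₂`.
  set e : Fin 7 → P → Cov 7 := ![𝓓.dlam, θ₁, θ₂, a, b, c', d'] with he
  have se : ∀ i, SmoothOneOn (e i) U := by
    intro i
    fin_cases i
    · exact hζ
    · exact L.smooth₁ 0
    · exact L.smooth₂ 0
    · exact L.smooth₁ 1
    · exact L.smooth₁ 2
    · exact L.smooth₂ 3
    · exact L.smooth₂ 4
  have hi : ∀ q ∈ U, LinearIndependent ℝ fun i => e i q := by
    intro q hq
    refine linearIndependent_of_apply fun v hv => ?_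
    obtain ⟨h3, h4⟩ := n₁ q hq v (hv 0) (hv 1) (hv 2) (hv 3) (hv 4)
    exact kz q hq v (hv 0) (hv 1) (hv 2) h3 h4 (hv 5) (hv 6)
  have hd : ∀ q ∈ U, ∀ i j, i ≠ j → e i q (dualVec (fun i => e i q) j) = 0 := fun q hq i j hij => by
    rw [apply_dualVec (hi q hq) i j, if_neg hij]
  -- The numbering of the characteristic systems says that `a', b'` have no components along `c',
  -- d'`.
  have v₁ : ∀ j, j = 5 ∨ j = 6 → ∀ q ∈ U, a' q (dualVec (fun i => e i q) j) = 0 ∧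
      b' q (dualVec (fun i => e i q) j) = 0 := by
    rintro j (rfl | rfl) q hq <;>
    exact n₁ q hq _ (hd q hq 0 _ (by decide)) (hd q hq 1 _ (by decide)) (hd q hq 2 _ (by decide))
      (hd q hq 3 _ (by decide)) (hd q hq 4 _ (by decide))
  have v₂ : ∀ j, j = 3 ∨ j = 4 → ∀ q ∈ U, c q (dualVec (fun i => e i q) j) = 0 ∧
      d q (dualVec (fun i => e i q) j) = 0 := by
    rintro j (rfl | rfl) q hq <;>
    exact n₂' q hq _ (hd q hq 0 _ (by decide)) (hd q hq 1 _ (by decide)) (hd q hq 2 _ (by decide))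
      (hd q hq 5 _ (by decide)) (hd q hq 6 _ (by decide))
  obtain ⟨ω₁, z₁, w₁, s₁, eq₁, ext₁, g₁, sg₁, hg₁⟩ := exists_reduction hU se hi
    (x := a') (L.smooth₂ 1) (i := 0) (j := 2) (k := 5) (l := 6) (s := ![1, 3, 4]) (by decide)
    (by decide) (by decide) (by decide) (by decide) (fun q hq => (v₁ 5 (.inl rfl) q hq).1)
    (fun q hq => (v₁ 6 (.inr rfl) q hq).1)
  obtain ⟨ω₂, z₂, w₂, s₂, eq₂, ext₂, g₂, sg₂, hg₂⟩ := exists_reduction hU se hi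
    (x := b') (L.smooth₂ 2) (i := 0) (j := 2) (k := 5) (l := 6) (s := ![1, 3, 4]) (by decide)
    (by decide) (by decide) (by decide) (by decide) (fun q hq => (v₁ 5 (.inl rfl) q hq).2)
    (fun q hq => (v₁ 6 (.inr rfl) q hq).2)
  obtain ⟨ω₃, z₃, w₃, s₃, eq₃, -, g₃, -, hg₃⟩ := exists_reduction hU se hi
    (x := c) (L.smooth₁ 3) (i := 0) (j := 1) (k := 3) (l := 4) (s := ![2, 5, 6]) (by decide)
    (by decide) (by decide) (by decide) (by decide) (fun q hq => (v₂ 3 (.inl rfl) q hq).1)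
    (fun q hq => (v₂ 4 (.inr rfl) q hq).1)
  obtain ⟨ω₄, z₄, w₄, s₄, eq₄, -, g₄, -, hg₄⟩ := exists_reduction hU se hi
    (x := d) (L.smooth₁ 4) (i := 0) (j := 1) (k := 3) (l := 4) (s := ![2, 5, 6]) (by decide)
    (by decide) (by decide) (by decide) (by decide) (fun q hq => (v₂ 3 (.inl rfl) q hq).2)
    (fun q hq => (v₂ 4 (.inr rfl) q hq).2)
  have ee₁ : ∀ q t, e ((![1, 3, 4] : Fin 3 → Fin 7) t) q = ![θ₁ q, a q, b q] t := by
    intro q t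
    fin_cases t <;> rfl
  have ee₂ : ∀ q t, e ((![2, 5, 6] : Fin 3 → Fin 7) t) q = ![θ₂ q, c' q, d' q] t := by
    intro q t
    fin_cases t <;> rfl
  have m₁ : ∀ q ∈ U, ω₁ q ∈ Submodule.span ℝ {θ₁ q, a q, b q} := fun q hq => by
    rw [hg₁ q hq]; simp only [ee₁]; exact sum_three_mem _
  have m₂ : ∀ q ∈ U, ω₂ q ∈ Submodule.span ℝ {θ₁ q, a q, b q} := fun q hq => by
    rw [hg₂ q hq]; simp only [ee₁]; exact sum_three_mem _
  have m₃ : ∀ q ∈ U, ω₃ q ∈ Submodule.span ℝ {θ₂ q, c' q, d' q} := fun q hq => by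
    rw [hg₃ q hq]; simp only [ee₂]; exact sum_three_mem _
  have m₄ : ∀ q ∈ U, ω₄ q ∈ Submodule.span ℝ {θ₂ q, c' q, d' q} := fun q hq => by
    rw [hg₄ q hq]; simp only [ee₂]; exact sum_three_mem _
  change ∀ q, ω₁ q = a' q - z₁ q • θ₂ q - w₁ q • 𝓓.dlam q at eq₁
  change ∀ q, ω₂ q = b' q - z₂ q • θ₂ q - w₂ q • 𝓓.dlam q at eq₂
  change ∀ q, ω₃ q = c q - z₃ q • θ₁ q - w₃ q • 𝓓.dlam q at eq₃
  change ∀ q, ω₄ q = d q - z₄ q • θ₁ q - w₄ q • 𝓓.dlam q at eq₄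
  set σ : Coframing P := ⟨𝓓.dlam, θ₁, θ₂, ω₁, ω₂, ω₃, ω₄⟩ with hσ
  -- Chosen so that passing to `ω̃ⁱ` restores the subtracted multiple of `dλ`, leaving `a', b'`
  -- modulo `θ₂` and `c, d` modulo `θ₁`.
  set D : P → Fin 4 → ℝ := fun q => ![-w₂ q, w₁ q, -w₄ q, w₃ q] with hD
  have t₁ : ∀ q, σ.ωt₁ (D q) q = a' q - z₁ q • θ₂ q := fun q => by
    change ω₁ q + w₁ q • 𝓓.dlam q = _
    rw [eq₁]
    exact sub_add_cancel _ _
  have t₂ : ∀ q, σ.ωt₂ (D q) q = b' q - z₂ q • θ₂ q := fun q => by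
    change ω₂ q - (-w₂ q) • 𝓓.dlam q = _
    rw [eq₂]
    ext v
    simp
  have t₃ : ∀ q, σ.ωt₃ (D q) q = c q - z₃ q • θ₁ q := fun q => by
    change ω₃ q + w₃ q • 𝓓.dlam q = _
    rw [eq₃]
    exact sub_add_cancel _ _
  have t₄ : ∀ q, σ.ωt₄ (D q) q = d q - z₄ q • θ₁ q := fun q => by
    change ω₄ q - (-w₄ q) • 𝓓.dlam q = _
    rw [eq₄]
    ext v
    simp
  have hcof : ∀ q ∈ U, LinearIndependent ℝ (σ.value q) := by
    intro q hq
    refine linearIndependent_of_apply fun v hv => ?_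
    have h0 : 𝓓.dlam q v = 0 := hv 0
    have h1 : θ₁ q v = 0 := hv 1
    have h2 : θ₂ q v = 0 := hv 2
    have h3 : ω₁ q v = 0 := hv 3
    have h4 : ω₂ q v = 0 := hv 4
    have h5 : ω₃ q v = 0 := hv 5
    have h6 : ω₄ q v = 0 := hv 6
    rw [eq₁] at h3
    rw [eq₂] at h4
    rw [eq₃] at h5
    rw [eq₄] at h6
    simp only [sub_apply, smul_apply, h0, h1, h2, smul_zero, sub_zero] at h3 h4 h5 h6
    obtain ⟨h7, h8⟩ := n₂ q hq v h0 h1 h2 h5 h6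
    exact kz q hq v h0 h1 h2 h3 h4 h7 h8
  have C₁₁ : ∀ q ∈ U, 𝓓.pull₁ 𝓓.C₁₁ q = Submodule.span ℝ {θ₁ q, ω₁ q, ω₂ q} := by
    intro q hq
    refine eq_span_triple (by rw [L.C₁₁_eq q hq, span_triple_range]) ?_
      (L.C₁₁_eq q hq ▸ Submodule.subset_span (by simp)) (L.C₁₁_eq q hq ▸ m₁ q hq)
      (L.C₁₁_eq q hq ▸ m₂ q hq)
    have := (hcof q hq).comp (![1, 3, 4] : Fin 3 → Fin 7) (by decide)
    convert this using 1
    ext t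
    fin_cases t <;> rfl
  have C₂₂ : ∀ q ∈ U, 𝓓.pull₂ 𝓓.C₂₂ q = Submodule.span ℝ {θ₂ q, ω₃ q, ω₄ q} := by
    intro q hq
    refine eq_span_triple (by rw [L.C₂₂_eq q hq, span_triple_range]) ?_
      (L.C₂₂_eq q hq ▸ Submodule.subset_span (by simp)) (L.C₂₂_eq q hq ▸ m₃ q hq)
      (L.C₂₂_eq q hq ▸ m₄ q hq)
    have := (hcof q hq).comp (![2, 5, 6] : Fin 3 → Fin 7) (by decide)
    convert this using 1
    ext t
    fin_cases t <;> rfl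
  have ma : ∀ q ∈ U, a q ∈ Submodule.span ℝ {θ₁ q, ω₁ q, ω₂ q} := fun q hq => by
    rw [← C₁₁ q hq, L.C₁₁_eq q hq]; exact Submodule.subset_span (by simp)
  have mb : ∀ q ∈ U, b q ∈ Submodule.span ℝ {θ₁ q, ω₁ q, ω₂ q} := fun q hq => by
    rw [← C₁₁ q hq, L.C₁₁_eq q hq]; exact Submodule.subset_span (by simp)
  have mc : ∀ q ∈ U, c' q ∈ Submodule.span ℝ {θ₂ q, ω₃ q, ω₄ q} := fun q hq => by
    rw [← C₂₂ q hq, L.C₂₂_eq q hq]; exact Submodule.subset_span (by simp)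
  have md : ∀ q ∈ U, d' q ∈ Submodule.span ℝ {θ₂ q, ω₃ q, ω₄ q} := fun q hq => by
    rw [← C₂₂ q hq, L.C₂₂_eq q hq]; exact Submodule.subset_span (by simp)
  have C₁₂ : ∀ q ∈ U, 𝓓.pull₁ 𝓓.C₁₂ q =
      Submodule.span ℝ {θ₁ q, σ.ωt₃ (D q) q, σ.ωt₄ (D q) q} := fun q hq => by
    rw [L.C₁₂_eq q hq, t₃, t₄]
    exact span_sub_smul ..
  have C₂₁ : ∀ q ∈ U, 𝓓.pull₂ 𝓓.C₂₁ q =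
      Submodule.span ℝ {θ₂ q, σ.ωt₁ (D q) q, σ.ωt₂ (D q) q} := fun q hq => by
    rw [L.C₂₁_eq q hq, t₁, t₂]
    exact span_sub_smul ..
  -- The membership `q ∈ U` sits inside the existential so that the choice below gives a function on
  -- all of `P`; the coefficients `A` need not be smooth.
  have x₁ : ∀ q, ∃ A : ℝ, q ∈ U → extD θ₁ q - (wedge (ω₃ q) (ω₄ q) + A • wedge (ω₁ q) (ω₂ q) +
      wedge (𝓓.dlam q) (-w₄ q • ω₃ q + w₃ q • ω₄ q)) ∈ wedgeIdeal {θ₁ q} := fun q => by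
    by_cases hq : q ∈ U
    · obtain ⟨r, hr⟩ := L.dθ₁_eq q hq
      obtain ⟨A, hA⟩ := exists_sub_wedge_mem hr (ma q hq) (mb q hq) (eq₃ q) (eq₄ q)
      exact ⟨A, fun _ => hA⟩
    · exact ⟨0, fun h => absurd h hq⟩
  have x₂ : ∀ q, ∃ A : ℝ, q ∈ U → extD θ₂ q - (wedge (ω₁ q) (ω₂ q) + A • wedge (ω₃ q) (ω₄ q) +
      wedge (𝓓.dlam q) (-w₂ q • ω₁ q + w₁ q • ω₂ q)) ∈ wedgeIdeal {θ₂ q} := fun q => by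
    by_cases hq : q ∈ U
    · obtain ⟨r, hr⟩ := L.dθ₂_eq q hq
      obtain ⟨A, hA⟩ := exists_sub_wedge_mem hr (mc q hq) (md q hq) (eq₁ q) (eq₂ q)
      exact ⟨A, fun _ => hA⟩
    · exact ⟨0, fun h => absurd h hq⟩
  choose A₁ hA₁ using x₁
  choose A₂ hA₂ using x₂
  refine ⟨σ, fun q => ![A₁ q, A₂ q], D, ?_⟩
  constructor
  · constructor
    · exact hζ
    · exact L.smooth₁ 0
    · exact L.smooth₂ 0
    · exact s₁
    · exact s₂
    · exact s₃
    · exact s₄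
    · exact hcof
    · exact fun q _ => Submodule.mem_span_singleton_self _
    · exact L.θ₁_mem
    · exact L.θ₂_mem
    · exact C₁₁
    · exact C₂₂
    · intro q hq
      have e : A₁ q • wedge (ω₁ q) (ω₂ q) + wedge (ω₃ q) (ω₄ q) +
          wedge (𝓓.dlam q) (-w₄ q • ω₃ q + w₃ q • ω₄ q) =
          wedge (ω₃ q) (ω₄ q) + A₁ q • wedge (ω₁ q) (ω₂ q) +
          wedge (𝓓.dlam q) (-w₄ q • ω₃ q + w₃ q • ω₄ q) := by
        ext u v
        simp only [add_apply]
        ring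
      have := hA₁ q hq
      rw [← e] at this
      exact this
    · exact hA₂
    · exact C₁₂
    · exact C₂₁
  · rfl
  · intro q hq v h1 h3 h4 h5 h6
    rw [t₃] at h5
    rw [t₄] at h6
    change θ₁ q v = 0 at h1
    simp only [sub_apply, smul_apply, h1, smul_zero, sub_zero] at h5 h6
    have h3' := apply_eq_zero_of_mem_span_triple h1 h3 h4 (ma q hq)
    have h4' := apply_eq_zero_of_mem_span_triple h1 h3 h4 (mb q hq)
    refine L.ker₁ q hq v fun i => ?_
    fin_cases i <;> assumption
  · intro q hq v h1 h3 h4 h5 h6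
    rw [t₁] at h3
    rw [t₂] at h4
    change θ₂ q v = 0 at h1
    simp only [sub_apply, smul_apply, h1, smul_zero, sub_zero] at h3 h4
    have h3' := apply_eq_zero_of_mem_span_triple h1 h5 h6 (mc q hq)
    have h4' := apply_eq_zero_of_mem_span_triple h1 h5 h6 (md q hq)
    refine L.ker₂ q hq v fun i => ?_
    fin_cases i <;> assumption
  -- Uses the description of `ω¹, ω²` as combinations of forms pulled back from `M₁`.
  · intro q hq i u v hu h1 h3 h4
    have hv : ∀ t, e ((![1, 3, 4] : Fin 3 → Fin 7) t) q v = 0 := by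
      intro t
      rw [ee₁]
      fin_cases t
      · exact h1
      · exact apply_eq_zero_of_mem_span_triple h1 h3 h4 (ma q hq)
      · exact apply_eq_zero_of_mem_span_triple h1 h3 h4 (mb q hq)
    have hu' : ∀ t, e ((![1, 3, 4] : Fin 3 → Fin 7) t) q u = 0 := by
      intro t
      rw [ee₁]
      refine apply_eq_zero_of_mem_pull₁ (𝓓 := 𝓓) (C := 𝓓.C₁₁) (q := q) ?_ hu
      rw [L.C₁₁_eq q hq]
      refine Submodule.subset_span ?_
      fin_cases t <;> simp
    have hz : ∀ t, extD (e ((![1, 3, 4] : Fin 3 → Fin 7) t)) q u v = 0 := by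
      intro t
      fin_cases t
      · exact L.ext₁ q hq 0 u v hu
      · exact L.ext₁ q hq 1 u v hu
      · exact L.ext₁ q hq 2 u v hu
    fin_cases i
    · refine (extD_apply_of_eq_sum hU sg₁ (fun t => se _) hg₁ hq hu' hv).trans ?_
      simp [hz]
    · refine (extD_apply_of_eq_sum hU sg₂ (fun t => se _) hg₂ hq hu' hv).trans ?_
      simp [hz]
  -- Uses the other description, `a'` or `b'` minus multiples of `θ₂` and of the closed form `dλ`.
  · intro q hq i u v hu h0 h0' h2
    have h2' : θ₂ q u = 0 := apply_eq_zero_of_mem_pull₂ (L.θ₂_mem q hq) hu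
    have hz : extD (e 0) q u v = 0 := by
      change extD (diffForm 7 𝓓.lam) q u v = 0
      rw [extD_diffForm h.smooth_lam]
      rfl
    have hy : extD (e 2) q u v = 0 := L.ext₂ q hq 0 u v hu
    have ha : extD a' q u v = 0 := L.ext₂ q hq 1 u v hu
    have hb : extD b' q u v = 0 := L.ext₂ q hq 2 u v hu
    fin_cases i
    · refine (ext₁ q hq u v h2' h2 h0 h0').trans ?_
      simp [ha, hy, hz]
    · refine (ext₂ q hq u v h2' h2 h0 h0').trans ?_
      simp [hb, hy, hz]

end Data

end Backlund

namespace Backlund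

open Filter Topology

/-! ### Torsion of the constructed section and descent to `M₁` and `M₂` -/

namespace Data

variable {M₁ M₂ P : Type*}
  [TopologicalSpace M₁] [ChartedSpace (E 5) M₁]
  [TopologicalSpace M₂] [ChartedSpace (E 5) M₂]
  [TopologicalSpace P] [ChartedSpace (E 7) P]
  {𝓓 : Data M₁ M₂ P} {U : Set P} {σ : Coframing P} {A : P → Fin 2 → ℝ} {D : P → Fin 4 → ℝ}

theorem IsSection.linearIndependent_ωt (h : 𝓓.IsSection U σ A D) {q : P} (hq : q ∈ U) :
    LinearIndependent ℝ ![σ.ζ q, σ.θ₁ q, σ.θ₂ q, σ.ω₁ q, σ.ω₂ q, σ.ωt₃ (D q) q,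
      σ.ωt₄ (D q) q] := by
  refine linearIndependent_of_apply fun v hv => eq_zero_of_coframe (h.coframe q hq) fun i => ?_
  have h0 : σ.ζ q v = 0 := hv 0
  have h1 : σ.θ₁ q v = 0 := hv 1
  have h2 : σ.θ₂ q v = 0 := hv 2
  have h3 : σ.ω₁ q v = 0 := hv 3
  have h4 : σ.ω₂ q v = 0 := hv 4
  have h5 : σ.ω₃ q v = 0 := by simpa [Coframing.ωt₃, h0] using (hv 5 : σ.ωt₃ (D q) q v = 0)
  have h6 : σ.ω₄ q v = 0 := by simpa [Coframing.ωt₄, h0] using (hv 6 : σ.ωt₄ (D q) q v = 0)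
  rw [Coframing.value]
  fin_cases i <;> assumption

/-- In the frame dual to `ζ, θ₁, θ₂, ω¹, ω², ω̃³, ω̃⁴` the vectors dual to `ζ` and `θ₂` are tangent
to the fibres of `π₁`, and the one dual to `θ₁` to the fibres of `π₂` inside the slice. On `ker ω¹ ∩
ker ω²` the resulting vanishings leave only the components `θ₁∧θ₂`, `ω̃³∧ω̃⁴` and `ζ∧θ₁`. -/
theorem IsReducedSection.exists_isTorsion (h : 𝓓.IsReducedSection U σ A D) (hU : IsOpen U) {q : P}
    (hq : q ∈ U) : ∃ B C E : Fin 2 → ℝ, 𝓓.IsTorsion₁₂ q (σ.value q) B C E ∧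
      ∀ i v w, σ.ω₁ q v = 0 → σ.ω₂ q v = 0 → σ.ω₁ q w = 0 → σ.ω₂ q w = 0 →
        extD (![σ.ω₁, σ.ω₂] i) q v w = B i * wedge (σ.θ₁ q) (σ.θ₂ q) v w +
          C i * wedge (σ.ωt₃ (D q) q) (σ.ωt₄ (D q) q) v w +
          E i * wedge (σ.ζ q) (σ.θ₁ q) v w := by
  have hi := h.linearIndependent_ωt hq
  set e : Fin 7 → Cov 7 := ![σ.ζ q, σ.θ₁ q, σ.θ₂ q, σ.ω₁ q, σ.ω₂ q, σ.ωt₃ (D q) q,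
      σ.ωt₄ (D q) q] with he
  have hd : ∀ i j, e i (dualVec e j) = if i = j then 1 else 0 := apply_dualVec hi
  have z : ∀ i j, i ≠ j → e i (dualVec e j) = 0 := fun i j hij => by rw [hd, if_neg hij]
  have k₁ : ∀ j, j = 0 ∨ j = 2 → 𝓓.dπ₁ q (dualVec e j) = 0 := by
    rintro j (rfl | rfl) <;>
    exact h.ker₁ q hq _ (z 1 _ (by decide)) (z 3 _ (by decide)) (z 4 _ (by decide))
      (z 5 _ (by decide)) (z 6 _ (by decide))
  have k₂ : 𝓓.dπ₂ q (dualVec e 1) = 0 := by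
    have h0 : σ.ζ q (dualVec e 1) = 0 := z 0 1 (by decide)
    have h3 : σ.ω₁ q (dualVec e 1) = 0 := z 3 1 (by decide)
    have h4 : σ.ω₂ q (dualVec e 1) = 0 := z 4 1 (by decide)
    have h5 : σ.ωt₃ (D q) q (dualVec e 1) = 0 := z 5 1 (by decide)
    have h6 : σ.ωt₄ (D q) q (dualVec e 1) = 0 := z 6 1 (by decide)
    simp only [Coframing.ωt₃, Coframing.ωt₄, add_apply, sub_apply, smul_apply, h0, smul_zero,
      add_zero, sub_zero] at h5 h6
    refine h.ker₂ q hq _ (z 2 _ (by decide)) ?_ ?_ h5 h6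
    · simp [Coframing.ωt₁, h0, h3]
    · simp [Coframing.ωt₂, h0, h4]
  have x₁ : ∀ i : Fin 2, ∀ j k, (j = 0 ∨ j = 2) → (1 ≠ k ∧ 3 ≠ k ∧ 4 ≠ k) →
      extD (![σ.ω₁, σ.ω₂] i) q (dualVec e j) (dualVec e k) = 0 := fun i j k hj hk =>
    h.ext₁ q hq i _ _ (k₁ j hj) (z 1 k hk.1) (z 3 k hk.2.1) (z 4 k hk.2.2)
  have x₂ : ∀ i : Fin 2, ∀ k, (0 ≠ k ∧ 2 ≠ k) →
      extD (![σ.ω₁, σ.ω₂] i) q (dualVec e 1) (dualVec e k) = 0 := fun i k hk =>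
    h.ext₂ q hq i _ _ k₂ (z 0 1 (by decide)) (z 0 k hk.1) (z 2 k hk.2)
  have key : ∀ (i : Fin 2) (v w : E 7), σ.ω₁ q v = 0 → σ.ω₂ q v = 0 → σ.ω₁ q w = 0 →
      σ.ω₂ q w = 0 → extD (![σ.ω₁, σ.ω₂] i) q v w =
        extD (![σ.ω₁, σ.ω₂] i) q (dualVec e 1) (dualVec e 2) *
            wedge (σ.θ₁ q) (σ.θ₂ q) v w +
          extD (![σ.ω₁, σ.ω₂] i) q (dualVec e 5) (dualVec e 6) *
            wedge (σ.ωt₃ (D q) q) (σ.ωt₄ (D q) q) v w +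
          extD (![σ.ω₁, σ.ω₂] i) q (dualVec e 0) (dualVec e 1) *
            wedge (σ.ζ q) (σ.θ₁ q) v w := fun i v w h1 h2 h3 h4 =>
    apply_eq_of_coframe hi (extD_apply_self _ q) (x₁ i 0 2 (.inl rfl) (by decide))
      (x₁ i 0 5 (.inl rfl) (by decide)) (x₁ i 0 6 (.inl rfl) (by decide)) (x₂ i 5 (by decide))
      (x₂ i 6 (by decide)) (x₁ i 2 5 (.inr rfl) (by decide)) (x₁ i 2 6 (.inr rfl) (by decide))
      h1 h2 h3 h4
  refine ⟨_, _, _, ⟨U, σ, A, D, hU, hq, h.toIsSection, rfl, fun i => ?_⟩, key⟩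
  have o3 : σ.ω₁ q (dualVec e 3) = 1 := (hd 3 3).trans (if_pos rfl)
  have o4 : σ.ω₂ q (dualVec e 4) = 1 := (hd 4 4).trans (if_pos rfl)
  refine mem_wedgeIdeal_pair o3 (z 3 4 (by decide)) (z 4 3 (by decide)) o4 (fun v => ?_)
    fun v w h1 h2 h3 h4 => ?_
  · simp only [add_apply, sub_apply, smul_apply, smul_eq_mul, wedge_apply, extD_apply_self]
    ring
  · rw [sub_apply, sub_apply, key i v w h1 h2 h3 h4]
    simp only [add_apply, smul_apply, smul_eq_mul, sub_self]

/-- If `C = 0`, all three vectors vanish; if both factors vanish, only `C` can be nonzero. -/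
theorem _root_.Backlund.DependentOn.exists_eq {B C E : Fin 2 → ℝ} (h : DependentOn B C E) :
    (C 0 ≠ 0 ∨ C 1 ≠ 0) ∧ ∃ b e : ℝ, (b ≠ 0 ∨ e ≠ 0) ∧ B = b • C ∧ E = e • C := by
  obtain ⟨⟨b, rfl⟩, ⟨e, rfl⟩, h⟩ := h
  have hC : C ≠ 0 := by
    rintro rfl
    simp at h
  constructor
  · by_contra! hc
    exact hC (funext fun i => by fin_cases i <;> simp [hc])
  · refine ⟨b, e, ?_, rfl, rfl⟩
    by_contra! hc
    simp [hc] at h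

variable [IsManifold (𝓡 7) ∞ P]

theorem IsReducedSection.exists_integrable (h : 𝓓.IsReducedSection U σ A D) (hU : IsOpen U)
    (htor : ∀ (p : P), ∀ u ∈ 𝓓.𝒢 p, ∀ B C E : Fin 2 → ℝ,
      𝓓.IsTorsion₁₂ p u B C E → DependentOn B C E) :
    ∃ η : P → Cov 7, SmoothOneOn η U ∧ ∀ q ∈ U, η q ≠ 0 ∧
      η q ∈ Submodule.span ℝ {σ.ω₁ q, σ.ω₂ q} ∧ extD η q ∈ wedgeIdeal {η q} := by
  -- The untilded `ω³, ω⁴` are used here because smoothness is known for them, whereas `D` is not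
  -- assumed smooth.
  set e : Fin 7 → P → Cov 7 := ![σ.ζ, σ.θ₁, σ.θ₂, σ.ω₁, σ.ω₂, σ.ω₃, σ.ω₄] with he
  have se : ∀ i, SmoothOneOn (e i) U := by
    intro i
    fin_cases i
    · exact h.smooth_ζ
    · exact h.smooth_θ₁
    · exact h.smooth_θ₂
    · exact h.smooth_ω₁
    · exact h.smooth_ω₂
    · exact h.smooth_ω₃
    · exact h.smooth_ω₄
  have hv : ∀ q, (fun i => e i q) = σ.value q := by
    intro q
    ext i
    fin_cases i <;> rfl
  refine exists_integrable_combination hU se (fun q hq => hv q ▸ h.coframe q hq)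
    (i := 3) (j := 4) (k := 5) (l := 6) (by decide) (by decide) (by decide) (by decide)
    (by decide) fun q hq => ?_
  obtain ⟨B, C, E, ht, hE⟩ := h.exists_isTorsion hU hq
  obtain ⟨hC, b, s, hbs, rfl, rfl⟩ :=
    (htor q _ ⟨U, σ, A, D, hU, hq, h.toIsSection, rfl⟩ B C E ht).exists_eq
  refine ⟨b • wedge (σ.θ₁ q) (σ.θ₂ q) + wedge (σ.ωt₃ (D q) q) (σ.ωt₄ (D q) q) +
    s • wedge (σ.ζ q) (σ.θ₁ q), C 0, C 1, hC, fun u v h1 h2 h3 h4 => ⟨?_, ?_⟩, ?_, ?_⟩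
  · refine (hE 0 u v h1 h2 h3 h4).trans ?_
    simp only [add_apply, smul_apply, smul_eq_mul, Pi.smul_apply]
    ring
  · refine (hE 1 u v h1 h2 h3 h4).trans ?_
    simp only [add_apply, smul_apply, smul_eq_mul, Pi.smul_apply]
    ring
  -- `ζ` and `θ₁` vanish on these two dual vectors, so `ω̃³, ω̃⁴` agree there with `ω³, ω⁴`.
  · have hi : LinearIndependent ℝ fun i => e i q := hv q ▸ h.coframe q hq
    have hd := apply_dualVec hi
    have h05 := hd 0 5
    have h06 := hd 0 6
    have h15 := hd 1 5
    have h16 := hd 1 6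
    have h55 := hd 5 5
    have h56 := hd 5 6
    have h65 := hd 6 5
    have h66 := hd 6 6
    simp only [he, Fin.reduceEq, if_true, if_false] at h05 h06 h15 h16 h55 h56 h65 h66
    set x := dualVec (fun i => e i q) 5
    set y := dualVec (fun i => e i q) 6
    change σ.ζ q x = 0 at h05
    change σ.ζ q y = 0 at h06
    change σ.θ₁ q x = 0 at h15
    change σ.θ₁ q y = 0 at h16
    change σ.ω₃ q x = 1 at h55
    change σ.ω₃ q y = 0 at h56
    change σ.ω₄ q x = 0 at h65
    change σ.ω₄ q y = 1 at h66
    simp [Coframing.ωt₃, Coframing.ωt₄, h05, h06, h15, h16, h55, h56, h65, h66]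
  · intro γ hγ w h3 h4
    exact eq_zero_of_cyclic (h.linearIndependent_ωt hq) hbs rfl hγ h3 h4

variable [IsManifold (𝓡 5) ∞ M₁] [IsManifold (𝓡 5) ∞ M₂]

theorem IsParametricBacklund.hasIntegrableLineNear (h : 𝓓.IsParametricBacklund)
    (htor : ∀ (p : P), ∀ u ∈ 𝓓.𝒢 p, ∀ B C E : Fin 2 → ℝ,
      𝓓.IsTorsion₁₂ p u B C E → DependentOn B C E) (p : P) :
    HasIntegrableLineNear 𝓓.C₁₁ (𝓓.π₁ p) ∧ HasIntegrableLineNear 𝓓.C₂₁ (𝓓.π₂ p) := by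
  obtain ⟨U, θ₁, a, b, c, d, θ₂, a', b', c', d', hU, hp, L⟩ := h.exists_isLift p
  obtain ⟨σ, A, D, S⟩ := L.exists_isReducedSection h hU
  obtain ⟨η, hη, hη'⟩ := S.exists_integrable hU htor
  constructor
  · refine hasIntegrableLineNear_of_form h.smooth_π₁ h.smooth_lam (h.dlam_ne_zero p)
      (h.submersion₁ p) hU hp hη (fun q hq => (hη' q hq).2.2) fun q hq => ?_
    have hm : η q ∈ 𝓓.pull₁ 𝓓.C₁₁ q := by
      rw [S.C₁₁_eq q hq]
      exact Submodule.span_mono (Set.subset_insert _ _) (hη' q hq).2.1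
    obtain ⟨α, hα, hα'⟩ := hm
    refine ⟨α, hα, ?_, 0, ?_⟩
    · rintro rfl
      exact (hη' q hq).1 (by rw [← hα', map_zero])
    · rw [← hα']
      ext v
      simp
      rfl
  · refine hasIntegrableLineNear_of_form h.smooth_π₂ h.smooth_lam (h.dlam_ne_zero p)
      (h.submersion₂ p) hU hp hη (fun q hq => (hη' q hq).2.2) fun q hq => ?_
    obtain ⟨x, y, hxy⟩ := Submodule.mem_span_pair.1 (hη' q hq).2.1
    have hm : x • σ.ωt₁ (D q) q + y • σ.ωt₂ (D q) q ∈ 𝓓.pull₂ 𝓓.C₂₁ q := by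
      rw [S.C₂₁_eq q hq]
      exact Submodule.mem_span_triple.2 ⟨0, x, y, by ext v; simp⟩
    obtain ⟨α, hα, hα'⟩ := hm
    have hζ : σ.ζ q = diffForm 7 𝓓.lam q := congrFun S.ζ_eq q
    -- If `η = x ω¹ + y ω²`, replacing `ωⁱ` by `ω̃ⁱ` changes it by `(x D₂ - y D₁) ζ`.
    have e : η q = pullCov (mder 7 5 𝓓.π₂ q) α + (y * D q 0 - x * D q 1) • diffForm 7 𝓓.lam q := by
      change pullCov (mder 7 5 𝓓.π₂ q) α = _ at hα'
      rw [hα', ← hxy, ← hζ, Coframing.ωt₁, Coframing.ωt₂]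
      ext v
      simp only [add_apply, sub_apply, smul_apply, smul_eq_mul]
      ring
    refine ⟨α, hα, ?_, _, e⟩
    rintro rfl
    set r := y * D q 0 - x * D q 1
    have e' : ∀ v, η q v = r * σ.ζ q v := fun v => by
      rw [e, hζ]
      simp
    have hd := apply_dualVec (S.coframe q hq)
    have h00 : σ.ζ q (dualVec (σ.value q) 0) = 1 := (hd 0 0).trans (if_pos rfl)
    have h30 : σ.ω₁ q (dualVec (σ.value q) 0) = 0 := (hd 3 0).trans (if_neg (by decide))
    have h40 : σ.ω₂ q (dualVec (σ.value q) 0) = 0 := (hd 4 0).trans (if_neg (by decide))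
    -- A multiple of `ζ` in the span of `ω¹, ω²` is zero: evaluate on the vector dual to `ζ`.
    have hr : r = 0 := by
      have := e' (dualVec (σ.value q) 0)
      rw [← hxy, h00, mul_one] at this
      rw [← this]
      simp [h30, h40]
    refine (hη' q hq).1 ?_
    ext v
    rw [e', hr, zero_mul]
    rfl

end Data

end Backlund

namespace Backlund

open Filter Topology

variable {M₁ M₂ P : Type*}
  [TopologicalSpace M₁] [ChartedSpace (E 5) M₁]
  [TopologicalSpace M₂] [ChartedSpace (E 5) M₂]
  [TopologicalSpace P] [ChartedSpace (E 7) P]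

/-! ### Interchanging the two Monge-Ampère systems -/

theorem bil_add_right_comm {n : ℕ} (a b c : Bil n) : a + b + c = b + a + c := by
  ext u v
  simp only [add_apply]
  ring

/-- The coframing with the roles of the two systems interchanged. -/
def Coframing.swap (σ : Coframing P) : Coframing P :=
  ⟨σ.ζ, σ.θ₂, σ.θ₁, σ.ω₃, σ.ω₄, σ.ω₁, σ.ω₂⟩

/-- Accounts for the sign of `θ₁∧θ₂` when the two systems are interchanged. -/
theorem DependentOn.of_neg {B C E : Fin 2 → ℝ} (h : DependentOn (-B) C E) : DependentOn B C E := by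
  obtain ⟨⟨b, hb⟩, he, h⟩ := h
  exact ⟨⟨-b, by rw [neg_smul, ← hb, neg_neg]⟩, he, by simpa using h⟩

namespace Data

/-- The transformation with the roles of the two systems interchanged. -/
def swap (𝓓 : Data M₁ M₂ P) : Data M₂ M₁ P :=
  ⟨𝓓.I₂, 𝓓.I₁, 𝓓.C₂₂, 𝓓.C₂₁, 𝓓.C₁₂, 𝓓.C₁₁, 𝓓.π₂, 𝓓.π₁, 𝓓.lam⟩

variable {𝓓 : Data M₁ M₂ P}

theorem K_swap (p : P) : 𝓓.swap.K p = 𝓓.K p := by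
  rw [K, K, sup_comm (𝓓.pull₁ 𝓓.I₁.one p)]
  rfl

theorem IsParametricBacklund.swap (h : 𝓓.IsParametricBacklund) :
    𝓓.swap.IsParametricBacklund where
  hyperbolic₁ := h.hyperbolic₂
  hyperbolic₂ := h.hyperbolic₁
  characteristic₁ := h.characteristic₂.symm
  characteristic₂ := h.characteristic₁.symm
  smooth_π₁ := h.smooth_π₂
  smooth_π₂ := h.smooth_π₁
  smooth_lam := h.smooth_lam
  embedding := (((Homeomorph.prodAssoc M₁ M₂ ℝ).symm.trans
    ((Homeomorph.prodComm M₁ M₂).prodCongr (Homeomorph.refl ℝ))).trans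
    (Homeomorph.prodAssoc M₂ M₁ ℝ)).isEmbedding.comp h.embedding
  immersion p v h1 h2 := h.immersion p v h2 h1
  dlam_ne_zero := h.dlam_ne_zero
  submersion₁ := h.submersion₂
  submersion₂ := h.submersion₁
  same_span p := by
    rw [K_swap]
    exact (h.same_span p).symm
  indep p U₁ U₂ θ₁ Ψ₁ θ₂ Ψ₂ hU₁ hp₁ g₁ hU₂ hp₂ g₂ s t hst := by
    rw [K_swap] at hst
    refine (h.indep p U₂ U₁ θ₂ Ψ₂ θ₁ Ψ₁ hU₂ hp₂ g₂ hU₁ hp₁ g₁ t s ?_).symm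
    have e : t • pullBil (𝓓.dπ₁ p) (extD θ₂ (𝓓.π₁ p)) + s • pullBil (𝓓.dπ₂ p) (extD θ₁ (𝓓.π₂ p)) =
        s • pullBil (𝓓.dπ₂ p) (extD θ₁ (𝓓.π₂ p)) +
          t • pullBil (𝓓.dπ₁ p) (extD θ₂ (𝓓.π₁ p)) := by
      ext u v
      simp only [add_apply]
      ring
    rw [e]
    exact hst
  numbering₁ p := by
    rw [K_swap]
    exact (h.numbering₂ p).symm
  numbering₂ p := by
    rw [K_swap]
    exact (h.numbering₁ p).symm

theorem IsSection.of_swap {U : Set P} {σ : Coframing P} {A : P → Fin 2 → ℝ} {D : P → Fin 4 → ℝ}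
    (h : 𝓓.swap.IsSection U σ A D) :
    𝓓.IsSection U σ.swap (fun q => ![A q 1, A q 0])
      (fun q => ![D q 2, D q 3, D q 0, D q 1]) where
  smooth_ζ := h.smooth_ζ
  smooth_θ₁ := h.smooth_θ₂
  smooth_θ₂ := h.smooth_θ₁
  smooth_ω₁ := h.smooth_ω₃
  smooth_ω₂ := h.smooth_ω₄
  smooth_ω₃ := h.smooth_ω₁
  smooth_ω₄ := h.smooth_ω₂
  coframe q hq := by
    have := (h.coframe q hq).comp (![0, 2, 1, 5, 6, 3, 4] : Fin 7 → Fin 7) (by decide)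
    convert this using 1
    ext i
    fin_cases i <;> rfl
  ζ_mem := h.ζ_mem
  θ₁_mem := h.θ₂_mem
  θ₂_mem := h.θ₁_mem
  C₁₁_eq := h.C₂₂_eq
  C₂₂_eq := h.C₁₁_eq
  dθ₁_eq q hq := by
    have := h.dθ₂_eq q hq
    rw [bil_add_right_comm] at this
    exact this
  dθ₂_eq q hq := by
    have := h.dθ₁_eq q hq
    rw [bil_add_right_comm] at this
    exact this
  C₁₂_eq := h.C₂₁_eq
  C₂₁_eq := h.C₁₂_eq

theorem dependentOn_of_swap
    (htor : ∀ (p : P), ∀ u ∈ 𝓓.𝒢 p, ∀ B C E : Fin 2 → ℝ,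
      𝓓.IsTorsion₃₄ p u B C E → DependentOn B C E) (p : P) {u : Fin 7 → Cov 7}
    {B C E : Fin 2 → ℝ} (h : 𝓓.swap.IsTorsion₁₂ p u B C E) : DependentOn B C E := by
  obtain ⟨U, σ, A, D, hU, hp, hσ, -, ht⟩ := h
  refine (htor p _ ⟨U, σ.swap, _, _, hU, hp, hσ.of_swap, rfl⟩ (-B) C E
    ⟨U, σ.swap, _, _, hU, hp, hσ.of_swap, rfl, fun i => ?_⟩).of_neg
  have e : (-B) i • wedge (σ.θ₂ p) (σ.θ₁ p) = B i • wedge (σ.θ₁ p) (σ.θ₂ p) := by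
    ext v w
    simp only [smul_apply, smul_eq_mul, wedge_apply, Pi.neg_apply]
    ring
  have := ht i
  rw [← e] at this
  exact this

end Data

end Backlund

theorem mainTheorem1 {M₁ M₂ P : Type*}
    [TopologicalSpace M₁] [ChartedSpace (EuclideanSpace ℝ (Fin 5)) M₁] [IsManifold (𝓡 5) ∞ M₁]
    [TopologicalSpace M₂] [ChartedSpace (EuclideanSpace ℝ (Fin 5)) M₂] [IsManifold (𝓡 5) ∞ M₂]
    [TopologicalSpace P] [ChartedSpace (EuclideanSpace ℝ (Fin 7)) P] [IsManifold (𝓡 7) ∞ P]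
    (𝓓 : Backlund.Data M₁ M₂ P) (h𝓓 : 𝓓.IsParametricBacklund) :
    ((∀ (p : P), ∀ u ∈ 𝓓.𝒢 p, ∀ B C E : Fin 2 → ℝ,
        𝓓.IsTorsion₁₂ p u B C E → Backlund.DependentOn B C E) →
      ∀ p : P, Backlund.HasIntegrableLineNear 𝓓.C₁₁ (𝓓.π₁ p) ∧
        Backlund.HasIntegrableLineNear 𝓓.C₂₁ (𝓓.π₂ p)) ∧
    ((∀ (p : P), ∀ u ∈ 𝓓.𝒢 p, ∀ B C E : Fin 2 → ℝ,
        𝓓.IsTorsion₃₄ p u B C E → Backlund.DependentOn B C E) →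
      ∀ p : P, Backlund.HasIntegrableLineNear 𝓓.C₁₂ (𝓓.π₁ p) ∧
        Backlund.HasIntegrableLineNear 𝓓.C₂₂ (𝓓.π₂ p)) :=
  ⟨h𝓓.hasIntegrableLineNear, fun htor p =>
    -- The interchange takes `𝒞₂₂, 𝒞₁₂` to the roles of `𝒞₁₁, 𝒞₂₁`; the final `symm` restores the
    -- order of the conclusions.
    (h𝓓.swap.hasIntegrableLineNear
      (fun q _ _ _ _ _ ht => Backlund.Data.dependentOn_of_swap htor q ht) p).symm⟩
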